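/- A discounted-sum automaton (over finite words) is a tuple $\mathcal{A}=\langle\Sigma,Q,q_{in},Q_F,\delta,\gamma,\lambda\rangle$ with a finite alphabet $\Sigma$, a finite set of states $Q$, an initial state $q_{in}\in Q$, a set of accepting states $Q_F\subseteq Q$, a transition relation $\delta\subseteq Q\times\Sigma\times Q$, a weight function $\gamma:\delta\to\mathbb{Q}$ and a rational discount factor $0<\lambda<1$. A run of $\mathcal{A}$ on a finite word $w=\sigma_1\cdots\sigma_n$ is a sequence of states $q_0,\dots,q_n$ with $q_0=q_{in}$ and $(q_i,\sigma_{i+1},q_{i+1})\in\delta$ for all $0\le i<n$; it is accepting if $q_n\in Q_F$, and its value is $\sum_{i=0}^{n-1}\lambda^i\,\gamma(q_i,\sigma_{i+1},q_{i+1})$. The value $\mathcal{A}(w)$ is the infimum of the values of the accepting runs of $\mathcal{A}$ on $w$ (so $\mathcal{A}(w)=\infty$ if there is none). The automaton is functional if, for every finite word $w$, all accepting runs on $w$ have the same value; unambiguous if every finite word has at most one accepting run; deterministic if for every state $q$ and letter $\sigma$ there is at most one $q'$ with $(q,\sigma,q')\in\delta$. Theorem. The following problem is decidable in PSPACE: given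 a functional discounted-sum automaton $\mathcal{A}$ and a value $t\in\mathbb{Q}$, is there a finite word $w$ with $\mathcal{A}(w)=t$? The same holds for unambiguous automata, and for deterministic automata. (The input is an explicit list of the components of $\mathcal{A}$, together with $t$, with all numbers in binary, rationals as numerator and denominator in lowest terms. The assumption that $\mathcal{A}$ is functional, respectively unambiguous or deterministic, is a promise on the input: there is a deterministic Turing machine that halts on every input string, uses space polynomial in the length of the input string, and answers correctly on every input that encodes a pair $(\mathcal{A},t)$ with $\mathcal{A}$ in the class.) -/

import Mathlib

/-! ## Discounted-sum automata over finite words -/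

/-- A (nondeterministic) discounted-sum automaton over the alphabet `α` with state set `Q`:
an initial state, a set of accepting states, a transition relation `δ ⊆ Q × α × Q`,
a rational weight on every transition, and a rational discount factor `0 < lam < 1`.
Finiteness of `α` and `Q` is imposed where automata are used. -/
structure DSA (α Q : Type*) where
  init : Q
  accept : Finset Q
  δ : Finset (Q × α × Q)
  γ : {e : Q × α × Q // e ∈ δ} → ℚ
  lam : ℚ
  lam_pos : 0 < lam
  lam_lt_one : lam < 1

namespace DSA

variable {α Q : Type*}

/-- A run of `A` on the finite word `w = σ₁ … σₙ`: states `q₀, …, qₙ` with `q₀` initial and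
`(qᵢ, σᵢ₊₁, qᵢ₊₁) ∈ δ` for all `i < n`. -/
structure Run (A : DSA α Q) (w : List α) where
  state : Fin (w.length + 1) → Q
  start : state 0 = A.init
  step : ∀ i : Fin w.length, (state i.castSucc, w.get i, state i.succ) ∈ A.δ

namespace Run

variable {A : DSA α Q} {w : List α}

/-- The last state of the run is accepting. -/
def IsAccepting (r : A.Run w) : Prop :=
  r.state (Fin.last w.length) ∈ A.accept

/-- The value of a run: the discounted sum of the weights of its transitions. -/
def value (r : A.Run w) : ℚ :=
  ∑ i : Fin w.length, A.lam ^ (i : ℕ) * A.γ ⟨_, r.step i⟩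

end Run

/-- The value of a finite word: the infimum of the values of the accepting runs on it,
which is `⊤ = ∞` if there is no accepting run. -/
noncomputable def value (A : DSA α Q) (w : List α) : EReal :=
  ⨅ (r : A.Run w) (_ : r.IsAccepting), ((r.value : ℝ) : EReal)

/-- All accepting runs on the same word have the same value. -/
def IsFunctional (A : DSA α Q) : Prop :=
  ∀ (w : List α) (r r' : A.Run w), r.IsAccepting → r'.IsAccepting → r.value = r'.value

/-- Every word has at most one accepting run. -/
def IsUnambiguous (A : DSA α Q) : Prop :=
  ∀ (w : List α) (r r' : A.Run w), r.IsAccepting → r'.IsAccepting → r = r'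

/-- From every state there is at most one transition with a given letter. -/
def IsDeterministic (A : DSA α Q) : Prop :=
  ∀ (q : Q) (a : α) (q₁ q₂ : Q), (q, a, q₁) ∈ A.δ → (q, a, q₂) ∈ A.δ → q₁ = q₂

end DSA

/-! ## Polynomial space -/

/-- A language over a finite alphabet is in PSPACE if some deterministic multi-stack Turing
machine with finite stack alphabets halts on every input `x`, with output `true` if `x ∈ L` and
`false` if `x ∉ L`, and if throughout the computation on `x` the total length of all stacks
is bounded by a fixed polynomial in the length of `x`. -/
def InPSPACE {Γ : Type} [Fintype Γ] (L : Language Γ) : Prop :=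
  ∃ (M : Turing.TM2ComputableAux Γ Bool) (p : Polynomial ℕ),
    (∀ k, Finite (M.tm.Γ k)) ∧
    ∀ x : List Γ,
      (x ∈ L → Nonempty (Turing.TM2Outputs M.tm (x.map M.inputAlphabet.symm)
        (some ([true].map M.outputAlphabet.symm)))) ∧
      (x ∉ L → Nonempty (Turing.TM2Outputs M.tm (x.map M.inputAlphabet.symm)
        (some ([false].map M.outputAlphabet.symm)))) ∧
      ∀ c : M.tm.Cfg,
        StateTransition.Reaches M.tm.step
          (Turing.initList M.tm (x.map M.inputAlphabet.symm)) c →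
        ∑ k ∈ @Finset.univ M.tm.K M.tm.kFin, (Turing.TM2.Cfg.stk c k).length ≤ p.eval x.length

/-- The decision problem that asks, of an instance `i` given by its code `enc i` and known to be
in the class `C`, whether `Yes i` holds, is decidable in PSPACE: some language in PSPACE contains
the code of an instance in the class exactly if the answer for it is yes. -/
def DecidableInPSPACEOn {I Γ : Type} [Fintype Γ] (enc : I → List Γ) (C Yes : I → Prop) : Prop :=
  ∃ L : Language Γ, InPSPACE L ∧ ∀ i, C i → (enc i ∈ L ↔ Yes i)

/-! ## Instances of the exact-value problem and their codes -/

/-- An instance of the exact-value problem: a finite discounted-sum automaton, with its letters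
and its states numbered, and a rational target value. -/
structure ExactValueInstance where
  letters : ℕ
  states : ℕ
  aut : DSA (Fin letters) (Fin states)
  target : ℚ

/-- There is a finite word whose value is the target. -/
def ExactValueInstance.HasSolution (I : ExactValueInstance) : Prop :=
  ∃ w : List (Fin I.letters), I.aut.value w = ((I.target : ℝ) : EReal)

/-- The symbols used in codes of instances: binary digits, a symbol that ends a number, and a
symbol that ends a list. -/
inductive CodeSym : Type
  | bit (b : Bool)
  | endNum
  | endList
  deriving DecidableEq, Fintype

/-- Natural numbers are written in binary. -/
def codeNat (n : ℕ) : List CodeSym :=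
  (Computability.encodeNat n).map CodeSym.bit ++ [CodeSym.endNum]

/-- A rational number is written as its sign, its numerator and its denominator in lowest
terms, in binary. -/
def codeRat (r : ℚ) : List CodeSym :=
  CodeSym.bit (decide (r < 0)) :: (codeNat r.num.natAbs ++ codeNat r.den)

/-- A transition and its weight. -/
def codeTransition {k n : ℕ} (A : DSA (Fin k) (Fin n))
    (e : {e : Fin n × Fin k × Fin n // e ∈ A.δ}) : List CodeSym :=
  codeNat e.1.1.val ++ codeNat e.1.2.1.val ++ codeNat e.1.2.2.val ++ codeRat (A.γ e)

/-- The code of an instance: the number of letters, the number of states, the initial state,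
the list of accepting states, the list of transitions with their weights, the discount factor
and the target. -/
def codeInstance (I : ExactValueInstance) : List CodeSym :=
  codeNat I.letters ++ codeNat I.states ++ codeNat I.aut.init.val ++
  (((List.finRange I.states).filter (fun q => q ∈ I.aut.accept)).flatMap (fun q : Fin I.states => codeNat q.val)
    ++ [CodeSym.endList]) ++
  ((List.finRange I.states ×ˢ (List.finRange I.letters ×ˢ List.finRange I.states)).flatMap
      (fun e => if h : e ∈ I.aut.δ then codeTransition I.aut ⟨e, h⟩ else [])
    ++ [CodeSym.endList]) ++
  codeRat I.aut.lam ++ codeRat I.target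

open Function Relation

set_option linter.unusedSimpArgs false

/-! Attach to a state the gap: the value that the rest of the word still has to contribute. A
transition of weight `γ` from gap `g` leads to the gap `g'` with `λ g' + γ = g`, and the empty word
contributes `0`. So some word has an accepting run of value `t` exactly if, in the infinite graph of
pairs (state, gap), a path leads from the initial state with gap `t` to an accepting state with gap
`0` (`DSA.exists_run_iff`). In a functional automaton the value of a word is the value of any
accepting run on it (`DSA.IsFunctional.value_eq_iff`), and unambiguous and deterministic automata
are functional.

The graph can be cut down to exponential size. Let `λ = p / q` in lowest terms and let `D` be the
product of the denominators of the target and the weights. Going forward from the target, `g' = q (g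
- γ) / p`, so `D g` becomes an integer after multiplication by a power of `p` (`Reached.step`).
Going backward from gap `0`, `g = (p g' + q γ) / q`, so `D g` becomes an integer after
multiplication by a power of `q` (`Reaching.step`). Since `p` and `q` are coprime, `D g` is an
integer at every vertex of a successful path. Going backward also gives `|g| ≤ M / (1 - λ) ≤ M q`,
where `M` bounds the weights. Hence all gaps on successful paths have numerators and denominators of
length linear in the input (`canon_lt_of_reached_reaching`, `path_canon`), and the vertices become
numbers with linearly many digits.

Reachability there is decided by Savitch's recursion: a walk of length `2 ^ (k + 1)` is two walks of
length `2 ^ k` through a midpoint. The recursion is run as the iteration of one step function,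
`savStep`, whose stacks are numbers of polynomial length (`savStep_call`, `SavInv.step`).

For the machine model, `PS` collects the functions computed by register programs whose values have
polynomial binary length. It is closed under composition, pairing and iteration, even with
exponentially many rounds, as long as all iterates stay short (`PS.iterate_poly`); arithmetic,
parsing and Savitch's search are all built by iteration. A stack machine with one stack of bits per
register simulates such a program (`Prog.Exec.reaches`, `InPSPACE.of_prog`). -/

/-! ## Register programs -/

/-- Structured programs over registers that hold natural numbers. -/
inductive Prog : Type
  | skip
  | inc (r : ℕ)
  | dec (r : ℕ)
  | seq (p q : Prog)
  | ite (r : ℕ) (p q : Prog)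
  | loop (r : ℕ) (p : Prog)

namespace Prog

/-- `Exec M p s s'`: the program `p`, started with register contents `s`, halts with contents `s'`
and never increments a register beyond `M`. -/
inductive Exec (M : ℕ) : Prog → (ℕ → ℕ) → (ℕ → ℕ) → Prop
  | skip (s) : Exec M skip s s
  | inc (r s) : s r + 1 ≤ M → Exec M (inc r) s (update s r (s r + 1))
  | dec (r s) : Exec M (dec r) s (update s r (s r - 1))
  | seq {p q s t u} : Exec M p s t → Exec M q t u → Exec M (seq p q) s u
  | ite_pos {r p q s t} : s r ≠ 0 → Exec M p s t → Exec M (ite r p q) s t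
  | ite_neg {r p q s t} : s r = 0 → Exec M q s t → Exec M (ite r p q) s t
  | loop_zero {r p s} : s r = 0 → Exec M (loop r p) s s
  | loop_step {r p s t u} : s r ≠ 0 → Exec M p s t → Exec M (loop r p) t u → Exec M (loop r p) s u

/-- A strict upper bound on the registers that occur in a program. -/
def bound : Prog → ℕ
  | skip => 0
  | inc r => r + 1
  | dec r => r + 1
  | seq p q => max p.bound q.bound
  | ite r p q => max (r + 1) (max p.bound q.bound)
  | loop r p => max (r + 1) p.bound

/-- Only increments can raise a register, and `Exec` guards each of them by `M`. -/
theorem Exec.le {M : ℕ} {p : Prog} {s t : ℕ → ℕ} (h : Exec M p s t) (hs : ∀ i, s i ≤ M) :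
    ∀ i, t i ≤ M := by
  induction h with
  | skip | loop_zero => exact hs
  | inc r s h =>
    intro i
    by_cases hi : i = r
    · subst hi; simpa using h
    · simpa [hi] using hs i
  | dec r s =>
    intro i
    by_cases hi : i = r
    · subst hi; simpa using (Nat.sub_le _ _).trans (hs i)
    · simpa [hi] using hs i
  | seq _ _ ih₁ ih₂ | loop_step _ _ _ ih₁ ih₂ => exact ih₂ (ih₁ hs)
  | ite_pos _ _ ih | ite_neg _ _ ih => exact ih hs

/-- The program points of a program. -/
def Lbl : Prog → Type
  | skip => Unit
  | inc _ => Bool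
  | dec _ => Bool
  | seq p q => Lbl p ⊕ Lbl q
  | ite _ p q => Option (Lbl p ⊕ Lbl q)
  | loop _ p => Option (Lbl p)

instance lblFintype : (p : Prog) → Fintype (Lbl p)
  | skip => inferInstanceAs (Fintype Unit)
  | inc _ => inferInstanceAs (Fintype Bool)
  | dec _ => inferInstanceAs (Fintype Bool)
  | seq p q =>
    letI := lblFintype p; letI := lblFintype q; inferInstanceAs (Fintype (Lbl p ⊕ Lbl q))
  | ite _ p q =>
    letI := lblFintype p; letI := lblFintype q
    inferInstanceAs (Fintype (Option (Lbl p ⊕ Lbl q)))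
  | loop _ p => letI := lblFintype p; inferInstanceAs (Fintype (Option (Lbl p)))

/-- The first program point of a program. -/
def entry : (p : Prog) → Lbl p
  | skip => ()
  | inc _ => false
  | dec _ => false
  | seq p _ => Sum.inl (entry p)
  | ite _ _ _ => none
  | loop _ _ => none

end Prog

/-! ## Stack machines that run register programs -/

/-- The stacks of the machine: the input, a scratch stack, and one stack for every register. -/
inductive MStack (R : ℕ) : Type
  | inp
  | aux
  | reg (i : Fin R)
  deriving DecidableEq, Fintype

/-- The stack alphabets. -/
abbrev MAlph (R : ℕ) : MStack R → Type
  | .inp => CodeSym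
  | .aux => Bool
  | .reg _ => Bool

/-- The contents of all stacks. -/
def mkStk {R : ℕ} (x : List CodeSym) (a : List Bool) (s : Fin R → List Bool) :
    ∀ k : MStack R, List (MAlph R k)
  | .inp => x
  | .aux => a
  | .reg i => s i

section mkStk
variable {R : ℕ} (x : List CodeSym) (a : List Bool) (s : Fin R → List Bool)

@[simp] theorem mkStk_inp : mkStk x a s .inp = x := rfl
@[simp] theorem mkStk_aux : mkStk x a s .aux = a := rfl
@[simp] theorem mkStk_reg (i) : mkStk x a s (.reg i) = s i := rfl

theorem update_mkStk_inp (y : List CodeSym) :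
    update (mkStk x a s) .inp y = mkStk y a s := by
  funext k; cases k <;> rfl

theorem update_mkStk_aux (b : List Bool) :
    update (mkStk x a s) .aux b = mkStk x b s := by
  funext k; cases k <;> rfl

theorem update_mkStk_reg (i : Fin R) (b : List Bool) :
    update (mkStk x a s) (.reg i) b = mkStk x a (update s i b) := by
  funext k
  cases k with
  | inp => rfl
  | aux => rfl
  | reg j =>
    by_cases h : j = i
    · subst h; exact (update_self _ _ _).trans (update_self j b s).symm
    · have h' : (MStack.reg j : MStack R) ≠ .reg i := by simpa using h
      exact (update_of_ne h' _ _).trans (update_of_ne h _ _).symm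

end mkStk

/-- Statements of the machine; its finite memory holds the symbol read last. -/
abbrev MStmt (R : ℕ) (Λ : Type) := Turing.TM2.Stmt (MAlph R) Λ (Option CodeSym)

/-- Configurations of the machine. -/
abbrev MCfg (R : ℕ) (Λ : Type) := Turing.TM2.Cfg (MAlph R) Λ (Option CodeSym)

/-! ### Effect of single machine instructions on the stacks. -/

section stepAux
variable {R : ℕ} {Λ : Type} (x : List CodeSym) (a : List Bool) (s : Fin R → List Bool)
  (v : Option CodeSym) (q : MStmt R Λ)

@[simp high] theorem stepAux_pop_inp (f : Option CodeSym → Option CodeSym → Option CodeSym) :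
    Turing.TM2.stepAux (.pop .inp f q : MStmt R Λ) v (mkStk x a s) =
      Turing.TM2.stepAux q (f v x.head?) (mkStk x.tail a s) :=
  congrArg (Turing.TM2.stepAux q _) (update_mkStk_inp _ _ _ _)

@[simp high] theorem stepAux_pop_aux (f : Option CodeSym → Option Bool → Option CodeSym) :
    Turing.TM2.stepAux (.pop .aux f q : MStmt R Λ) v (mkStk x a s) =
      Turing.TM2.stepAux q (f v a.head?) (mkStk x a.tail s) :=
  congrArg (Turing.TM2.stepAux q _) (update_mkStk_aux _ _ _ _)

@[simp high] theorem stepAux_pop_reg (r : Fin R)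
    (f : Option CodeSym → Option Bool → Option CodeSym) :
    Turing.TM2.stepAux (.pop (.reg r) f q : MStmt R Λ) v (mkStk x a s) =
      Turing.TM2.stepAux q (f v (s r).head?) (mkStk x a (update s r (s r).tail)) :=
  congrArg (Turing.TM2.stepAux q _) (update_mkStk_reg _ _ _ _ _)

@[simp high] theorem stepAux_peek_reg (r : Fin R)
    (f : Option CodeSym → Option Bool → Option CodeSym) :
    Turing.TM2.stepAux (.peek (.reg r) f q : MStmt R Λ) v (mkStk x a s) =
      Turing.TM2.stepAux q (f v (s r).head?) (mkStk x a s) := rfl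

@[simp high] theorem stepAux_push_aux (f : Option CodeSym → Bool) :
    Turing.TM2.stepAux (.push .aux f q : MStmt R Λ) v (mkStk x a s) =
      Turing.TM2.stepAux q v (mkStk x (f v :: a) s) :=
  congrArg (Turing.TM2.stepAux q _) (update_mkStk_aux _ _ _ _)

@[simp high] theorem stepAux_push_reg (r : Fin R) (f : Option CodeSym → Bool) :
    Turing.TM2.stepAux (.push (.reg r) f q : MStmt R Λ) v (mkStk x a s) =
      Turing.TM2.stepAux q v (mkStk x a (update s r (f v :: s r))) :=
  congrArg (Turing.TM2.stepAux q _) (update_mkStk_reg _ _ _ _ _)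

end stepAux

/-- Read a bit into the finite memory. -/
def readBit (_ : Option CodeSym) (o : Option Bool) : Option CodeSym := o.map CodeSym.bit

open Turing.TM2.Stmt in
/-- The machine code of a program, given the names of its program points and the exit label. -/
def Prog.code {R : ℕ} {Λ : Type} :
    (p : Prog) → (p.Lbl → Λ) → Λ → p.Lbl → MStmt (R + 1) Λ
  | .skip, _, ex, _ => goto fun _ => ex
  -- Point `false` carries: leading ones are popped, each leaving a zero on the scratch stack, until
  -- a zero or the end is replaced by a one. Point `true` puts the zeros back.
  | .inc r, emb, _, false =>
    pop (.reg (Fin.ofNat (R + 1) r)) readBit <|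
      branch (fun v => decide (v = some (.bit true)))
        (push .aux (fun _ => false) <| goto fun _ => emb false)
        (push (.reg (Fin.ofNat (R + 1) r)) (fun _ => true) <| goto fun _ => emb true)
  | .inc r, emb, ex, true =>
    pop .aux readBit <|
      branch (fun v => v.isSome)
        (push (.reg (Fin.ofNat (R + 1) r)) (fun _ => false) <| goto fun _ => emb true)
        (goto fun _ => ex)
  -- The borrow is dual. The final one becomes a zero only if higher bits remain, which keeps the
  -- representation free of leading zeros.
  | .dec r, emb, _, false =>
    pop (.reg (Fin.ofNat (R + 1) r)) readBit <|
      branch (fun v => decide (v = some (.bit false)))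
        (push .aux (fun _ => false) <| goto fun _ => emb false)
        (branch (fun v => v.isSome)
          (peek (.reg (Fin.ofNat (R + 1) r)) readBit <|
            branch (fun v => v.isSome)
              (push (.reg (Fin.ofNat (R + 1) r)) (fun _ => false) <| goto fun _ => emb true)
              (goto fun _ => emb true))
          (goto fun _ => emb true))
  | .dec r, emb, ex, true =>
    pop .aux readBit <|
      branch (fun v => v.isSome)
        (push (.reg (Fin.ofNat (R + 1) r)) (fun _ => true) <| goto fun _ => emb true)
        (goto fun _ => ex)
  | .seq p q, emb, _, .inl l =>
    p.code (fun l => emb (.inl l)) (emb (.inr q.entry)) l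
  | .seq _ q, emb, ex, .inr l => q.code (fun l => emb (.inr l)) ex l
  | .ite r p q, emb, _, none =>
    peek (.reg (Fin.ofNat (R + 1) r)) readBit <|
      branch (fun v => v.isSome) (goto fun _ => emb (some (.inl p.entry)))
        (goto fun _ => emb (some (.inr q.entry)))
  | .ite _ p _, emb, ex, some (.inl l) => p.code (fun l => emb (some (.inl l))) ex l
  | .ite _ _ q, emb, ex, some (.inr l) => q.code (fun l => emb (some (.inr l))) ex l
  | .loop r p, emb, ex, none =>
    peek (.reg (Fin.ofNat (R + 1) r)) readBit <|
      branch (fun v => v.isSome) (goto fun _ => emb (some p.entry)) (goto fun _ => ex)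
  | .loop _ p, emb, _, some l => p.code (fun l => emb (some l)) (emb none) l

/-! ### Binary successor and predecessor on stacks. -/

section Simulation

variable {R : ℕ} {Λ : Type} (M : Λ → MStmt (R + 1) Λ)

/-- All stacks have length at most `N`. -/
def Short (N : ℕ) (c : MCfg (R + 1) Λ) : Prop := ∀ k, (c.stk k).length ≤ N

theorem short_mk {N : ℕ} {l : Option Λ} {v : Option CodeSym} {x : List CodeSym} {a : List Bool}
    {s : Fin (R + 1) → List Bool} (hx : x.length ≤ N) (ha : a.length ≤ N)
    (hs : ∀ i, (s i).length ≤ N) : Short N (⟨l, v, mkStk x a s⟩ : MCfg (R + 1) Λ) := by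
  intro k; cases k
  · exact hx
  · exact ha
  · exact hs _

/-- Reachability through configurations with short stacks. -/
def ShortReaches (N : ℕ) : MCfg (R + 1) Λ → MCfg (R + 1) Λ → Prop :=
  ReflTransGen fun a b => b ∈ Turing.TM2.step M a ∧ Short N b

variable {M}

theorem ShortReaches.reaches {N : ℕ} {a b : MCfg (R + 1) Λ} (h : ShortReaches M N a b) :
    StateTransition.Reaches (Turing.TM2.step M) a b :=
  ReflTransGen.mono (fun _ _ h => h.1) _ _ h

/-- The machine is deterministic, so every configuration reachable from `a` lies on the one
computation that ends in the halting `b`. Space bounds need only be checked along that computation.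
-/
theorem ShortReaches.short {N : ℕ} {a b c : MCfg (R + 1) Λ} (h : ShortReaches M N a b)
    (ha : Short N a) (hb : Turing.TM2.step M b = none)
    (hc : StateTransition.Reaches (Turing.TM2.step M) a c) : Short N c := by
  induction h using ReflTransGen.head_induction_on with
  | refl =>
    rcases ReflTransGen.cases_head hc with rfl | ⟨d, hd, _⟩
    · exact ha
    · rw [hb] at hd; cases hd
  | head h' _ ih =>
    rcases ReflTransGen.cases_head hc with rfl | ⟨d, hd, hdc⟩
    · exact ha
    · have := Option.mem_unique h'.1 hd
      subst this
      exact ih h'.2 hdc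

theorem ShortReaches.step {N : ℕ} {l : Λ} {v : Option CodeSym} {S : ∀ k, List (MAlph (R + 1) k)}
    {c d : MCfg (R + 1) Λ} (e : Turing.TM2.stepAux (M l) v S = c) (hs : Short N c)
    (h : ShortReaches M N c d) : ShortReaches M N ⟨some l, v, S⟩ d := by
  subst e; exact ReflTransGen.head ⟨rfl, hs⟩ h

theorem ShortReaches.single {N : ℕ} {l : Λ} {v : Option CodeSym}
    {S : ∀ k, List (MAlph (R + 1) k)} {c : MCfg (R + 1) Λ}
    (e : Turing.TM2.stepAux (M l) v S = c) (hs : Short N c) :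
    ShortReaches M N ⟨some l, v, S⟩ c := .step e hs .refl

/-- The stacks that represent the register contents `s`. -/
def regStk (s : ℕ → ℕ) : Fin (R + 1) → List Bool := fun i => (s i).bits

theorem update_regStk (s : ℕ → ℕ) {r : ℕ} (hr : r ≤ R) (m : ℕ) (l : List Bool) (hl : l = m.bits) :
    update (regStk (R := R) s) (Fin.ofNat (R + 1) r) l = regStk (update s r m) := by
  subst hl
  funext i
  by_cases h : i = Fin.ofNat (R + 1) r
  · subst h
    have : r % (R + 1) = r := Nat.mod_eq_of_lt (by omega)
    simp [regStk, this]
  · have h' : (i : ℕ) ≠ r := by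
      rintro rfl; apply h; ext; simp
    rw [update_of_ne h]; simp [regStk, h']

theorem regStk_ofNat (s : ℕ → ℕ) {r : ℕ} (hr : r ≤ R) :
    regStk (R := R) s (Fin.ofNat (R + 1) r) = (s r).bits := by
  have : r % (R + 1) = r := Nat.mod_eq_of_lt (by omega)
  simp [regStk, this]

theorem bits_length_mono {m n : ℕ} (h : m ≤ n) : m.bits.length ≤ n.bits.length := by
  rw [Nat.size_eq_bits_len, Nat.size_eq_bits_len]; exact Nat.size_le_size h

theorem regStk_length {s : ℕ → ℕ} {M : ℕ} (hs : ∀ i, s i ≤ M) (i : Fin (R + 1)) :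
    (regStk s i).length ≤ M.size := by
  rw [← Nat.size_eq_bits_len]; exact bits_length_mono (hs i)

theorem update_length {N : ℕ} {S : Fin (R + 1) → List Bool} (hS : ∀ i, (S i).length ≤ N)
    {r : Fin (R + 1)} {b : List Bool} (hb : b.length ≤ N) :
    ∀ i, (update S r b i).length ≤ N := by
  intro i
  by_cases h : i = r
  · subst h; simpa using hb
  · simpa [h] using hS i

/-- The loop that moves the scratch stack back onto a register. -/
theorem restore_reaches {N : ℕ} {l ex : Λ} {r : Fin (R + 1)} {b : Bool}
    (hM : M l = .pop .aux readBit (.branch (fun v => v.isSome)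
        (.push (.reg r) (fun _ => b) <| .goto fun _ => l) (.goto fun _ => ex)))
    (x : List CodeSym) (hx : x.length ≤ N) (a : List Bool) (S : Fin (R + 1) → List Bool)
    (hS : ∀ i, (S i).length ≤ N) (ha : a.length + (S r).length ≤ N) (v : Option CodeSym) :
    ∃ v', ShortReaches M N ⟨some l, v, mkStk x a S⟩
      ⟨some ex, v', mkStk x [] (update S r (List.replicate a.length b ++ S r))⟩ := by
  induction a generalizing S v with
  | nil =>
    refine ⟨none, ShortReaches.single ?_ (short_mk hx (by simp) (by simpa using hS))⟩
    simp [hM, readBit]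
  | cons c a ih =>
    simp only [List.length_cons] at ha
    have hS' : ∀ i, (update S r (b :: S r) i).length ≤ N :=
      update_length hS (by simp only [List.length_cons]; omega)
    obtain ⟨v', h⟩ := ih (update S r (b :: S r)) hS' (by simp; omega) (some (.bit c))
    refine ⟨v', ShortReaches.step (c := ⟨some l, some (.bit c), mkStk x a (update S r (b :: S r))⟩)
      ?_ (short_mk hx (by omega) hS') ?_⟩
    · simp [hM, readBit]
    · simp only [update_idem, update_self] at h
      simpa [List.replicate_succ', List.append_assoc] using h

/-- The successor function on binary numbers, lowest bit first. -/
theorem carry_reaches {N : ℕ} {l l' : Λ} {r : Fin (R + 1)}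
    (hM : M l = .pop (.reg r) readBit (.branch (fun v => decide (v = some (.bit true)))
        (.push .aux (fun _ => false) <| .goto fun _ => l)
        (.push (.reg r) (fun _ => true) <| .goto fun _ => l')))
    (x : List CodeSym) (hx : x.length ≤ N) (n : ℕ) (a : List Bool) (S : Fin (R + 1) → List Bool)
    (hn : S r = n.bits)
    (hS : ∀ i, (S i).length ≤ N) (ha : a.length + (n + 1).bits.length ≤ N) (v : Option CodeSym) :
    ∃ v' a' b, ShortReaches M N ⟨some l, v, mkStk x a S⟩
      ⟨some l', v', mkStk x a' (update S r b)⟩ ∧ a'.length + b.length ≤ N ∧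
      List.replicate a'.length false ++ b = List.replicate a.length false ++ (n + 1).bits := by
  -- Restoring pushes a constant bit, so only the length of the scratch stack matters; this is why
  -- the conclusion compares replicated bits.
  induction n using Nat.binaryRec generalizing S a v with
  | zero =>
    simp only [Nat.zero_bits] at hn
    refine ⟨none, a, [true], ShortReaches.single ?_ (short_mk hx (by omega) (update_length hS ?_)),
      by simpa using ha, by simp⟩
    · simp [hM, readBit, hn]
    · simp at ha ⊢; omega
  | bit c n ih =>
    -- The induction also offers `0` as `bit false 0`, whose list of bits is empty.
    have hb : (Nat.bit c n).bits = c :: n.bits ∨ Nat.bit c n = 0 := by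
      by_cases h : Nat.bit c n = 0
      · exact .inr h
      · exact .inl (Nat.bits_append_bit _ _ (by rintro rfl; cases c <;> simp_all [Nat.bit]))
    rcases hb with hb | hb
    · rw [hb] at hn
      cases c with
      | false =>
        have e : (Nat.bit false n + 1).bits = true :: n.bits := by
          rw [← Nat.bit1_bits]; simp [Nat.bit]
        rw [e] at ha ⊢
        refine ⟨some (.bit false), a, true :: n.bits,
          ShortReaches.single ?_ (short_mk hx (by omega) (update_length hS ?_)), ha, rfl⟩
        · simp [hM, readBit, hn]
        · simp at ha ⊢; omega
      | true =>
        have e : (Nat.bit true n + 1).bits = false :: (n + 1).bits := by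
          rw [← Nat.bit0_bits _ (by simp)]; congr 1
        rw [e] at ha ⊢
        simp only [List.length_cons] at ha
        have hS' : ∀ i, (update S r n.bits i).length ≤ N :=
          update_length hS (by have := hS r; rw [hn] at this; simp at this; omega)
        obtain ⟨v', a', b, h, h1, h2⟩ := ih (false :: a) (update S r n.bits) (by simp) hS'
          (by simp; omega) (some (.bit true))
        simp only [update_idem] at h
        refine ⟨v', a', b, ShortReaches.step
          (c := ⟨some l, some (.bit true), mkStk x (false :: a) (update S r n.bits)⟩)
          ?_ (short_mk hx (by simp; omega) hS') h, h1, ?_⟩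
        · simp [hM, readBit, hn]
        · rw [h2]; simp [List.replicate_succ', List.append_assoc]
    · rw [hb] at hn ha ⊢
      simp only [Nat.zero_bits] at hn
      refine ⟨none, a, [true],
        ShortReaches.single ?_ (short_mk hx (by omega) (update_length hS ?_)),
        by simpa using ha, by simp⟩
      · simp [hM, readBit, hn]
      · simp at ha ⊢; omega

/-- The predecessor function on binary numbers, lowest bit first. -/
theorem borrow_reaches {N : ℕ} {l l' : Λ} {r : Fin (R + 1)}
    (hM : M l = .pop (.reg r) readBit (.branch (fun v => decide (v = some (.bit false)))
        (.push .aux (fun _ => false) <| .goto fun _ => l)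
        (.branch (fun v => v.isSome)
          (.peek (.reg r) readBit <|
            .branch (fun v => v.isSome)
              (.push (.reg r) (fun _ => false) <| .goto fun _ => l')
              (.goto fun _ => l'))
          (.goto fun _ => l'))))
    (x : List CodeSym) (hx : x.length ≤ N) (n : ℕ) (hn0 : n ≠ 0) (a : List Bool)
    (S : Fin (R + 1) → List Bool) (hn : S r = n.bits)
    (hS : ∀ i, (S i).length ≤ N) (ha : a.length + n.bits.length ≤ N) (v : Option CodeSym) :
    ∃ v' a' b, ShortReaches M N ⟨some l, v, mkStk x a S⟩
      ⟨some l', v', mkStk x a' (update S r b)⟩ ∧ a'.length + b.length ≤ N ∧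
      List.replicate a'.length true ++ b = List.replicate a.length true ++ (n - 1).bits := by
  induction n using Nat.binaryRec generalizing S a v with
  | zero => exact absurd rfl hn0
  | bit c n ih =>
    have hb : (Nat.bit c n).bits = c :: n.bits :=
      Nat.bits_append_bit _ _ (by rintro rfl; cases c <;> simp_all [Nat.bit])
    rw [hb] at hn ha
    simp only [List.length_cons] at ha
    cases c with
    | false =>
      have hn1 : n ≠ 0 := by rintro rfl; exact hn0 rfl
      have e : (Nat.bit false n - 1).bits = true :: (n - 1).bits := by
        rw [← Nat.bit1_bits]; congr 1; simp [Nat.bit]; omega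
      have hS' : ∀ i, (update S r n.bits i).length ≤ N :=
        update_length hS (by have := hS r; rw [hn] at this; simp at this; omega)
      obtain ⟨v', a', b, h, h1, h2⟩ := ih hn1 (false :: a) (update S r n.bits) (by simp) hS'
        (by simp; omega) (some (.bit false))
      simp only [update_idem] at h
      refine ⟨v', a', b, ShortReaches.step
        (c := ⟨some l, some (.bit false), mkStk x (false :: a) (update S r n.bits)⟩)
        ?_ (short_mk hx (by simp; omega) hS') h, h1, ?_⟩
      · simp [hM, readBit, hn]
      · rw [h2, e]; simp [List.replicate_succ', List.append_assoc]
    | true =>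
      -- If nothing lies above the removed one, the number was `1` and the stack stays empty;
      -- otherwise a zero takes its place.
      rcases h : n.bits with _ | ⟨d, t⟩
      · rw [h] at hn ha
        have : n = 0 := by
          by_contra h0
          have := Nat.size_pos.2 (Nat.pos_of_ne_zero h0)
          rw [← Nat.size_eq_bits_len, h] at this; simp at this
        subst this
        refine ⟨none, a, [], ShortReaches.single ?_ (short_mk hx (by omega)
          (update_length hS (by simp))), by simp; omega, by simp [Nat.bit]⟩
        simp [hM, readBit, hn]
      · have hn1 : n ≠ 0 := by rintro rfl; simp at h
        have e : (Nat.bit true n - 1).bits = false :: d :: t := by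
          rw [← h, ← Nat.bit0_bits _ hn1]; congr 1
        rw [h] at hn ha
        rw [e]
        simp only [List.length_cons] at ha
        refine ⟨some (.bit d), a, false :: d :: t, ShortReaches.single ?_ (short_mk hx (by omega)
          (update_length hS (by simp; omega))), by simp; omega, rfl⟩
        simp [hM, readBit, hn]

end Simulation

theorem Prog.Exec.mono {A B : ℕ} {q : Prog} {s t : ℕ → ℕ} (h : q.Exec A s t) (hAB : A ≤ B) :
    q.Exec B s t := by
  induction h with
  | skip s => exact .skip s
  | inc r s h => exact .inc r s (h.trans hAB)
  | dec r s => exact .dec r s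
  | seq _ _ h1 h2 => exact .seq h1 h2
  | ite_pos h _ h1 => exact .ite_pos h h1
  | ite_neg h _ h1 => exact .ite_neg h h1
  | loop_zero h => exact .loop_zero h
  | loop_step h _ _ h1 h2 => exact .loop_step h h1 h2

/-! ### Simulation of program executions. -/

section Simulation

variable {R : ℕ} {Λ : Type} {M : Λ → MStmt (R + 1) Λ}

/-- Binary representations have no leading zeros, so a register is zero exactly when its stack is
empty, and one peek decides the test. -/
theorem test_reaches {N : ℕ} {l l₁ l₂ : Λ} {r : ℕ}
    (hM : M l = .peek (.reg (Fin.ofNat (R + 1) r)) readBit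
      (.branch (fun v => v.isSome) (.goto fun _ => l₁) (.goto fun _ => l₂)))
    (hr : r ≤ R) {s : ℕ → ℕ} (hs : ∀ i : Fin (R + 1), (regStk s i).length ≤ N)
    (v : Option CodeSym) :
    (s r ≠ 0 → ∃ v', ShortReaches M N ⟨some l, v, mkStk [] [] (regStk s)⟩
      ⟨some l₁, v', mkStk [] [] (regStk s)⟩) ∧
    (s r = 0 → ∃ v', ShortReaches M N ⟨some l, v, mkStk [] [] (regStk s)⟩
      ⟨some l₂, v', mkStk [] [] (regStk s)⟩) := by
  constructor
  · intro h
    have hne : (s r).bits ≠ [] := by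
      intro h'
      exact h (Nat.size_eq_zero.1 (by rw [← Nat.size_eq_bits_len, h']; rfl))
    obtain ⟨b, t, e⟩ := List.exists_cons_of_ne_nil hne
    refine ⟨some (.bit b), .single ?_ (short_mk (by simp) (by simp) hs)⟩
    simp [hM, readBit, regStk_ofNat s hr, e, -Fin.ofNat_eq_cast]
  · intro h
    refine ⟨none, .single ?_ (short_mk (by simp) (by simp) hs)⟩
    simp [hM, readBit, regStk_ofNat s hr, h, -Fin.ofNat_eq_cast]

/-- Induction on the execution. The embedding of program points and the exit label stay arbitrary,
so that the same statement applies to subprograms. The scratch stack only holds digits taken off one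
register, so the binary length of `B` suffices for it too. -/
theorem Prog.Exec.reaches {B N : ℕ} (hN : B.size ≤ N) {p : Prog} {s t : ℕ → ℕ}
    (h : p.Exec B s t) (emb : p.Lbl → Λ) (ex : Λ) (hM : ∀ l, M (emb l) = p.code emb ex l)
    (hR : p.bound ≤ R + 1) (hs : ∀ i, s i ≤ B) (v : Option CodeSym) :
    ∃ v', ShortReaches M N ⟨some (emb p.entry), v, mkStk [] [] (regStk s)⟩
      ⟨some ex, v', mkStk [] [] (regStk t)⟩ := by
  have hlen : ∀ {s : ℕ → ℕ}, (∀ i, s i ≤ B) → ∀ i : Fin (R + 1), (regStk s i).length ≤ N :=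
    fun hs i => (regStk_length hs i).trans hN
  have hshort : ∀ {s : ℕ → ℕ} (l : Option Λ) (v : Option CodeSym), (∀ i, s i ≤ B) →
      Short N (⟨l, v, mkStk [] [] (regStk s)⟩ : MCfg (R + 1) Λ) :=
    fun l v hs => short_mk (by simp) (by simp) (hlen hs)
  induction h generalizing ex v with
  | skip s => exact ⟨v, .single (by rw [hM]; rfl) (hshort _ _ hs)⟩
  | inc r s hr =>
    have hrR : r ≤ R := by simp only [bound] at hR; omega
    have hl : (s r + 1).bits.length ≤ N := by
      rw [Nat.size_eq_bits_len]; exact (Nat.size_le_size hr).trans hN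
    obtain ⟨v₁, a, b, h1, h2, h3⟩ := carry_reaches (M := M) (N := N) (hM false) [] (by simp) (s r)
      [] (regStk s) (regStk_ofNat s hrR) (hlen hs) (by simpa using hl) v
    have hb : b.length ≤ N := by omega
    obtain ⟨v₂, h4⟩ := restore_reaches (M := M) (N := N) (hM true) [] (by simp) a
      (update (regStk s) (Fin.ofNat (R + 1) r) b) (update_length (hlen hs) hb) (by simpa using h2) v₁
    simp only [update_idem, update_self, h3, List.length_nil, List.replicate_zero,
      List.nil_append] at h4
    rw [update_regStk s hrR _ _ rfl] at h4
    exact ⟨v₂, h1.trans h4⟩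
  | dec r s =>
    have hrR : r ≤ R := by simp only [bound] at hR; omega
    -- Truncated subtraction: `borrow_reaches` needs a nonzero number, and an empty stack goes
    -- straight to the restoring point.
    by_cases h0 : s r = 0
    · have e : regStk s (Fin.ofNat (R + 1) r) = [] := by rw [regStk_ofNat s hrR, h0]; rfl
      obtain ⟨v₂, h4⟩ := restore_reaches (M := M) (N := N) (hM true) [] (by simp) []
        (regStk s) (hlen hs) (by simpa using hlen hs _) none
      refine ⟨v₂, .step (c := ⟨some (emb true), none, mkStk [] [] (regStk s)⟩) ?_
        (hshort _ _ hs) ?_⟩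
      · have : update (regStk s) (Fin.ofNat (R + 1) r) [] = regStk s := by
          rw [← e]; exact update_eq_self _ _
        refine (congrArg (fun q => Turing.TM2.stepAux q v _) (hM false)).trans ?_
        refine (stepAux_pop_reg _ _ _ _ _ _ _).trans ?_
        rw [e]
        exact congrArg (fun S => (⟨some (emb true), none, mkStk [] [] S⟩ : MCfg (R + 1) Λ)) this
      · have e' : s r - 1 = s r := by omega
        rw [e', update_eq_self]
        simpa using h4
    · have hl : (s r).bits.length ≤ N := by
        rw [Nat.size_eq_bits_len]; exact (Nat.size_le_size (hs r)).trans hN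
      obtain ⟨v₁, a, b, h1, h2, h3⟩ := borrow_reaches (M := M) (N := N) (hM false) [] (by simp)
        (s r) h0 [] (regStk s) (regStk_ofNat s hrR) (hlen hs) (by simpa using hl) v
      have hb : b.length ≤ N := by omega
      obtain ⟨v₂, h4⟩ := restore_reaches (M := M) (N := N) (hM true) [] (by simp) a
        (update (regStk s) (Fin.ofNat (R + 1) r) b) (update_length (hlen hs) hb)
        (by simpa using h2) v₁
      simp only [update_idem, update_self, h3, List.length_nil, List.replicate_zero,
        List.nil_append] at h4
      rw [update_regStk s hrR _ _ rfl] at h4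
      exact ⟨v₂, h1.trans h4⟩
  | @seq p q s t u hp _ ih₁ ih₂ =>
    simp only [bound] at hR
    obtain ⟨v₁, h1⟩ := ih₁ (fun l => emb (.inl l)) (emb (.inr q.entry)) (fun l => hM (.inl l))
      (by omega) hs v
    obtain ⟨v₂, h2⟩ := ih₂ (fun l => emb (.inr l)) ex (fun l => hM (.inr l))
      (by omega) (hp.le hs) v₁
    exact ⟨v₂, h1.trans h2⟩
  | @ite_pos r p q s t hr hp ih =>
    simp only [bound] at hR
    obtain ⟨v₀, h0⟩ := (test_reaches (hM none) (by omega) (hlen hs) v).1 hr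
    obtain ⟨v₁, h1⟩ := ih (fun l => emb (some (.inl l))) ex (fun l => hM (some (.inl l)))
      (by omega) hs v₀
    exact ⟨v₁, h0.trans h1⟩
  | @ite_neg r p q s t hr hp ih =>
    simp only [bound] at hR
    obtain ⟨v₀, h0⟩ := (test_reaches (hM none) (by omega) (hlen hs) v).2 hr
    obtain ⟨v₁, h1⟩ := ih (fun l => emb (some (.inr l))) ex (fun l => hM (some (.inr l)))
      (by omega) hs v₀
    exact ⟨v₁, h0.trans h1⟩
  | @loop_zero r p s hr =>
    simp only [bound] at hR
    exact (test_reaches (hM none) (by omega) (hlen hs) v).2 hr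
  | @loop_step r p s t u hr hp _ ih₁ ih₂ =>
    have hR' := hR
    simp only [bound] at hR
    obtain ⟨v₀, h0⟩ := (test_reaches (hM none) (by omega) (hlen hs) v).1 hr
    obtain ⟨v₁, h1⟩ := ih₁ (fun l => emb (some l)) (emb none) (fun l => hM (some l))
      (by omega) hs v₀
    obtain ⟨v₂, h2⟩ := ih₂ emb ex hM hR' (hp.le hs) v₁
    exact ⟨v₂, h0.trans (h1.trans h2)⟩

end Simulation

/-! ## The whole machine -/

/-- The three bits that represent a symbol; the last one is the highest, and it is `1`. -/
def symBits : CodeSym → List Bool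
  | .bit b => [b, false, true]
  | .endNum => [false, true, true]
  | .endList => [true, true, true]

/-- The number that represents a string, with the first symbol in the lowest digit. -/
def codeString : List CodeSym → ℕ
  | [] => 0
  | .bit b :: x => 4 + b.toNat + 8 * codeString x
  | .endNum :: x => 6 + 8 * codeString x
  | .endList :: x => 7 + 8 * codeString x

/-- Each symbol fills one octal digit whose top bit is `1`, so no block is lost as leading zeros and
the bits of the number are the concatenated blocks. -/
theorem bits_codeString (x : List CodeSym) : (codeString x).bits = x.flatMap symBits := by
  have key : ∀ (a b : Bool) (n : ℕ), (4 + 2 * b.toNat + a.toNat + 8 * n).bits =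
      [a, b, true] ++ n.bits := by
    intro a b n
    have h1 := Nat.bit1_bits n
    have h2 : (Nat.bit b (2 * n + 1)).bits = b :: true :: n.bits := by
      rw [Nat.bits_append_bit _ _ (by simp), h1]
    have h3 := Nat.bits_append_bit (Nat.bit b (2 * n + 1)) a
      (fun h => by cases b <;> simp [Nat.bit] at h)
    rw [h2] at h3
    rw [List.cons_append, List.cons_append, List.cons_append, List.nil_append, ← h3]
    congr 1
    cases a <;> cases b <;> simp [Nat.bit] <;> ring
  induction x with
  | nil => rfl
  | cons c x ih =>
    rw [List.flatMap_cons, ← ih]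
    cases c with
    | bit b => rw [codeString, symBits, ← key]; congr 1
    | endNum => rw [codeString, symBits, ← key]; congr 1
    | endList => rw [codeString, symBits, ← key]; congr 1

theorem symBits_length (c : CodeSym) : (symBits c).length = 3 := by cases c <;> rfl

theorem size_codeString (x : List CodeSym) : (codeString x).size = 3 * x.length := by
  rw [← Nat.size_eq_bits_len, bits_codeString]
  induction x with
  | nil => rfl
  | cons c x ih => simp [symBits_length] at ih ⊢; omega

/-- One of the bits of the symbol in the finite memory. -/
def memBit (i : ℕ) (v : Option CodeSym) : Bool :=
  match v with
  | none => false
  | some c => (symBits c).getD i false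

/-- The machine that loads its input into register `0`, runs a program, and returns the truth value
in register `1`. -/
def progTM (R : ℕ) (p : Prog) : Turing.FinTM2 where
  K := MStack (R + 1)
  k₀ := .inp
  k₁ := .reg (Fin.ofNat (R + 1) 1)
  Γ := MAlph (R + 1)
  Λ := p.Lbl ⊕ Fin 3
  main := .inr 0
  σ := Option CodeSym
  initialState := none
  Γk₀Fin := inferInstanceAs (Fintype CodeSym)
  m
    | .inl l => p.code .inl (.inr 2) l
    | .inr 0 =>
      .pop .inp (fun _ o => o) <| .branch (fun v => v.isSome)
        (.push .aux (memBit 0) <| .push .aux (memBit 1) <| .push .aux (memBit 2) <|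
          .goto fun _ => .inr 0)
        (.goto fun _ => .inr 1)
    | .inr 1 =>
      .pop .aux readBit <| .branch (fun v => v.isSome)
        (.push (.reg (Fin.ofNat (R + 1) 0)) (fun v => decide (v = some (.bit true))) <|
          .goto fun _ => .inr 1)
        (.goto fun _ => .inl p.entry)
    -- The result `1` is already the stack `[true]`; the result `0` is an empty stack, on which
    -- `false` must be pushed. The memory is reset because a halting configuration requires its
    -- initial value.
    | .inr 2 =>
      .peek (.reg (Fin.ofNat (R + 1) 1)) readBit <| .branch (fun v => v.isSome)
        (.load (fun _ => none) .halt)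
        (.push (.reg (Fin.ofNat (R + 1) 1)) (fun _ => false) <| .load (fun _ => none) .halt)

section
variable {R : ℕ} {p : Prog} {N : ℕ}

theorem progTM_load (x : List CodeSym) (a : List Bool) (v : Option CodeSym)
    (hN : 3 * x.length + a.length ≤ N) :
    ∃ v', ShortReaches (progTM R p).m N ⟨some (.inr 0), v, mkStk x a fun _ => []⟩
      ⟨some (.inr 1), v', mkStk [] ((x.flatMap symBits).reverse ++ a) fun _ => []⟩ := by
  induction x generalizing a v with
  | nil =>
    refine ⟨none, .single ?_ (short_mk (by simp) (by simp at hN; simpa) (by simp))⟩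
    simp [progTM]
  | cons c x ih =>
    simp only [List.length_cons] at hN
    obtain ⟨v', h⟩ := ih ((symBits c).reverse ++ a) (some c) (by simp [symBits_length]; omega)
    refine ⟨v', .step (c := ⟨some (.inr 0), some c,
      mkStk x ((symBits c).reverse ++ a) fun _ => []⟩) ?_
      (short_mk (by omega) (by simp [symBits_length]; omega) (by simp)) ?_⟩
    · cases c <;> simp [progTM, memBit, symBits]
    · simpa using h

theorem progTM_store (a : List Bool) (s : Fin (R + 1) → List Bool)
    (hs : ∀ i, (s i).length ≤ N) (v : Option CodeSym)
    (hN : a.length + (s (Fin.ofNat (R + 1) 0)).length ≤ N) :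
    ∃ v', ShortReaches (progTM R p).m N ⟨some (.inr 1), v, mkStk [] a s⟩
      ⟨some (.inl p.entry), v', mkStk [] []
        (update s (Fin.ofNat (R + 1) 0) (a.reverse ++ s (Fin.ofNat (R + 1) 0)))⟩ := by
  induction a generalizing s v with
  | nil =>
    refine ⟨none, .single ?_ (short_mk (by simp) (by simp) (by simpa using hs))⟩
    simp [progTM, readBit]
  | cons c a ih =>
    simp only [List.length_cons] at hN
    have hs' : ∀ i, (update s (Fin.ofNat (R + 1) 0) (c :: s (Fin.ofNat (R + 1) 0)) i).length ≤ N :=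
      update_length hs (by simp only [List.length_cons]; omega)
    obtain ⟨v', h⟩ := ih _ hs' (some (.bit c)) (by simp only [update_self, List.length_cons]; omega)
    refine ⟨v', .step (c := ⟨some (.inr 1), some (.bit c), mkStk [] a _⟩) ?_
      (short_mk (by simp) (by omega) hs') ?_⟩
    · cases c <;> simp [progTM, readBit]
    · simp only [update_idem, update_self] at h
      simpa [List.append_assoc] using h

end

theorem evalsTo_of_reaches {σ : Type*} {f : σ → Option σ} {a b : σ}
    (h : StateTransition.Reaches f a b) : Nonempty (StateTransition.EvalsTo f a (some b)) := by
  induction h with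
  | refl => exact ⟨.refl f a⟩
  | tail _ h ih =>
    obtain ⟨ih⟩ := ih
    exact ⟨ih.trans _ _ _ _ ⟨1, h⟩⟩

/-- A language is in PSPACE if its membership test, on strings coded as numbers, is computed by a
register program whose values have polynomial length. -/
theorem InPSPACE.of_prog (f : List CodeSym → Bool) (p : Prog) (P : Polynomial ℕ)
    (h : ∀ x, p.Exec (2 ^ P.eval x.length) (update (fun _ => 0) 0 (codeString x))
      (update (fun _ => 0) 1 (f x).toNat)) :
    InPSPACE ({x | f x = true} : Language CodeSym) := by
  set R := p.bound + 1 with hRdef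
  have hk : ∀ x : List CodeSym, (∃ N, N ≤ P.eval x.length + 1 + 3 * x.length + 1 ∧
      Short N (Turing.initList (progTM R p) x : MCfg (R + 1) _) ∧
      ShortReaches (progTM R p).m N (Turing.initList (progTM R p) x)
      (Turing.haltList (progTM R p) [f x])) := by
    intro x
    refine ⟨_, le_rfl, ?_⟩
    set N := P.eval x.length + 1 + 3 * x.length + 1
    have e0 : (Turing.initList (progTM R p) x : MCfg (R + 1) _) =
        ⟨some (.inr 0), none, mkStk x [] fun _ => []⟩ := by
      unfold Turing.initList
      congr 1
      funext k
      cases k <;> rfl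
    have e1 : (Turing.haltList (progTM R p) [f x] : MCfg (R + 1) _) =
        ⟨none, none, mkStk [] [] (update (fun _ => []) (Fin.ofNat (R + 1) 1) [f x])⟩ := by
      unfold Turing.haltList
      congr 1
      funext k
      cases k with
      | inp => rfl
      | aux => rfl
      | reg i =>
        by_cases hi : i = Fin.ofNat (R + 1) 1
        · subst hi
          exact (dif_pos rfl).trans (update_self (Fin.ofNat (R + 1) 1) [f x] fun _ => []).symm
        · exact (dif_neg fun h => hi (MStack.reg.inj h)).trans
            (update_of_ne hi [f x] fun _ => []).symm
    rw [e0, e1]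
    refine ⟨short_mk (by omega) (by simp) (by simp), ?_⟩
    obtain ⟨v₁, h1⟩ := progTM_load (R := R) (p := p) (N := N) x [] none (by simp; omega)
    have hlen : (x.flatMap symBits).length = 3 * x.length := by
      rw [← bits_codeString, Nat.size_eq_bits_len, size_codeString]
    obtain ⟨v₂, h2⟩ := progTM_store (R := R) (p := p) (N := N)
      ((x.flatMap symBits).reverse ++ []) (fun _ => []) (by simp) v₁
      (by simp only [List.append_nil, List.length_reverse, hlen, List.length_nil]; omega)
    -- The input number may exceed the bound on the increments, so the simulation runs with the
    -- maximum of both.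
    have hB : (max (2 ^ P.eval x.length) (codeString x)).size ≤ N := by
      rcases le_total (2 ^ P.eval x.length) (codeString x) with h | h
      · rw [max_eq_right h, size_codeString]; omega
      · rw [max_eq_left h, Nat.size_pow]; omega
    obtain ⟨v₃, h3⟩ := ((h x).mono (le_max_left _ (codeString x))).reaches (R := R)
      (M := (progTM R p).m) hB .inl (.inr 2) (fun _ => rfl) (by omega)
      (by
        intro i
        by_cases hi : i = 0
        · subst hi; simp
        · simp [hi]) v₂
    have hz : regStk (R := R) (fun _ => 0) = fun _ => [] := by
      funext i; simp [regStk]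
    rw [← update_regStk _ (by omega) _ _ rfl, hz, bits_codeString,
      ← update_regStk _ (by omega) _ _ rfl, hz] at h3
    rw [List.append_nil] at h1 h2
    rw [List.reverse_reverse, List.append_nil] at h2
    refine h1.trans (h2.trans (h3.trans (ShortReaches.single ?_ ?_)))
    · cases hf : f x <;> simp [progTM, readBit]
    · exact short_mk (by simp) (by simp) (update_length (by simp) (by simp; omega))
  refine ⟨⟨progTM R p, Equiv.refl _, Equiv.refl _⟩,
    -- `N` bounds each single stack; the total length costs a factor for the fixed number of stacks.
    Polynomial.C (Fintype.card (MStack (R + 1))) * (P + 1 + 3 * Polynomial.X + 1), ?_, ?_⟩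
  · intro k
    cases k
    · exact inferInstanceAs (Finite CodeSym)
    · exact inferInstanceAs (Finite Bool)
    · exact inferInstanceAs (Finite Bool)
  · intro x
    obtain ⟨N, hN, hs, hr⟩ := hk x
    have hmap : x.map (Equiv.refl CodeSym).symm = x := List.map_id x
    have hout : Nonempty (Turing.TM2Outputs (progTM R p) (x.map (Equiv.refl CodeSym).symm)
        (some ([f x].map (Equiv.refl Bool).symm))) := by
      exact (congrArg (fun y => Nonempty (Turing.TM2Outputs (progTM R p) y (some [f x])))
        hmap).mpr (evalsTo_of_reaches hr.reaches)
    refine ⟨?_, ?_, ?_⟩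
    · intro hx
      rwa [show f x = true from hx] at hout
    · intro hx
      rwa [show f x = false from eq_false_of_ne_true hx] at hout
    · intro c hc
      have hc' : Short N c := by
        exact hr.short hs rfl ((congrArg (fun y => StateTransition.Reaches
          (Turing.TM2.step (progTM R p).m) (Turing.initList (progTM R p) y) c) hmap).mp hc)
      refine (Finset.sum_le_card_nsmul _ _ N fun k _ => hc' k).trans ?_
      simp only [smul_eq_mul, Polynomial.eval_mul, Polynomial.eval_C, Polynomial.eval_add,
        Polynomial.eval_one, Polynomial.eval_X, Polynomial.eval_ofNat]
      exact Nat.mul_le_mul le_rfl hN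

/-! ## Register programs for basic functions -/

namespace Prog

variable {B : ℕ}

theorem exec_inc {r : ℕ} {s t : ℕ → ℕ} (h : s r + 1 ≤ B) (ht : t = update s r (s r + 1)) :
    Exec B (inc r) s t := by subst ht; exact .inc r s h

theorem exec_dec {r : ℕ} {s t : ℕ → ℕ} (ht : t = update s r (s r - 1)) :
    Exec B (dec r) s t := by subst ht; exact .dec r s

theorem Exec.congr {p : Prog} {s t u : ℕ → ℕ} (h : Exec B p s t) (ht : u = t) :
    Exec B p s u := by subst ht; exact h

/-- A loop whose state after each round is known. -/
theorem Exec.loop_count {r n : ℕ} {p : Prog} (S : ℕ → ℕ → ℕ) (h0 : ∀ k ≤ n, S k r = k)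
    (h : ∀ k < n, Exec B p (S (k + 1)) (S k)) : Exec B (loop r p) (S n) (S 0) := by
  induction n with
  | zero => exact .loop_zero (h0 0 le_rfl)
  | succ n ih =>
    refine .loop_step ?_ (h n (by omega)) (ih (fun k hk => h0 k (by omega)) fun k hk => h k (by omega))
    rw [h0 _ le_rfl]; omega

/-- Add a register to another one and clear it. -/
def move (x y : ℕ) : Prog := loop x (seq (dec x) (inc y))

/-- Add a register to two others and clear it. -/
def move2 (x y z : ℕ) : Prog := loop x (seq (dec x) (seq (inc y) (inc z)))

/-- Set a register to zero. -/
def clear (x : ℕ) : Prog := loop x (dec x)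

/-- Add a register to another one, with the help of a scratch register. -/
def copy (i o t : ℕ) : Prog := seq (move2 i o t) (move t i)

theorem exec_clear (x : ℕ) (s : ℕ → ℕ) : Exec B (clear x) s (update s x 0) := by
  have := Exec.loop_count (B := B) (r := x) (n := s x) (p := dec x) (fun k => update s x k)
    (fun k _ => by simp) (fun k _ => exec_dec (by simp))
  simpa [clear] using this

theorem exec_move {x y : ℕ} {s : ℕ → ℕ} (hxy : x ≠ y) (h : s y + s x ≤ B) :
    Exec B (move x y) s (update (update s x 0) y (s y + s x)) := by
  have := Exec.loop_count (B := B) (r := x) (n := s x) (p := seq (dec x) (inc y))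
    (fun k => update (update s x k) y (s y + (s x - k)))
    (fun k _ => by simp [hxy]) (fun k hk => by
      refine .seq (.dec _ _) (exec_inc ?_ ?_)
      · simp [hxy, hxy.symm]; omega
      · funext r; simp only [update_apply]; split_ifs <;> simp_all <;> omega)
  simpa [move] using this

theorem exec_move2 {x y z : ℕ} {s : ℕ → ℕ} (hxy : x ≠ y) (hxz : x ≠ z) (hyz : y ≠ z)
    (h : s y + s x ≤ B) (h' : s z + s x ≤ B) :
    Exec B (move2 x y z) s (update (update (update s x 0) y (s y + s x)) z (s z + s x)) := by
  have := Exec.loop_count (B := B) (r := x) (n := s x) (p := seq (dec x) (seq (inc y) (inc z)))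
    (fun k => update (update (update s x k) y (s y + (s x - k))) z (s z + (s x - k)))
    (fun k _ => by simp [hxy, hxz]) (fun k hk => by
      refine .seq (.dec _ _) (.seq (.inc _ _ ?_) (exec_inc ?_ ?_))
      · simp [hxy, hxz, hyz, hxy.symm, hxz.symm, hyz.symm]; omega
      · simp [hxy, hxz, hyz, hxy.symm, hxz.symm, hyz.symm]; omega
      · funext r; simp only [update_apply]; split_ifs <;> simp_all <;> omega)
  simpa [move2] using this

theorem exec_copy {i o t : ℕ} {s : ℕ → ℕ} (hio : i ≠ o) (hit : i ≠ t) (hot : o ≠ t)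
    (ht : s t = 0) (h : s o + s i ≤ B) :
    Exec B (copy i o t) s (update s o (s o + s i)) := by
  refine .seq (exec_move2 hio hit hot h (by omega)) ((exec_move hit.symm ?_).congr ?_)
  · simp [hio, hit, ht]; omega
  · funext r; simp only [update_apply]; split_ifs <;> simp_all

end Prog

/-! ## Codes of pairs -/

/-- Triangular numbers. -/
def tri : ℕ → ℕ
  | 0 => 0
  | n + 1 => tri n + (n + 1)

/-- The Cantor pairing function. -/
def cpair (a b : ℕ) : ℕ := tri (a + b) + b

theorem le_tri (n : ℕ) : n ≤ tri n := by
  induction n with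
  | zero => simp
  | succ n ih => simp only [tri]; omega

theorem tri_mono : Monotone tri := monotone_nat_of_le_succ fun n => by simp [tri]

theorem left_le_cpair (a b : ℕ) : a ≤ cpair a b := by
  have := le_tri (a + b); unfold cpair; omega

theorem right_le_cpair (a b : ℕ) : b ≤ cpair a b := by unfold cpair; omega

/-- `cpair a b < (a + b + 1) ^ 2`. Pairing thus costs only a constant factor in binary length, so
tuples of short numbers are short. -/
theorem size_cpair_le (a b : ℕ) : (cpair a b).size ≤ 2 * (a.size + b.size + 1) := by
  rw [Nat.size_le]
  have ha := Nat.lt_size_self a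
  have hb := Nat.lt_size_self b
  have h1 : a + b + 1 ≤ 2 ^ (a.size + b.size + 1) := by
    have h2 : 2 ^ a.size ≤ 2 ^ (a.size + b.size) := Nat.pow_le_pow_right (by norm_num) (by omega)
    have h3 : 2 ^ b.size ≤ 2 ^ (a.size + b.size) := Nat.pow_le_pow_right (by norm_num) (by omega)
    rw [pow_succ]; omega
  have h4 : cpair a b < (a + b + 1) ^ 2 := by
    have : tri (a + b) + (a + b) < (a + b + 1) ^ 2 := by
      have : 2 * tri (a + b) = (a + b) * (a + b + 1) := by
        generalize a + b = n
        induction n with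
        | zero => simp [tri]
        | succ n ih => simp only [tri]; nlinarith
      nlinarith
    unfold cpair; omega
  calc cpair a b < (a + b + 1) ^ 2 := h4
    _ ≤ (2 ^ (a.size + b.size + 1)) ^ 2 := Nat.pow_le_pow_left h1 2
    _ = _ := by rw [← pow_mul]; congr 1; ring

/-- The pair after a given one in the Cantor enumeration. -/
def cnext (p : ℕ × ℕ) : ℕ × ℕ := if p.1 = 0 then (p.2 + 1, 0) else (p.1 - 1, p.2 + 1)

theorem cpair_cnext (p : ℕ × ℕ) : cpair (cnext p).1 (cnext p).2 = cpair p.1 p.2 + 1 := by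
  obtain ⟨a, b⟩ := p
  unfold cnext
  rcases a with _ | a
  · simp [cpair, tri]; ring
  · have : a + (b + 1) = a + 1 + b := by ring
    simp [cpair, this]; ring

/-- The pairs of sum `n` occupy the interval from `tri n` to `tri n + n`, and these intervals are
disjoint. -/
theorem cpair_inj {a b c d : ℕ} (h : cpair a b = cpair c d) : a = c ∧ b = d := by
  have key : ∀ {s t x y : ℕ}, x ≤ s → s < t → tri s + x < tri t + y := by
    intro s t x y hx hst
    have := tri_mono (Nat.succ_le_of_lt hst)
    simp only [Nat.succ_eq_add_one, tri] at this
    omega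
  unfold cpair at h
  rcases lt_trichotomy (a + b) (c + d) with h1 | h1 | h1
  · have := key (x := b) (y := d) (by omega) h1; omega
  · rw [h1] at h; omega
  · have := key (x := d) (y := b) (by omega) h1; omega

/-- Every number is the code of a pair. -/
def cunpair (n : ℕ) : ℕ × ℕ := cnext^[n] (0, 0)

theorem cpair_cunpair (n : ℕ) : cpair (cunpair n).1 (cunpair n).2 = n := by
  induction n with
  | zero => simp [cunpair, cpair, tri]
  | succ n ih => rw [cunpair, iterate_succ_apply', cpair_cnext]; exact congrArg (· + 1) ih

theorem cunpair_cpair (a b : ℕ) : cunpair (cpair a b) = (a, b) := by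
  have := cpair_inj (cpair_cunpair (cpair a b))
  exact Prod.ext this.1 this.2

namespace Prog

variable {B : ℕ}

/-- Add the code of the pair held in two registers to a third register, and clear them. -/
def pairP (x y o : ℕ) : Prog :=
  seq (move2 y x o) (loop x (seq (dec x) (seq (inc o) (seq (move2 x y o) (move y x)))))

/-- With the sum of both entries in `x`, each round adds the current `x` to `o` and lowers `x` by
one, which accumulates the triangular number. -/
theorem exec_pairP {x y o : ℕ} {s : ℕ → ℕ} (hxy : x ≠ y) (hxo : x ≠ o) (hyo : y ≠ o)
    (ho : s o = 0) (h : cpair (s x) (s y) ≤ B) :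
    Exec B (pairP x y o) s (update (update (update s x 0) y 0) o (cpair (s x) (s y))) := by
  have h1 := le_tri (s x + s y)
  have h2 : tri (s x + s y) + s y ≤ B := h
  refine .seq (exec_move2 hxy.symm hyo hxo (by omega) (by omega)) ?_
  have := Exec.loop_count (B := B) (r := x) (n := s x + s y)
    (p := seq (dec x) (seq (inc o) (seq (move2 x y o) (move y x))))
    (fun k => update (update (update s x k) y 0) o (s y + (tri (s x + s y) - tri k)))
    (fun k _ => by simp [hxy, hxo]) (fun k hk => by
      have h3 := tri_mono (Nat.succ_le_of_lt hk)
      simp only [Nat.succ_eq_add_one, tri] at h3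
      refine .seq (.dec _ _) (.seq (.inc _ _ ?_) (.seq (exec_move2 hxy hxo hyo ?_ ?_)
        ((exec_move hxy.symm ?_).congr ?_)))
      · simp [hxy, hxo, hyo, hxy.symm, hxo.symm, hyo.symm, tri]; omega
      · simp [hxy, hxo, hyo, hxy.symm, hxo.symm, hyo.symm, tri]; omega
      · simp [hxy, hxo, hyo, hxy.symm, hxo.symm, hyo.symm, tri]; omega
      · simp [hxy, hxo, hyo, hxy.symm, hxo.symm, hyo.symm, tri]; omega
      · funext r
        by_cases r1 : r = x
        · subst r1; simp [hxy, hxo, hyo, hxy.symm, hxo.symm, hyo.symm]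
        by_cases r2 : r = y
        · subst r2; simp [hxy, hxo, hyo, hxy.symm, hxo.symm, hyo.symm]
        by_cases r3 : r = o
        · subst r3; simp [hxy, hxo, hyo, hxy.symm, hxo.symm, hyo.symm, tri]; omega
        simp [r1, r2, r3])
  convert this using 1
  · funext r; simp only [update_apply]; split_ifs <;> simp_all
  · funext r; simp only [update_apply]; split_ifs <;> simp_all [cpair, tri]; omega

/-- Decode the pair whose code is held in register `i` into the registers `x` and `y`. -/
def unpairP (i x y b : ℕ) : Prog :=
  seq (copy i b (b + 1))
    (loop b (seq (dec b) (ite x (seq (dec x) (inc y)) (seq (inc x) (move y x)))))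

/-- The program walks through the Cantor enumeration as many steps as the code says. This takes
exponential time, but both entries never exceed the code. -/
theorem exec_unpairP {i x y b : ℕ} {s : ℕ → ℕ} (hxy : x ≠ y) (hib : i < b) (hxb : x < b)
    (hyb : y < b) (hx : s x = 0) (hy : s y = 0) (hb : ∀ r ≥ b, s r = 0)
    (h : s i ≤ B) :
    Exec B (unpairP i x y b) s
      (update (update s x (cunpair (s i)).1) y (cunpair (s i)).2) := by
  have hxb' : x ≠ b := by omega
  have hyb' : y ≠ b := by omega
  have hb0 := hb b le_rfl
  refine .seq (exec_copy (by omega) (by omega) (by omega) (hb _ (by omega)) (by omega)) ?_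
  have hle : ∀ k, (cunpair k).1 ≤ k ∧ (cunpair k).2 ≤ k := by
    intro k
    have h1 := left_le_cpair (cunpair k).1 (cunpair k).2
    have h2 := right_le_cpair (cunpair k).1 (cunpair k).2
    rw [cpair_cunpair] at h1 h2
    exact ⟨h1, h2⟩
  have := Exec.loop_count (B := B) (r := b) (n := s i)
    (p := seq (dec b) (ite x (seq (dec x) (inc y)) (seq (inc x) (move y x))))
    (fun k => update (update (update s b k) x (cunpair (s i - k)).1) y (cunpair (s i - k)).2)
    (fun k _ => by simp [hxb'.symm, hyb'.symm]) (fun k hk => by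
      have e : s i - k = (s i - (k + 1)) + 1 := by omega
      have e2 : cunpair (s i - k) = cnext (cunpair (s i - (k + 1))) := by
        rw [e, cunpair, iterate_succ_apply']; rfl
      have h3 := hle (s i - k)
      have h4 := hle (s i - (k + 1))
      rw [e2] at h3 ⊢
      refine .seq (.dec _ _) ?_
      by_cases h0 : (cunpair (s i - (k + 1))).1 = 0
      · simp only [cnext, h0, if_true] at h3 ⊢
        refine .ite_neg ?_ (.seq (.inc _ _ ?_) ((exec_move hxy.symm ?_).congr ?_))
        · simp [hxy, hxb', hyb', hxy.symm]
        · simp [hxy, hxb', hyb', hxy.symm]; omega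
        · simp [hxy, hxb', hyb', hxy.symm]; omega
        · funext r
          by_cases r1 : r = x
          · subst r1; simp [hxy, hxb', hyb', hxy.symm]; omega
          by_cases r2 : r = y
          · subst r2; simp [hxy, hxb', hyb', hxy.symm]
          by_cases r3 : r = b
          · subst r3; simp [hxb'.symm, hyb'.symm]
          simp [r1, r2, r3]
      · simp only [cnext, h0, if_false] at h3 ⊢
        refine .ite_pos ?_ (.seq (.dec _ _) (exec_inc ?_ ?_))
        · simpa [hxy, hxb', hyb', hxy.symm] using h0
        · simp [hxy, hxb', hyb', hxy.symm]; omega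
        · funext r
          by_cases r1 : r = x
          · subst r1; simp [hxy, hxb', hyb', hxy.symm]
          by_cases r2 : r = y
          · subst r2; simp [hxy, hxb', hyb', hxy.symm]
          by_cases r3 : r = b
          · subst r3; simp [hxb'.symm, hyb'.symm]
          simp [r1, r2, r3])
  convert this using 1
  · funext r; simp only [update_apply]; split_ifs <;> simp_all [cunpair]
  · funext r; simp only [update_apply]; split_ifs <;> simp_all

/-- Increment a register a fixed number of times. -/
def incs (o : ℕ) : ℕ → Prog
  | 0 => skip
  | n + 1 => seq (incs o n) (inc o)

theorem exec_incs {o n : ℕ} {s : ℕ → ℕ} (h : s o + n ≤ B) :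
    Exec B (incs o n) s (update s o (s o + n)) := by
  induction n with
  | zero => simpa [incs] using Exec.skip (M := B) s
  | succ n ih => exact .seq (ih (by omega)) (exec_inc (by simp; omega) (by simp [add_assoc]))

end Prog

/-! ## Functions computable in polynomial space -/

/-- Types whose elements are coded by natural numbers. -/
class Code (α : Type) where
  /-- The code of an element. -/
  enc : α → ℕ

open Code

instance : Code ℕ := ⟨id⟩
instance : Code Bool := ⟨Bool.toNat⟩
instance : Code (List CodeSym) := ⟨codeString⟩
instance {α β : Type} [Code α] [Code β] : Code (α × β) := ⟨fun p => cpair (enc p.1) (enc p.2)⟩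

@[simp] theorem enc_nat (n : ℕ) : enc n = n := rfl
theorem enc_bool (b : Bool) : enc b = b.toNat := rfl
theorem enc_string (x : List CodeSym) : enc x = codeString x := rfl
theorem enc_pair {α β : Type} [Code α] [Code β] (p : α × β) :
    enc p = cpair (enc p.1) (enc p.2) := rfl

/-- The number of binary digits of the code of an element. -/
def sz {α : Type} [Code α] (a : α) : ℕ := (enc a).size

theorem le_two_pow_of_size {n k : ℕ} (h : n.size ≤ k) : n ≤ 2 ^ k := (Nat.size_le.1 h).le

/-- `c i o b` is a program that adds `m` to register `o` if register `i` holds `n`, provided that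
all registers from `b` on hold zero. -/
def Computes (c : ℕ → ℕ → ℕ → Prog) (B n m : ℕ) : Prop :=
  ∀ (i o b : ℕ) (s : ℕ → ℕ), i < b → o < b → i ≠ o → s i = n → s o = 0 → (∀ r ≥ b, s r = 0) →
    (c i o b).Exec B s (update s o m)

theorem Computes.mono {c : ℕ → ℕ → ℕ → Prog} {A B n m : ℕ} (h : Computes c A n m) (hAB : A ≤ B) :
    Computes c B n m :=
  fun i o b s h1 h2 h3 h4 h5 h6 => (h i o b s h1 h2 h3 h4 h5 h6).mono hAB

/-- A function is computable in polynomial space if some register program computes it with values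
of polynomial length. -/
@[fun_prop]
def PS {α β : Type} [Code α] [Code β] (f : α → β) : Prop :=
  ∃ (c : ℕ → ℕ → ℕ → Prog) (P : Polynomial ℕ), ∀ a,
    sz (f a) ≤ P.eval (sz a) ∧ Computes c (2 ^ P.eval (sz a)) (enc a) (enc (f a))

theorem poly_mono (P : Polynomial ℕ) : Monotone fun n => P.eval n := by
  intro m n h
  induction P using Polynomial.induction_on' with
  | add p q hp hq => simpa using Nat.add_le_add hp hq
  | monomial k a => simpa using Nat.mul_le_mul le_rfl (Nat.pow_le_pow_left h k)

section SpaceBounded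

variable {α β γ σ : Type} [Code α] [Code β] [Code γ] [Code σ]

theorem sz_fst_le (a : α) (b : β) : sz a ≤ sz (a, b) := Nat.size_le_size (left_le_cpair _ _)

theorem sz_snd_le (a : α) (b : β) : sz b ≤ sz (a, b) := Nat.size_le_size (right_le_cpair _ _)

theorem sz_pair_le (a : α) (b : β) : sz (a, b) ≤ 2 * (sz a + sz b + 1) := size_cpair_le _ _

theorem enc_le_two_pow {a : α} {k : ℕ} (h : sz a ≤ k) : enc a ≤ 2 ^ k := le_two_pow_of_size h

namespace PS

/-- A function that only changes the type leaves the code as it is. -/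
theorem of_enc_eq {f : α → β} (h : ∀ a, enc (f a) = enc a) : PS f := by
  refine ⟨fun i o b => Prog.copy i o b, Polynomial.X, fun a => ⟨?_, ?_⟩⟩
  · simp [sz, h]
  · intro i o b s hi ho hio hsi hso hb
    have := Prog.exec_copy (B := 2 ^ (sz a)) (s := s) hio (by omega : i ≠ b) (by omega) (hb _ le_rfl)
      (by rw [hso, hsi, zero_add]; exact enc_le_two_pow le_rfl)
    simpa [hso, hsi, h] using this

@[fun_prop] theorem id : PS (fun a : α => a) := of_enc_eq fun _ => rfl

@[fun_prop] theorem const (b : β) : PS (fun _ : α => b) := by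
  refine ⟨fun _ o _ => Prog.incs o (enc b), Polynomial.C (sz b), fun a => ⟨by simp, ?_⟩⟩
  intro i o r s _ _ _ _ hso _
  have := Prog.exec_incs (B := 2 ^ (sz b)) (o := o) (n := enc b) (s := s)
    (by rw [hso, zero_add]; exact enc_le_two_pow le_rfl)
  simpa [hso] using this

@[fun_prop] theorem comp {g : β → γ} {f : α → β} (hg : PS g) (hf : PS f) : PS (fun a => g (f a)) := by
  obtain ⟨cg, P, hg⟩ := hg
  obtain ⟨cf, Q, hf⟩ := hf
  refine ⟨fun i o b => .seq (cf i b (b + 1)) (.seq (cg b o (b + 1)) (.clear b)),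
    P.comp Q + Q, fun a => ⟨?_, ?_⟩⟩
  · have h1 := (hg (f a)).1
    have h2 := poly_mono P (hf a).1
    simp only [Polynomial.eval_add, Polynomial.eval_comp] at h2 ⊢
    omega
  · intro i o b s hi ho hio hsi hso hb
    have hQ : 2 ^ Q.eval (sz a) ≤ 2 ^ (P.comp Q + Q).eval (sz a) :=
      Nat.pow_le_pow_right (by norm_num) (by simp)
    have hP : 2 ^ P.eval (sz (f a)) ≤ 2 ^ (P.comp Q + Q).eval (sz a) := by
      refine Nat.pow_le_pow_right (by norm_num) ?_
      have h2 := poly_mono P (hf a).1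
      simp only [Polynomial.eval_add, Polynomial.eval_comp] at h2 ⊢
      omega
    refine .seq ((hf a).2.mono hQ i b (b + 1) s (by omega) (by omega) (by omega) hsi
      (hb _ le_rfl) fun r hr => hb r (by omega)) (.seq ((hg (f a)).2.mono hP b o (b + 1) _
      (by omega) (by omega) (by omega) (by simp) (by rw [update_of_ne (by omega)]; exact hso)
      fun r hr => by rw [update_of_ne (by omega)]; exact hb r (by omega))
      ((Prog.exec_clear b _).congr ?_))
    funext r
    have := hb b le_rfl
    simp only [update_apply]; split_ifs <;> simp_all

@[fun_prop] theorem prodMk {f : α → β} {g : α → γ} (hf : PS f) (hg : PS g) : PS (fun a => (f a, g a)) := by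
  obtain ⟨cf, P, hf⟩ := hf
  obtain ⟨cg, Q, hg⟩ := hg
  refine ⟨fun i o b => .seq (cf i b (b + 2)) (.seq (cg i (b + 1) (b + 2)) (.pairP b (b + 1) o)),
    2 * (P + Q + 1), fun a => ?_⟩
  have hs : sz (f a, g a) ≤ (2 * (P + Q + 1)).eval (sz a) := by
    have h1 := (hf a).1
    have h2 := (hg a).1
    have := sz_pair_le (f a) (g a)
    simp only [Polynomial.eval_add, Polynomial.eval_mul, Polynomial.eval_ofNat,
      Polynomial.eval_one]
    omega
  refine ⟨hs, ?_⟩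
  intro i o b s hi ho hio hsi hso hb
  refine .seq ((hf a).2.mono (Nat.pow_le_pow_right (by norm_num) ?_) i b (b + 2) s (by omega)
    (by omega) (by omega) hsi (hb _ le_rfl) fun r hr => hb r (by omega))
    (.seq ((hg a).2.mono (Nat.pow_le_pow_right (by norm_num) ?_) i (b + 1) (b + 2) _ (by omega)
      (by omega) (by omega) (by rw [update_of_ne (by omega)]; exact hsi)
      (by rw [update_of_ne (by omega)]; exact hb _ (by omega))
      fun r hr => by rw [update_of_ne (by omega)]; exact hb r (by omega))
    ((Prog.exec_pairP (by omega) (by omega) (by omega) ?_ ?_).congr ?_))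
  · simp; omega
  · simp; omega
  · rw [update_of_ne (by omega), update_of_ne (by omega)]; exact hso
  · simpa [enc_pair] using enc_le_two_pow hs
  · rw [enc_pair]
    funext r
    by_cases r1 : r = o
    · subst r1; simp
    by_cases r2 : r = b
    · subst r2; simp [hb r le_rfl, r1]
    by_cases r3 : r = b + 1
    · subst r3; simp [hb (b + 1) (by omega), r1]
    simp [r1, r2, r3]

@[fun_prop] theorem fst : PS (fun p : α × β => p.1) := by
  refine ⟨fun i o b => .seq (.unpairP i o b (b + 1)) (.clear b), Polynomial.X, fun a =>
    ⟨by simpa using sz_fst_le a.1 a.2, ?_⟩⟩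
  intro i o b s hi ho hio hsi hso hb
  refine .seq (Prog.exec_unpairP (by omega) (by omega) (by omega) (by omega) hso (hb _ le_rfl)
    (fun r hr => hb r (by omega)) ?_) ((Prog.exec_clear b _).congr ?_)
  · rw [hsi]; simpa using enc_le_two_pow le_rfl
  · have := hb b le_rfl
    rw [hsi, enc_pair, cunpair_cpair]
    funext r
    simp only [update_apply]; split_ifs <;> simp_all

@[fun_prop] theorem snd : PS (fun p : α × β => p.2) := by
  refine ⟨fun i o b => .seq (.unpairP i b o (b + 1)) (.clear b), Polynomial.X, fun a =>
    ⟨by simpa using sz_snd_le a.1 a.2, ?_⟩⟩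
  intro i o b s hi ho hio hsi hso hb
  refine .seq (Prog.exec_unpairP (by omega) (by omega) (by omega) (by omega) (hb _ le_rfl) hso
    (fun r hr => hb r (by omega)) ?_) ((Prog.exec_clear b _).congr ?_)
  · rw [hsi]; simpa using enc_le_two_pow le_rfl
  · have := hb b le_rfl
    rw [hsi, enc_pair, cunpair_cpair]
    funext r
    simp only [update_apply]; split_ifs <;> simp_all

theorem nat_succ : PS Nat.succ := by
  refine ⟨fun i o b => .seq (.copy i o b) (.inc o), Polynomial.X + 1, fun a => ?_⟩
  have hle : a + 1 ≤ 2 ^ sz a := Nat.lt_size_self a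
  have hle2 : a + 1 ≤ 2 ^ (sz a + 1) :=
    hle.trans (Nat.pow_le_pow_right (by norm_num) (by omega))
  refine ⟨?_, ?_⟩
  · simp only [Polynomial.eval_add, Polynomial.eval_X, Polynomial.eval_one]
    refine Nat.size_le.2 (lt_of_le_of_lt hle ?_)
    exact Nat.pow_lt_pow_right (by norm_num) (by omega)
  · intro i o b s hi ho hio hsi hso hb
    simp only [Polynomial.eval_add, Polynomial.eval_X, Polynomial.eval_one, enc_nat] at hsi ⊢
    refine .seq (Prog.exec_copy hio (by omega) (by omega) (hb _ le_rfl)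
      (by rw [hso, hsi, zero_add]; exact (Nat.le_succ a).trans hle2)) (Prog.exec_inc ?_ ?_)
    · simpa [hso, hsi] using hle2
    · simp [hso, hsi]

/-- Iteration, provided that all iterates have polynomial length. The number of rounds may be
exponential. -/
theorem iterate_base {g : σ → σ} {f : α → σ} {n : α → ℕ} (hg : PS g) (hf : PS f) (hn : PS n)
    (Q : Polynomial ℕ) (hQ : ∀ a, ∀ j ≤ n a, sz (g^[j] (f a)) ≤ Q.eval (sz a)) :
    PS (fun a => g^[n a] (f a)) := by
  obtain ⟨cg, P, hg⟩ := hg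
  obtain ⟨cf, P₁, hf⟩ := hf
  obtain ⟨cn, P₂, hn⟩ := hn
  refine ⟨fun i o b => .seq (cf i o b) (.seq (cn i b (b + 1)) (.loop b (.seq (.dec b)
    (.seq (cg o (b + 1) (b + 2)) (.seq (.clear o) (.move (b + 1) o)))))),
    -- `P.comp Q` pays for one round on an iterate of length at most `Q`, `Q` for storing iterates,
    -- `P₁` and `P₂` for the start value and the counter.
    P.comp Q + Q + P₁ + P₂, fun a => ⟨?_, ?_⟩⟩
  · have := hQ a (n a) le_rfl
    simp only [Polynomial.eval_add]; omega
  intro i o b s hi ho hio hsi hso hb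
  set B := 2 ^ (P.comp Q + Q + P₁ + P₂).eval (sz a) with hB
  have h1 : 2 ^ P₁.eval (sz a) ≤ B :=
    Nat.pow_le_pow_right (by norm_num) (by simp only [Polynomial.eval_add]; omega)
  have h2 : 2 ^ P₂.eval (sz a) ≤ B :=
    Nat.pow_le_pow_right (by norm_num) (by simp only [Polynomial.eval_add]; omega)
  refine .seq ((hf a).2.mono h1 i o b s hi ho hio hsi hso hb)
    (.seq ((hn a).2.mono h2 i b (b + 1) _ (by omega) (by omega) (by omega)
      (by rw [update_of_ne (by omega)]; exact hsi)
      (by rw [update_of_ne (by omega)]; exact hb _ le_rfl)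
      fun r hr => by rw [update_of_ne (by omega)]; exact hb _ (by omega)) ?_)
  -- Invariant: with `k` rounds left, `o` holds the iterate number `n a - k`.
  have := Prog.Exec.loop_count (B := B) (r := b) (n := n a)
    (p := .seq (.dec b) (.seq (cg o (b + 1) (b + 2)) (.seq (.clear o) (.move (b + 1) o))))
    (fun k => update (update s o (enc (g^[n a - k] (f a)))) b k)
    (fun k _ => by simp) (fun k hk => by
      have e : n a - k = (n a - (k + 1)) + 1 := by omega
      have hle := hQ a (n a - (k + 1)) (by omega)
      have hle' := hQ a (n a - k) (by omega)
      rw [e, iterate_succ_apply'] at hle' ⊢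
      set u := g^[n a - (k + 1)] (f a) with hu
      have h3 : 2 ^ P.eval (sz u) ≤ B := by
        refine Nat.pow_le_pow_right (by norm_num) ?_
        have := poly_mono P hle
        simp only [Polynomial.eval_add, Polynomial.eval_comp] at this ⊢
        omega
      have h4 : enc (g u) ≤ B := by
        refine enc_le_two_pow (hle'.trans ?_)
        simp only [Polynomial.eval_add]; omega
      have hb0 := hb b le_rfl
      have hb1 := hb (b + 1) (by omega)
      refine .seq (.dec _ _) (.seq ((hg u).2.mono h3 o (b + 1) (b + 2) _ (by omega) (by omega)
        (by omega) ?_ ?_ ?_) (.seq (Prog.exec_clear _ _) ((Prog.exec_move (by omega) ?_).congr ?_)))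
      · rw [update_of_ne (by omega), update_of_ne (by omega), update_self]
      · rw [update_of_ne (by omega), update_of_ne (by omega), update_of_ne (by omega), hb1]
      · intro r hr
        rw [update_of_ne (by omega), update_of_ne (by omega), update_of_ne (by omega)]
        exact hb _ (by omega)
      · rw [update_self, update_of_ne (by omega), update_self]; omega
      · funext r
        by_cases r1 : r = o
        · subst r1
          simp [show r ≠ b by omega, show r ≠ b + 1 by omega, show b + 1 ≠ r by omega]
        by_cases r2 : r = b
        · subst r2; simp [show r ≠ o by omega]
        by_cases r3 : r = b + 1
        · subst r3; simp [show b + 1 ≠ o by omega, hb1]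
        simp [r1, r2, r3])
  convert this using 1
  · funext r; simp only [update_apply]; split_ifs <;> simp_all
  · have := hb b le_rfl
    funext r; simp only [update_apply]; split_ifs <;> simp_all

end PS

/-- The language of a Boolean function computable in polynomial space is in PSPACE. -/
theorem PS.inPSPACE {f : List CodeSym → Bool} (hf : PS f) :
    InPSPACE ({x | f x = true} : Language CodeSym) := by
  obtain ⟨c, P, hf⟩ := hf
  -- Polynomials in `PS` refer to the size of the code, which is three bits per symbol.
  refine InPSPACE.of_prog f (.seq (c 0 1 2) (.clear 0)) (P.comp (3 * Polynomial.X)) fun x => ?_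
  have h := (hf x).2 0 1 2 (update (fun _ => 0) 0 (codeString x)) (by omega) (by omega) (by omega)
    (by simp [enc_string]) (by simp) (fun r hr => by rw [update_of_ne (by omega)])
  have e : sz x = 3 * x.length := size_codeString x
  rw [e] at h
  refine .seq (by simpa using h) ((Prog.exec_clear 0 _).congr ?_)
  funext r
  simp only [update_apply]; split_ifs <;> simp_all [enc_bool]

end SpaceBounded

/-! ## Arithmetic in polynomial space -/

section Closure

variable {α β γ σ τ : Type} [Code α] [Code β] [Code γ] [Code σ] [Code τ]

theorem sz_nat (n : ℕ) : sz n = n.size := rfl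

theorem size_add_le (m n : ℕ) : (m + n).size ≤ m.size + n.size + 1 := by
  rw [Nat.size_le]
  have hm := Nat.lt_size_self m
  have hn := Nat.lt_size_self n
  have h2 : 2 ^ m.size ≤ 2 ^ (m.size + n.size) := Nat.pow_le_pow_right (by norm_num) (by omega)
  have h3 : 2 ^ n.size ≤ 2 ^ (m.size + n.size) := Nat.pow_le_pow_right (by norm_num) (by omega)
  rw [pow_succ]; omega

theorem size_mul_le (m n : ℕ) : (m * n).size ≤ m.size + n.size := by
  rw [Nat.size_le, pow_add]
  rcases Nat.eq_zero_or_pos (m * n) with h | h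
  · rw [h]; positivity
  · exact Nat.mul_lt_mul'' (Nat.lt_size_self m) (Nat.lt_size_self n)

theorem cpair_mono {a b c d : ℕ} (h : a ≤ c) (h' : b ≤ d) : cpair a b ≤ cpair c d := by
  have := tri_mono (Nat.add_le_add h h')
  unfold cpair; omega

theorem enc_pair_mono {a c : α} {b d : β} (h : enc a ≤ enc c) (h' : enc b ≤ enc d) :
    enc (a, b) ≤ enc (c, d) := cpair_mono h h'

theorem enc_bool_le (b : Bool) : enc b ≤ 1 := by cases b <;> simp [enc_bool]

namespace PS

theorem of_eq {f g : α → β} (hf : PS f) (h : ∀ a, f a = g a) : PS g := by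
  rwa [← funext h]

theorem poly_bound {f : α → β} (hf : PS f) :
    ∃ P : Polynomial ℕ, ∀ a, sz (f a) ≤ P.eval (sz a) := by
  obtain ⟨_, P, h⟩ := hf
  exact ⟨P, fun a => (h a).1⟩

/-- Iteration with a parameter. -/
theorem iterate_poly {g : α → σ → σ} {f : α → σ} {n : α → ℕ}
    (hg : PS fun p : α × σ => g p.1 p.2) (hf : PS f) (hn : PS n)
    (Q : Polynomial ℕ) (hQ : ∀ a, ∀ j ≤ n a, sz ((g a)^[j] (f a)) ≤ Q.eval (sz a)) :
    PS (fun a => (g a)^[n a] (f a)) := by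
  have key : ∀ (a : α) (j : ℕ), (fun p : α × σ => (p.1, g p.1 p.2))^[j] (a, f a) =
      (a, (g a)^[j] (f a)) := by
    intro a j
    induction j with
    | zero => rfl
    | succ j ih => rw [iterate_succ_apply', ih, iterate_succ_apply']
  have := iterate_base (g := fun p : α × σ => (p.1, g p.1 p.2)) (f := fun a => (a, f a)) (n := n)
    (by fun_prop) (by fun_prop) hn (2 * (Polynomial.X + Q + 1)) (by
      intro a j hj
      rw [key]
      have h1 := hQ a j hj
      have h2 := sz_pair_le a ((g a)^[j] (f a))
      simp only [Polynomial.eval_add, Polynomial.eval_mul, Polynomial.eval_ofNat,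
        Polynomial.eval_one, Polynomial.eval_X]
      omega)
  exact (snd.comp this).of_eq fun a => by rw [key]

/-- Iteration where a computable function bounds the iterates. -/
theorem iterate {g : α → σ → σ} {f : α → σ} {n : α → ℕ} {b : α → τ}
    (hg : PS fun p : α × σ => g p.1 p.2) (hf : PS f) (hn : PS n) (hb : PS b)
    (h : ∀ a, ∀ j ≤ n a, enc ((g a)^[j] (f a)) ≤ enc (b a)) :
    PS (fun a => (g a)^[n a] (f a)) := by
  obtain ⟨Q, hQ⟩ := hb.poly_bound
  exact iterate_poly hg hf hn Q fun a j hj => (Nat.size_le_size (h a j hj)).trans (hQ a)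

-- Branching is iteration: from the pair `(g a, f a)`, one round moves the second entry to the front
-- and zero rounds leave the first there.
@[fun_prop] theorem bool_cond {c : α → Bool} {f g : α → β} (hc : PS c) (hf : PS f) (hg : PS g) :
    PS (fun a => cond (c a) (f a) (g a)) := by
  have hn : PS (fun a => (c a).toNat) :=
    comp (g := Bool.toNat) (of_enc_eq fun b => rfl) hc
  have := iterate_poly (g := fun (_ : α) (p : β × β) => (p.2, p.2)) (f := fun a => (g a, f a))
    (n := fun a => (c a).toNat) (by fun_prop) (by fun_prop) hn
  obtain ⟨P, hP⟩ := hf.poly_bound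
  obtain ⟨Q, hQ⟩ := hg.poly_bound
  refine (fst.comp (this (2 * (P + Q + P + 1)) ?_)).of_eq fun a => by cases c a <;> rfl
  intro a j hj
  have h0 : j = 0 ∨ j = 1 := by cases h : c a <;> simp_all; omega
  have h1 := hP a
  have h2 := hQ a
  have h3 := sz_pair_le (g a) (f a)
  have h4 := sz_pair_le (f a) (f a)
  simp only [Polynomial.eval_add, Polynomial.eval_mul, Polynomial.eval_ofNat, Polynomial.eval_one]
  rcases h0 with rfl | rfl
  · simp only [iterate_zero, id_eq]; omega
  · simp only [iterate_one]; omega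

@[fun_prop] theorem bool_and {f g : α → Bool} (hf : PS f) (hg : PS g) :
    PS (fun a => f a && g a) :=
  (bool_cond hf hg (const false)).of_eq fun a => by cases f a <;> rfl

@[fun_prop] theorem bool_or {f g : α → Bool} (hf : PS f) (hg : PS g) :
    PS (fun a => f a || g a) :=
  (bool_cond hf (const true) hg).of_eq fun a => by cases f a <;> rfl

@[fun_prop] theorem nat_add {f g : α → ℕ} (hf : PS f) (hg : PS g) : PS (fun a => f a + g a) := by
  have key : ∀ m j, Nat.succ^[j] m = m + j := fun m j => Nat.succ_iterate m j
  obtain ⟨P, hP⟩ := hf.poly_bound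
  obtain ⟨Q, hQ⟩ := hg.poly_bound
  refine (iterate_base nat_succ hf hg (P + Q + 1) ?_).of_eq fun a => key _ _
  intro a j hj
  rw [key, sz_nat]
  have h1 := hP a
  have h2 := hQ a
  have h3 := size_add_le (f a) j
  have h4 := Nat.size_le_size hj
  simp only [Polynomial.eval_add, Polynomial.eval_one, sz_nat] at *
  omega

@[fun_prop] theorem nat_mul {f g : α → ℕ} (hf : PS f) (hg : PS g) : PS (fun a => f a * g a) := by
  have key : ∀ m j, (fun x => x + m)^[j] 0 = m * j := by
    intro m j
    rw [add_right_iterate_apply_zero, smul_eq_mul, mul_comm]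
  obtain ⟨P, hP⟩ := hf.poly_bound
  obtain ⟨Q, hQ⟩ := hg.poly_bound
  refine (iterate_poly (g := fun a x => x + f a) (f := fun _ => 0) (n := g) (by fun_prop)
    (by fun_prop) hg (P + Q) ?_).of_eq fun a => key _ _
  intro a j hj
  rw [key, sz_nat]
  have h1 := hP a
  have h2 := hQ a
  have h3 := size_mul_le (f a) j
  have h4 := Nat.size_le_size hj
  simp only [Polynomial.eval_add, Polynomial.eval_one, sz_nat] at *
  omega

/-- Kleene's trick: count up while remembering the previous number. -/
theorem nat_pred : PS Nat.pred := by
  have key : ∀ j, (fun p : ℕ × ℕ => (p.2, p.2 + 1))^[j] (0, 0) = (j.pred, j) := by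
    intro j
    induction j with
    | zero => rfl
    | succ j ih => rw [iterate_succ_apply', ih]; rfl
  refine (fst.comp (iterate (g := fun (_ : ℕ) (p : ℕ × ℕ) => (p.2, p.2 + 1)) (f := fun _ => (0, 0))
    (n := fun n => n) (b := fun n => (n, n)) (by fun_prop) (by fun_prop) (by fun_prop)
    (by fun_prop) ?_)).of_eq fun n => by rw [key]
  intro n j hj
  rw [key]
  exact enc_pair_mono ((Nat.pred_le j).trans hj) hj

@[fun_prop] theorem nat_sub {f g : α → ℕ} (hf : PS f) (hg : PS g) : PS (fun a => f a - g a) := by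
  have key : ∀ m j, Nat.pred^[j] m = m - j := fun m j => Nat.pred_iterate m j
  refine (iterate (g := fun _ x => Nat.pred x) (b := f) (nat_pred.comp snd) hf hg hf ?_).of_eq
    fun a => key _ _
  intro a j _
  rw [key]
  exact Nat.sub_le _ _

theorem isZero : PS (fun n : ℕ => decide (n = 0)) := by
  have key : ∀ j, (fun _ : Bool => false)^[j] true = decide (j = 0) := by
    intro j
    cases j with
    | zero => rfl
    | succ j => rw [iterate_succ_apply']; rfl
  refine (iterate (g := fun (_ : ℕ) (_ : Bool) => false) (f := fun _ => true) (n := fun n => n)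
    (b := fun _ => (1 : ℕ)) (by fun_prop) (by fun_prop) (by fun_prop) (by fun_prop) ?_).of_eq
    fun a => key _
  exact fun a j _ => enc_bool_le _

@[fun_prop] theorem nat_ble {f g : α → ℕ} (hf : PS f) (hg : PS g) :
    PS (fun a => Nat.ble (f a) (g a)) :=
  (isZero.comp (nat_sub hf hg)).of_eq fun a => by
    rw [Bool.eq_iff_iff, decide_eq_true_iff, Nat.ble_eq]; omega

@[fun_prop] theorem nat_beq {f g : α → ℕ} (hf : PS f) (hg : PS g) :
    PS (fun a => Nat.beq (f a) (g a)) :=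
  (bool_and (nat_ble hf hg) (nat_ble hg hf)).of_eq fun a => by
    rw [Bool.eq_iff_iff, Bool.and_eq_true, Nat.ble_eq, Nat.ble_eq, Nat.beq_eq]; omega

/-- Counting up with a remainder that wraps at the divisor. For divisor `0` it never wraps, in
agreement with `j / 0 = 0` and `j % 0 = j`. -/
theorem divMod : PS (fun p : ℕ × ℕ => (p.1 / p.2, p.1 % p.2)) := by
  have key : ∀ d j : ℕ, (fun s : ℕ × ℕ => cond (Nat.beq (s.2 + 1) d) (s.1 + 1, 0) (s.1, s.2 + 1))^[j]
      (0, 0) = (j / d, j % d) := by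
    intro d j
    induction j with
    | zero => simp
    | succ j ih =>
      rw [iterate_succ_apply', ih]
      by_cases h : j % d + 1 = d
      · have h' : Nat.beq (j % d + 1) d = true := by rw [Nat.beq_eq]; exact h
        have hd : d ∣ j + 1 := by
          refine ⟨j / d + 1, ?_⟩
          have := Nat.div_add_mod j d
          rw [mul_add, mul_one]; omega
        simp only [h', cond_true]
        rw [Nat.succ_div_of_dvd hd, Nat.mod_eq_zero_of_dvd hd]
      · have h' : Nat.beq (j % d + 1) d = false := by
          rw [← Bool.not_eq_true, Nat.beq_eq]; exact h
        have hd : ¬ d ∣ j + 1 := by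
          intro hd
          rcases Nat.eq_zero_or_pos d with rfl | hd0
          · rw [zero_dvd_iff] at hd; omega
          · rcases Nat.eq_or_lt_of_le hd0 with h1 | h1
            · apply h; rw [← h1, Nat.mod_one]
            · have hlt := Nat.mod_lt j hd0
              have : (j % d + 1) % d = 0 := by
                rw [Nat.mod_add_mod]; exact Nat.mod_eq_zero_of_dvd hd
              rw [Nat.mod_eq_of_lt (by omega)] at this
              omega
        simp only [h', cond_false]
        rw [Nat.succ_div_of_not_dvd hd]
        have h1 := Nat.div_add_mod (j + 1) d
        have h2 := Nat.div_add_mod j d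
        rw [Nat.succ_div_of_not_dvd hd] at h1
        exact Prod.ext rfl (by simp only; omega)
  refine (iterate (g := fun (p : ℕ × ℕ) (s : ℕ × ℕ) =>
      cond (Nat.beq (s.2 + 1) p.2) (s.1 + 1, 0) (s.1, s.2 + 1)) (f := fun _ => (0, 0))
    (n := fun p => p.1) (b := fun p => (p.1, p.1)) (by fun_prop) (by fun_prop) (by fun_prop)
    (by fun_prop) ?_).of_eq fun a => key _ _
  intro a j hj
  rw [key]
  exact enc_pair_mono ((Nat.div_le_self _ _).trans hj) ((Nat.mod_le _ _).trans hj)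

@[fun_prop] theorem nat_div {f g : α → ℕ} (hf : PS f) (hg : PS g) : PS (fun a => f a / g a) :=
  fst.comp (divMod.comp (prodMk hf hg))

@[fun_prop] theorem nat_mod {f g : α → ℕ} (hf : PS f) (hg : PS g) : PS (fun a => f a % g a) :=
  snd.comp (divMod.comp (prodMk hf hg))

/-- Powers of two with a short exponent. -/
theorem two_pow {f : α → ℕ} (hf : PS f) (Q : Polynomial ℕ) (hQ : ∀ a, f a ≤ Q.eval (sz a)) :
    PS (fun a => 2 ^ f a) := by
  have key : ∀ j, (fun x => 2 * x)^[j] 1 = 2 ^ j := by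
    intro j
    rw [mul_left_iterate_apply_one]
  refine (iterate_poly (g := fun (_ : α) (x : ℕ) => 2 * x) (f := fun _ => 1) (n := f) (by fun_prop)
    (by fun_prop) hf (Q + 1) ?_).of_eq fun a => key _
  intro a j hj
  rw [key, sz_nat, Nat.size_pow]
  have := hQ a
  simp only [Polynomial.eval_add, Polynomial.eval_one]
  omega

end PS

/-- Bounded search. -/
def bex (n : ℕ) (p : ℕ → Bool) : Bool := decide (∃ v < n, p v = true)

theorem bex_eq_true {n : ℕ} {p : ℕ → Bool} : bex n p = true ↔ ∃ v < n, p v = true := by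
  simp [bex]

/-- The range may be exponential: the search keeps only a counter and a flag. -/
theorem PS.bounded_exists {n : α → ℕ} {p : α → ℕ → Bool} (hn : PS n)
    (hp : PS fun q : α × ℕ => p q.1 q.2) : PS (fun a => bex (n a) (p a)) := by
  have key : ∀ a j, (fun s : ℕ × Bool => (s.1 + 1, s.2 || p a s.1))^[j] (0, false) =
      (j, bex j (p a)) := by
    intro a j
    induction j with
    | zero => simp [bex]
    | succ j ih =>
      rw [iterate_succ_apply', ih]
      refine Prod.ext rfl ?_
      rw [Bool.eq_iff_iff, Bool.or_eq_true, bex_eq_true, bex_eq_true]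
      constructor
      · rintro (⟨v, hv, h⟩ | h)
        · exact ⟨v, by omega, h⟩
        · exact ⟨j, by omega, h⟩
      · rintro ⟨v, hv, h⟩
        rcases Nat.lt_succ_iff_lt_or_eq.1 hv with h1 | rfl
        · exact .inl ⟨v, h1, h⟩
        · exact .inr h
  refine (PS.snd.comp (PS.iterate (g := fun a (s : ℕ × Bool) => (s.1 + 1, s.2 || p a s.1))
    (f := fun _ => (0, false)) (n := n) (b := fun a => (n a, 1)) ?_ (by fun_prop) hn (by fun_prop)
    ?_)).of_eq fun a => by rw [key]
  · have : PS (fun q : α × (ℕ × Bool) => p q.1 q.2.1) :=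
      hp.comp (g := fun q : α × ℕ => p q.1 q.2) (f := fun q : α × (ℕ × Bool) => (q.1, q.2.1))
        (by fun_prop)
    fun_prop
  · intro a j hj
    rw [key]
    exact enc_pair_mono (d := (1 : ℕ)) hj (enc_bool_le _)

end Closure

/-! ## Reachability in exponential graphs -/

/-- There is a walk of length `2 ^ k` from `u` to `v` whose inner vertices are less than `W`. -/
def savR (e : ℕ → ℕ → Bool) (W : ℕ) : ℕ → ℕ → ℕ → Prop
  | 0, u, v => e u v = true
  | k + 1, u, v => ∃ m < W, savR e W k u m ∧ savR e W k m v

/-- There is a walk of length `n` from `u` to `v` whose vertices after `u` are less than `W`. -/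
def Walk (e : ℕ → ℕ → Bool) (W : ℕ) : ℕ → ℕ → ℕ → Prop
  | 0, u, v => u = v
  | n + 1, u, v => ∃ m < W, e u m = true ∧ Walk e W n m v

/-! ### Halving of walks. -/

section Walks

variable {e : ℕ → ℕ → Bool} {W : ℕ}

theorem Walk.split {m n u v : ℕ} (hu : u < W) (h : Walk e W (m + n) u v) :
    ∃ x < W, Walk e W m u x ∧ Walk e W n x v := by
  induction m generalizing u with
  | zero => rw [Nat.zero_add] at h; exact ⟨u, hu, rfl, h⟩
  | succ m ih =>
    rw [Nat.succ_add] at h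
    obtain ⟨y, hy, h1, h2⟩ := h
    obtain ⟨x, hx, h3, h4⟩ := ih hy h2
    exact ⟨x, hx, ⟨y, hy, h1, h3⟩, h4⟩

/-- Self-loops pad short walks to length `2 ^ k`; otherwise halve the walk and recurse. -/
theorem Walk.savR (he : ∀ u, e u u = true) {k n u v : ℕ} (hu : u < W) (hn : n ≤ 2 ^ k)
    (h : Walk e W n u v) : savR e W k u v := by
  induction k generalizing n u v with
  | zero =>
    have : n = 0 ∨ n = 1 := by simp at hn; omega
    rcases this with rfl | rfl
    · cases h; exact he u
    · obtain ⟨m, _, h1, rfl⟩ := h; exact h1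
  | succ k ih =>
    rw [pow_succ] at hn
    obtain ⟨a, b, rfl, ha, hb⟩ : ∃ a b, n = a + b ∧ a ≤ 2 ^ k ∧ b ≤ 2 ^ k :=
      ⟨n / 2, n - n / 2, by omega, by omega, by omega⟩
    obtain ⟨x, hx, h1, h2⟩ := h.split hu
    exact ⟨x, hx, ih hu ha h1, ih hx hb h2⟩

/-- Edges between vertices below `W`. -/
def EdgeBelow (e : ℕ → ℕ → Bool) (W u v : ℕ) : Prop := u < W ∧ v < W ∧ e u v = true

/-- When a vertex put in front occurs again later, everything before that occurrence is cut off. -/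
theorem exists_nodup_chain {α : Type*} {r : α → α → Prop} {u v : α} (h : ReflTransGen r u v) :
    ∃ l : List α, (u :: l).Nodup ∧ (u :: l).IsChain r ∧ (u :: l).getLast (by simp) = v := by
  induction h using ReflTransGen.head_induction_on with
  | refl => exact ⟨[], by simp, by simp, rfl⟩
  | @head a c h _ ih =>
    obtain ⟨l, h1, h2, h3⟩ := ih
    by_cases ha : a ∈ c :: l
    · obtain ⟨l1, l2, e⟩ := List.append_of_mem ha
      have hs : (a :: l2) <:+ (c :: l) := ⟨l1, e.symm⟩
      refine ⟨l2, h1.sublist hs.sublist, h2.suffix hs, ?_⟩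
      rw [← h3]
      simp only [e]
      rw [List.getLast_append_of_ne_nil]
    · exact ⟨c :: l, List.nodup_cons.2 ⟨ha, h1⟩, List.isChain_cons_cons.2 ⟨h, h2⟩, by simpa using h3⟩

theorem walk_of_chain {u : ℕ} {l : List ℕ} (h : (u :: l).IsChain (EdgeBelow e W)) :
    Walk e W l.length u ((u :: l).getLast (by simp)) := by
  induction l generalizing u with
  | nil => rfl
  | cons c l ih =>
    rw [List.isChain_cons_cons] at h
    exact ⟨c, h.1.2.1, h.1.2.2, by simpa using ih h.2⟩

/-- A walk without repeated vertices has fewer than `W ≤ 2 ^ k` steps. -/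
theorem savR_iff (he : ∀ u, e u u = true) {k : ℕ} (hk : W ≤ 2 ^ k) {u v : ℕ} (hu : u < W)
    (hv : v < W) : savR e W k u v ↔ ReflTransGen (EdgeBelow e W) u v := by
  constructor
  · intro h
    clear hk
    induction k generalizing u v with
    | zero => exact .single ⟨hu, hv, h⟩
    | succ k ih =>
      obtain ⟨m, hm, h1, h2⟩ := h
      exact (ih hu hm h1).trans (ih hm hv h2)
  · intro h
    obtain ⟨l, h1, h2, h3⟩ := exists_nodup_chain h
    have hw := walk_of_chain h2
    rw [h3] at hw
    refine hw.savR he hu ?_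
    have hall : ∀ x ∈ u :: l, x < W := by
      have : ∀ (l : List ℕ) (u : ℕ), u < W → (u :: l).IsChain (EdgeBelow e W) → ∀ x ∈ u :: l, x < W := by
        intro l
        induction l with
        | nil => intro u hu _ x hx; simp at hx; omega
        | cons c l ih =>
          intro u hu h x hx
          rw [List.isChain_cons_cons] at h
          rcases List.mem_cons.1 hx with rfl | hx
          · exact hu
          · exact ih c h.1.2.1 h.2 x hx
      exact this l u hu h2
    have : (u :: l).length ≤ W := by
      rw [← List.toFinset_card_of_nodup h1]
      refine (Finset.card_le_card (t := Finset.range W) fun x hx => ?_).trans (by simp)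
      exact Finset.mem_range.2 (hall x (List.mem_toFinset.1 hx))
    simp at this
    omega

end Walks

/-- States of the search: a mode (`0` for a call, `1` for failure, `2` for success), the level, and
three stacks written to base `W` or `2 * W`, which hold the end points of the current subproblems
and the progress of the search for their midpoints. -/
abbrev SavState := ℕ × ℕ × ℕ × ℕ × ℕ

/-- One step of the depth-first search for a walk of length `2 ^ K`. -/
def savStep (e : ℕ → ℕ → Bool) (W K : ℕ) (s : SavState) : SavState :=
  let k := s.2.1
  let U := s.2.2.1
  let V := s.2.2.2.1
  let E := s.2.2.2.2
  -- The lowest digits of `U` and `V` are the end points of the current subproblem. The lowest digit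
  -- of `E` is `2 m + b`, where `m` is the midpoint on trial and `b` tells which half is being
  -- examined. A call pops its own end points when it is answered, which uncovers those of its
  -- caller.
  cond (Nat.beq s.1 0)
    (cond (Nat.beq k 0)
      (cond (e (U % W) (V % W)) 2 1, 0, U / W, V / W, E)
      (0, k - 1, U * W + U % W, V * W, E * (2 * W)))
    (cond (Nat.beq k K) s
      (cond (Nat.beq s.1 2)
        (cond (Nat.beq (E % 2) 0)
          (0, k, U * W + E % (2 * W) / 2, V * W + V % W, E + 1)
          (2, k + 1, U / W, V / W, E / (2 * W)))
        (cond (Nat.ble W (E % (2 * W) / 2 + 1))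
          (1, k + 1, U / W, V / W, E / (2 * W))
          (0, k, U * W + U % W, V * W + (E % (2 * W) / 2 + 1),
            E - E % (2 * W) + 2 * (E % (2 * W) / 2 + 1)))))

/-! ### Correctness, running time and size of the depth-first search. -/

section SavStep

variable {e : ℕ → ℕ → Bool} {W K : ℕ}

theorem mul_add_div_base {U u : ℕ} (hu : u < W) : (U * W + u) / W = U := by
  rw [mul_comm, Nat.mul_add_div (by omega), Nat.div_eq_of_lt hu, add_zero]

theorem mul_add_mod_base {U u : ℕ} (hu : u < W) : (U * W + u) % W = u := by
  rw [mul_comm, Nat.mul_add_mod, Nat.mod_eq_of_lt hu]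

-- Induction on the level: a call replaces its top digits by an answer and leaves the rest of the
-- stacks intact. Each of the `W` midpoints costs at most two calls and two more steps, and `W * (2
-- * t + 2) + 1 ≤ 8 * W * t`.
open Classical in
theorem savStep_call (k : ℕ) (hk : k ≤ K) {u v : ℕ} (hu : u < W) (hv : v < W) (U V E : ℕ) :
    ∃ T ≤ (8 * W) ^ k, (savStep e W K)^[T] (0, k, U * W + u, V * W + v, E) =
      (if savR e W k u v then 2 else 1, k, U, V, E) := by
  induction k generalizing u v U V E with
  | zero =>
    refine ⟨1, by simp, ?_⟩
    have h0 : Nat.beq 0 0 = true := rfl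
    simp only [iterate_one, savStep, h0, cond_true, mul_add_div_base hu, mul_add_div_base hv,
      mul_add_mod_base hu, mul_add_mod_base hv, savR]
    by_cases h : e u v = true <;> simp [h]
  | succ k ih =>
    have hkK : Nat.beq k K = false := by rw [← Bool.not_eq_true, Nat.beq_eq]; omega
    have hk1 : Nat.beq (k + 1) 0 = false := rfl
    have hE : ∀ x < 2 * W, (E * (2 * W) + x) % (2 * W) = x := fun x hx => mul_add_mod_base hx
    have hE' : ∀ x < 2 * W, (E * (2 * W) + x) / (2 * W) = E := fun x hx => mul_add_div_base hx
    have hE2 : ∀ x, (E * (2 * W) + x) % 2 = x % 2 := by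
      intro x
      rw [show E * (2 * W) = 2 * (E * W) by ring, Nat.mul_add_mod]
    set t := (8 * W) ^ k with ht
    have ht1 : 1 ≤ t := Nat.one_le_pow _ _ (by omega)
    have h10 : Nat.beq 1 0 = false := rfl
    have h12 : Nat.beq 1 2 = false := rfl
    have h20 : Nat.beq 2 0 = false := rfl
    have h22 : Nat.beq 2 2 = true := rfl
    have h00 : Nat.beq 0 0 = true := rfl
    -- The search over the midpoints from `m` on, by induction on a bound for how many are left.
    have key : ∀ n m, m < W → W - m ≤ n → ∃ T ≤ n * (2 * t + 2), (savStep e W K)^[T]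
        (0, k, (U * W + u) * W + u, (V * W + v) * W + m, E * (2 * W) + 2 * m) =
        (if ∃ x < W, m ≤ x ∧ savR e W k u x ∧ savR e W k x v then 2 else 1, k + 1, U, V, E) := by
      intro n
      induction n with
      | zero => intro m hm h; omega
      | succ n ihn =>
        intro m hm hmn
        -- Failure is handled alike for the first half (`b = 0`) and the second (`b = 1`): go on to
        -- `m + 1`, or give up.
        have fail : ¬ (savR e W k u m ∧ savR e W k m v) → ∀ b < 2,
            ∃ T ≤ n * (2 * t + 2) + 1, (savStep e W K)^[T]
              (1, k, U * W + u, V * W + v, E * (2 * W) + (2 * m + b)) =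
            (if ∃ x < W, m ≤ x ∧ savR e W k u x ∧ savR e W k x v then 2 else 1,
              k + 1, U, V, E) := by
          intro hno b hb
          have hx : (2 * m + b) / 2 = m := by omega
          have hlt : 2 * m + b < 2 * W := by omega
          by_cases hn : W ≤ m + 1
          · have hW : Nat.ble W (m + 1) = true := by rw [Nat.ble_eq]; omega
            have hneg : ¬ ∃ x < W, m ≤ x ∧ savR e W k u x ∧ savR e W k x v := by
              rintro ⟨x, h1, h2, h3⟩
              have : x = m := by omega
              exact hno (this ▸ h3)
            refine ⟨1, by omega, ?_⟩
            simp only [iterate_one, savStep, h10, h12, hkK, cond_false, hE _ hlt, hE' _ hlt, hx, hW,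
              cond_true, mul_add_div_base hu, mul_add_div_base hv, if_neg hneg]
          · have hW : Nat.ble W (m + 1) = false := by rw [← Bool.not_eq_true, Nat.ble_eq]; omega
            obtain ⟨T, hT, h⟩ := ihn (m + 1) (by omega) (by omega)
            refine ⟨T + 1, by omega, ?_⟩
            rw [iterate_succ_apply]
            have hiff : (∃ x < W, m ≤ x ∧ savR e W k u x ∧ savR e W k x v) ↔
                ∃ x < W, m + 1 ≤ x ∧ savR e W k u x ∧ savR e W k x v := by
              constructor
              · rintro ⟨x, h1, h2, h3⟩
                refine ⟨x, h1, ?_, h3⟩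
                rcases Nat.eq_or_lt_of_le h2 with rfl | h
                · exact absurd h3 hno
                · exact h
              · rintro ⟨x, h1, h2, h3⟩; exact ⟨x, h1, by omega, h3⟩
            simp only [hiff]
            rw [← h]
            simp only [savStep, h10, h12, hkK, cond_false, hE _ hlt, hx, hW, mul_add_mod_base hu]
            congr 5
            omega
        have hm2 : 2 * m < 2 * W := by omega
        rw [Nat.succ_mul]
        obtain ⟨T₁, hT₁, h1⟩ := ih (by omega) hu hm (U * W + u) (V * W + v) (E * (2 * W) + 2 * m)
        by_cases hR₁ : savR e W k u m
        · rw [if_pos hR₁] at h1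
          have hs : savStep e W K (2, k, U * W + u, V * W + v, E * (2 * W) + 2 * m) =
              (0, k, (U * W + u) * W + m, (V * W + v) * W + v, E * (2 * W) + (2 * m + 1)) := by
            have : Nat.beq (2 * m % 2) 0 = true := by rw [Nat.beq_eq]; omega
            simp only [savStep, h20, h22, hkK, cond_false, cond_true, hE2, this, hE _ hm2,
              mul_add_mod_base hv]
            congr 4
            omega
          obtain ⟨T₂, hT₂, h2⟩ := ih (by omega) hm hv (U * W + u) (V * W + v)
            (E * (2 * W) + (2 * m + 1))
          by_cases hR₂ : savR e W k m v
          · rw [if_pos hR₂] at h2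
            rw [if_pos ⟨m, hm, le_rfl, hR₁, hR₂⟩]
            refine ⟨1 + (T₂ + (1 + T₁)), by omega, ?_⟩
            rw [iterate_add_apply, iterate_add_apply, iterate_add_apply, h1, iterate_one, hs, h2]
            have : Nat.beq ((2 * m + 1) % 2) 0 = false := by
              rw [← Bool.not_eq_true, Nat.beq_eq]; omega
            simp only [savStep, h20, h22, hkK, cond_false, cond_true, hE2, this,
              hE' _ (show 2 * m + 1 < 2 * W by omega), mul_add_div_base hu, mul_add_div_base hv]
          · rw [if_neg hR₂] at h2
            obtain ⟨T₃, hT₃, h3⟩ := fail (fun h => hR₂ h.2) 1 (by omega)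
            refine ⟨T₃ + (T₂ + (1 + T₁)), by omega, ?_⟩
            rw [iterate_add_apply, iterate_add_apply, iterate_add_apply, h1, iterate_one, hs, h2, h3]
        · rw [if_neg hR₁] at h1
          obtain ⟨T₃, hT₃, h3⟩ := fail (fun h => hR₁ h.1) 0 (by omega)
          refine ⟨T₃ + T₁, by omega, ?_⟩
          rw [iterate_add_apply, h1]
          exact h3
    obtain ⟨T, hT, h⟩ := key W 0 (by omega) (by omega)
    refine ⟨T + 1, ?_, ?_⟩
    · rw [pow_succ, ← ht]
      have : W * 1 ≤ W * t := Nat.mul_le_mul le_rfl ht1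
      nlinarith
    · rw [iterate_succ_apply]
      have hs : savStep e W K (0, k + 1, U * W + u, V * W + v, E) =
          (0, k, (U * W + u) * W + u, (V * W + v) * W + 0, E * (2 * W) + 2 * 0) := by
        simp only [savStep, h00, hk1, cond_false, cond_true, mul_add_mod_base hu]
        rfl
      rw [hs, h]
      simp only [savR, Nat.zero_le, true_and]
      congr

/-- The answer at the top level is a fixed point, so a fixed number of rounds can be run regardless
of when the search ends. -/
theorem savStep_final {s : SavState} (h0 : s.1 ≠ 0) (hK : s.2.1 = K) : savStep e W K s = s := by
  have h1 : Nat.beq s.1 0 = false := by rw [← Bool.not_eq_true, Nat.beq_eq]; exact h0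
  have h2 : Nat.beq s.2.1 K = true := by rw [Nat.beq_eq]; exact hK
  simp only [savStep, h1, h2, cond_false, cond_true]

/-- The stacks have the height that fits the level. -/
def SavInv (W K : ℕ) (s : SavState) : Prop :=
  -- `d` is the recursion depth. During a call the end point stacks hold one digit more than after
  -- its answer.
  s.1 ≤ 2 ∧ ∃ d, s.2.1 + d = K ∧ s.2.2.1 < W ^ (d + if s.1 = 0 then 1 else 0) ∧
    s.2.2.2.1 < W ^ (d + if s.1 = 0 then 1 else 0) ∧ s.2.2.2.2 < (2 * W) ^ d

theorem push_lt {a b d : ℕ} (ha : a < W ^ d) (hb : b < W) : a * W + b < W ^ (d + 1) := by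
  rw [pow_succ]
  have : (a + 1) * W ≤ W ^ d * W := Nat.mul_le_mul ha le_rfl
  rw [Nat.succ_mul] at this
  omega

theorem pop_lt {a d : ℕ} (ha : a < W ^ (d + 1)) : a / W < W ^ d := by
  apply Nat.div_lt_of_lt_mul
  rwa [mul_comm, ← pow_succ]

/-- This keeps the stacks short during exponentially many rounds: the depth never exceeds `K`, and
each level adds one digit to each stack. -/
theorem SavInv.step (hW : 0 < W) {s : SavState} (h : SavInv W K s) :
    SavInv W K (savStep e W K s) := by
  obtain ⟨mode, k, U, V, E⟩ := s
  obtain ⟨hm, d, hd, hU, hV, hE⟩ := h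
  simp only at hm hd hU hV hE
  have hUm : U % W < W := Nat.mod_lt _ hW
  have hVm : V % W < W := Nat.mod_lt _ hW
  by_cases h0 : mode = 0
  · subst h0
    simp only [if_true] at hU hV
    have h00 : Nat.beq 0 0 = true := rfl
    by_cases hk : k = 0
    · subst hk
      simp only [savStep, h00, cond_true]
      cases e (U % W) (V % W)
      · exact ⟨by simp, d, hd, by simpa using pop_lt hU, by simpa using pop_lt hV, hE⟩
      · exact ⟨by simp, d, hd, by simpa using pop_lt hU, by simpa using pop_lt hV, hE⟩
    · have hk' : Nat.beq k 0 = false := by rw [← Bool.not_eq_true, Nat.beq_eq]; exact hk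
      simp only [savStep, h00, hk', cond_true, cond_false]
      refine ⟨by simp, d + 1, by simp only; omega, by simpa using push_lt hU hUm,
        by simpa using push_lt hV hW, ?_⟩
      simpa using push_lt (W := 2 * W) hE (show 0 < 2 * W by omega)
  · have h0' : Nat.beq mode 0 = false := by rw [← Bool.not_eq_true, Nat.beq_eq]; exact h0
    simp only [h0, if_false, add_zero] at hU hV
    by_cases hk : k = K
    · rw [savStep_final (by exact h0) hk]
      exact ⟨hm, d, hd, by simpa [h0] using hU, by simpa [h0] using hV, hE⟩
    have hk' : Nat.beq k K = false := by rw [← Bool.not_eq_true, Nat.beq_eq]; exact hk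
    obtain ⟨d, rfl⟩ : ∃ d', d = d' + 1 := ⟨d - 1, by omega⟩
    have hEm : E % (2 * W) < 2 * W := Nat.mod_lt _ (by omega)
    have hEd := Nat.div_add_mod E (2 * W)
    have hEp : E / (2 * W) < (2 * W) ^ d := pop_lt hE
    have hEq : ∀ x < 2 * W, E - E % (2 * W) + x < (2 * W) ^ (d + 1) := by
      intro x hx
      have : E - E % (2 * W) = E / (2 * W) * (2 * W) := by
        have := mul_comm (E / (2 * W)) (2 * W)
        omega
      rw [this]; exact push_lt hEp hx
    by_cases h2 : mode = 2
    · subst h2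
      have h22 : Nat.beq 2 2 = true := rfl
      by_cases hev : E % 2 = 0
      · have hev' : Nat.beq (E % 2) 0 = true := by rw [Nat.beq_eq]; exact hev
        simp only [savStep, h0', hk', h22, hev', cond_true, cond_false]
        refine ⟨by simp, d + 1, hd, by simpa using push_lt hU (show E % (2 * W) / 2 < W by omega),
          by simpa using push_lt hV hVm, ?_⟩
        have hme : E % (2 * W) % 2 = 0 := by rw [Nat.mod_mul_right_mod]; exact hev
        have := hEq (E % (2 * W) + 1) (by omega)
        simp only
        have hle := Nat.mod_le E (2 * W)
        omega
      · have hev' : Nat.beq (E % 2) 0 = false := by rw [← Bool.not_eq_true, Nat.beq_eq]; exact hev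
        simp only [savStep, h0', hk', h22, hev', cond_true, cond_false]
        exact ⟨by simp, d, by simp only; omega, by simpa using pop_lt hU, by simpa using pop_lt hV, hEp⟩
    · have h2' : Nat.beq mode 2 = false := by rw [← Bool.not_eq_true, Nat.beq_eq]; exact h2
      by_cases hb : W ≤ E % (2 * W) / 2 + 1
      · have hb' : Nat.ble W (E % (2 * W) / 2 + 1) = true := by rw [Nat.ble_eq]; exact hb
        simp only [savStep, h0', hk', h2', hb', cond_true, cond_false]
        exact ⟨by simp, d, by simp only; omega, by simpa using pop_lt hU, by simpa using pop_lt hV, hEp⟩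
      · have hb' : Nat.ble W (E % (2 * W) / 2 + 1) = false := by
          rw [← Bool.not_eq_true, Nat.ble_eq]; exact hb
        simp only [savStep, h0', hk', h2', hb', cond_true, cond_false]
        refine ⟨by simp, d + 1, hd, by simpa using push_lt hU hUm,
          by simpa using push_lt hV (show E % (2 * W) / 2 + 1 < W by omega), ?_⟩
        exact hEq _ (by omega)

end SavStep

/-- Deterministic reachability in the graph with edges `e` on the vertices below `2 ^ w`. -/
def savitch (e : ℕ → ℕ → Bool) (w u v : ℕ) : Bool :=
  Nat.beq ((savStep e (2 ^ w) w)^[2 ^ ((w + 3) * w)] (0, w, u % 2 ^ w, v % 2 ^ w, 0)).1 2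

theorem savitch_eq_true {e : ℕ → ℕ → Bool} (he : ∀ u, e u u = true) {w u v : ℕ} (hu : u < 2 ^ w)
    (hv : v < 2 ^ w) : savitch e w u v = true ↔ ReflTransGen (EdgeBelow e (2 ^ w)) u v := by
  classical
  rw [← savR_iff he le_rfl hu hv, savitch, Nat.mod_eq_of_lt hu, Nat.mod_eq_of_lt hv]
  obtain ⟨T, hT, h⟩ := savStep_call (e := e) (W := 2 ^ w) (K := w) w le_rfl hu hv 0 0 0
  -- The number of rounds in `savitch` is the bound of `savStep_call` for `W = 2 ^ w`; surplus
  -- rounds change nothing.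
  rw [show (8 * 2 ^ w) ^ w = 2 ^ ((w + 3) * w) by
    rw [pow_mul, pow_add]; congr 1; ring] at hT
  obtain ⟨r, hr⟩ := Nat.exists_eq_add_of_le hT
  rw [hr, add_comm, iterate_add_apply]
  rw [zero_mul, zero_add, zero_add] at h
  rw [h]
  rw [iterate_fixed]
  · split_ifs with hR <;> simp [hR]
  · exact savStep_final (by split_ifs <;> simp) rfl

theorem PS.savitch_comp {α : Type} [Code α] {e : α → ℕ → ℕ → Bool} {w u v : α → ℕ}
    (he : PS fun p : α × ℕ × ℕ => e p.1 p.2.1 p.2.2) (hw : PS w) (hu : PS u) (hv : PS v)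
    (Q : Polynomial ℕ) (hQ : ∀ a, w a ≤ Q.eval (sz a)) :
    PS (fun a => savitch (e a) (w a) (u a) (v a)) := by
  have hW : PS (fun a => 2 ^ w a) := two_pow hw Q hQ
  have hT : PS (fun a => 2 ^ ((w a + 3) * w a)) := by
    refine two_pow (by fun_prop) ((Q + 3) * Q) fun a => ?_
    simp only [Polynomial.eval_mul, Polynomial.eval_add, Polynomial.eval_ofNat]
    exact Nat.mul_le_mul (Nat.add_le_add_right (hQ a) 3) (hQ a)
  have hB : PS (fun a => 2 ^ ((w a + 1) * (w a + 1))) := by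
    refine two_pow (by fun_prop) ((Q + 1) * (Q + 1)) fun a => ?_
    simp only [Polynomial.eval_mul, Polynomial.eval_add, Polynomial.eval_one]
    exact Nat.mul_le_mul (Nat.add_le_add_right (hQ a) 1) (Nat.add_le_add_right (hQ a) 1)
  have hit := PS.iterate (g := fun a s => savStep (e a) (2 ^ w a) (w a) s)
    (f := fun a => (0, w a, u a % 2 ^ w a, v a % 2 ^ w a, 0)) (n := fun a => 2 ^ ((w a + 3) * w a))
    (b := fun a => ((2, w a, 2 ^ ((w a + 1) * (w a + 1)), 2 ^ ((w a + 1) * (w a + 1)),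
      2 ^ ((w a + 1) * (w a + 1))) : SavState))
    (by
      have hW' : PS (fun p : α × SavState => 2 ^ w p.1) := hW.comp PS.fst
      have he' : PS (fun p : α × SavState =>
          e p.1 (p.2.2.2.1 % 2 ^ w p.1) (p.2.2.2.2.1 % 2 ^ w p.1)) :=
        he.comp (f := fun p : α × SavState =>
          (p.1, p.2.2.2.1 % 2 ^ w p.1, p.2.2.2.2.1 % 2 ^ w p.1)) (by fun_prop)
      simp only [savStep]
      fun_prop)
    (by fun_prop) hT (by fun_prop) (by
      intro a j _
      have hpos : 0 < 2 ^ w a := by positivity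
      have hinv : SavInv (2 ^ w a) (w a) ((savStep (e a) (2 ^ w a) (w a))^[j]
          (0, w a, u a % 2 ^ w a, v a % 2 ^ w a, 0)) := by
        induction j with
        | zero => exact ⟨by simp, 0, by simp, by simpa using Nat.mod_lt _ hpos,
            by simpa using Nat.mod_lt _ hpos, by simp⟩
        | succ j ih => rw [iterate_succ_apply']; exact (ih (by omega)).step hpos
      obtain ⟨h1, d, h2, h3, h4, h5⟩ := hinv
      set s := (savStep (e a) (2 ^ w a) (w a))^[j] (0, w a, u a % 2 ^ w a, v a % 2 ^ w a, 0)
      have hle : (2 ^ w a) ^ (d + if s.1 = 0 then 1 else 0) ≤ 2 ^ ((w a + 1) * (w a + 1)) := by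
        rw [← pow_mul]
        refine Nat.pow_le_pow_right (by norm_num) (Nat.mul_le_mul (by omega) ?_)
        split_ifs <;> omega
      have hle' : (2 * 2 ^ w a) ^ d ≤ 2 ^ ((w a + 1) * (w a + 1)) := by
        rw [← pow_succ', ← pow_mul]
        exact Nat.pow_le_pow_right (by norm_num) (Nat.mul_le_mul (by omega) (by omega))
      refine enc_pair_mono (a := s.1) (b := s.2) h1 (enc_pair_mono (a := s.2.1) (b := s.2.2)
        (by simp only [enc_nat]; omega) (enc_pair_mono (a := s.2.2.1) (b := s.2.2.2)
          (h3.le.trans hle) (enc_pair_mono (h4.le.trans hle) (h5.le.trans hle')))))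
  unfold savitch
  fun_prop

/-! ## Reading codes in polynomial space -/

section Reading

variable {α : Type} [Code α]

/-- The number of the first symbol, `0` for the empty string. -/
def hd (x : List CodeSym) : ℕ := codeString x % 8

theorem hd_nil : hd [] = 0 := rfl
theorem hd_bit (b : Bool) (x : List CodeSym) : hd (.bit b :: x) = 4 + b.toNat := by
  cases b <;> simp [hd, codeString]
theorem hd_endNum (x : List CodeSym) : hd (.endNum :: x) = 6 := by simp [hd, codeString]
theorem hd_endList (x : List CodeSym) : hd (.endList :: x) = 7 := by simp [hd, codeString]

theorem codeString_cons (c : CodeSym) (x : List CodeSym) :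
    codeString (c :: x) = hd (c :: x) + 8 * codeString x ∧ 4 ≤ hd (c :: x) := by
  cases c with
  | bit b => rw [hd_bit, codeString]; exact ⟨rfl, by omega⟩
  | endNum => rw [hd_endNum, codeString]; exact ⟨rfl, by omega⟩
  | endList => rw [hd_endList, codeString]; exact ⟨rfl, by omega⟩

theorem codeString_tail (x : List CodeSym) : codeString x.tail = codeString x / 8 := by
  cases x with
  | nil => rfl
  | cons c x =>
    have := codeString_cons c x
    have : hd (c :: x) < 8 := Nat.mod_lt _ (by norm_num)
    simp only [List.tail_cons]; omega

theorem codeString_tail_le (x : List CodeSym) : codeString x.tail ≤ codeString x := by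
  rw [codeString_tail]; exact Nat.div_le_self _ _

theorem codeString_suffix {x y : List CodeSym} (h : x <:+ y) : codeString x ≤ codeString y := by
  obtain ⟨z, rfl⟩ := h
  induction z with
  | nil => exact le_rfl
  | cons c z ih =>
    have := (codeString_cons c (z ++ x)).1
    rw [List.cons_append]; omega

theorem length_le_codeString (x : List CodeSym) : x.length ≤ codeString x := by
  induction x with
  | nil => exact le_rfl
  | cons c x ih =>
    have := codeString_cons c x
    rw [List.length_cons]; omega

namespace PS

theorem codeNumber : PS (fun x : List CodeSym => codeString x) := of_enc_eq fun _ => rfl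

@[fun_prop] theorem hd_comp {f : α → List CodeSym} (hf : PS f) : PS (fun a => hd (f a)) :=
  nat_mod (codeNumber.comp hf) (const 8)

-- On codes the tail is division by `8`, so the program for the quotient serves unchanged.
@[fun_prop] theorem list_tail {f : α → List CodeSym} (hf : PS f) : PS (fun a => (f a).tail) := by
  refine PS.comp (g := List.tail) ?_ hf
  obtain ⟨c, P, h⟩ := nat_div codeNumber (const 8)
  refine ⟨c, P, fun x => ?_⟩
  have e : enc x.tail = codeString x / 8 := codeString_tail x
  have := h x
  rw [sz, e]
  exact this

end PS

/-- Whether the first symbol is a bit. -/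
def isBit (x : List CodeSym) : Bool := Nat.ble 4 (hd x) && Nat.ble (hd x) 5

/-- Whether a list of items goes on, that is, whether the string is not empty and does not start
with the symbol that ends a list. -/
def goesOn (x : List CodeSym) : Bool := Nat.ble 1 (hd x) && Nat.ble (hd x) 6

@[fun_prop] theorem PS.isBit_comp {f : α → List CodeSym} (hf : PS f) :
    PS (fun a => isBit (f a)) := by unfold isBit; fun_prop

@[fun_prop] theorem PS.goesOn_comp {f : α → List CodeSym} (hf : PS f) :
    PS (fun a => goesOn (f a)) := by unfold goesOn; fun_prop

theorem isBit_nil : isBit [] = false := rfl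
theorem isBit_bit (b : Bool) (x : List CodeSym) : isBit (.bit b :: x) = true := by
  rw [isBit, hd_bit]; cases b <;> rfl
theorem isBit_endNum (x : List CodeSym) : isBit (.endNum :: x) = false := by
  rw [isBit, hd_endNum]; rfl
theorem isBit_endList (x : List CodeSym) : isBit (.endList :: x) = false := by
  rw [isBit, hd_endList]; rfl
theorem goesOn_nil : goesOn [] = false := rfl
theorem goesOn_bit (b : Bool) (x : List CodeSym) : goesOn (.bit b :: x) = true := by
  rw [goesOn, hd_bit]; cases b <;> rfl
theorem goesOn_endNum (x : List CodeSym) : goesOn (.endNum :: x) = true := by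
  rw [goesOn, hd_endNum]; rfl
theorem goesOn_endList (x : List CodeSym) : goesOn (.endList :: x) = false := by
  rw [goesOn, hd_endList]; rfl

/-- The value of the number written at the start of a string, lowest bit first. -/
def natVal : List CodeSym → ℕ
  | .bit b :: x => b.toNat + 2 * natVal x
  | _ => 0

/-- The string without the bits at its start. -/
def dropBits : List CodeSym → List CodeSym
  | .bit _ :: x => dropBits x
  | x => x

/-- The string after the number at its start. -/
def natRest (x : List CodeSym) : List CodeSym := (dropBits x).tail

/-- One step of reading a number. -/
def readStep (s : ℕ × ℕ × List CodeSym) : ℕ × ℕ × List CodeSym :=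
  cond (isBit s.2.2) (s.1 + s.2.1 * (hd s.2.2 - 4), 2 * s.2.1, s.2.2.tail) s

theorem readStep_iterate (x : List CodeSym) (j : ℕ) (hj : x.length ≤ j) (a p : ℕ) :
    (readStep^[j] (a, p, x)).1 = a + p * natVal x ∧ (readStep^[j] (a, p, x)).2.2 = dropBits x := by
  induction x generalizing j a p with
  | nil =>
    rw [iterate_fixed (by simp [readStep, isBit_nil])]
    simp [natVal, dropBits]
  | cons c x ih =>
    cases c with
    | bit b =>
      obtain ⟨j, rfl⟩ : ∃ i, j = i + 1 := ⟨j - 1, by simp at hj; omega⟩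
      rw [iterate_succ_apply]
      have : readStep (a, p, .bit b :: x) = (a + p * b.toNat, 2 * p, x) := by
        simp [readStep, isBit_bit, hd_bit]
      rw [this]
      obtain ⟨h1, h2⟩ := ih j (by simpa using hj) (a + p * b.toNat) (2 * p)
      refine ⟨?_, h2⟩
      rw [h1, natVal]; ring
    | endNum =>
      rw [iterate_fixed (by simp [readStep, isBit_endNum])]
      simp [natVal, dropBits]
    | endList =>
      rw [iterate_fixed (by simp [readStep, isBit_endList])]
      simp [natVal, dropBits]

theorem isBit_iff {x : List CodeSym} (h : isBit x = true) : ∃ b y, x = .bit b :: y := by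
  match x, h with
  | .bit b :: y, _ => exact ⟨b, y, rfl⟩
  | [], h => simp [isBit_nil] at h
  | .endNum :: y, h => simp [isBit_endNum] at h
  | .endList :: y, h => simp [isBit_endList] at h

theorem PS.readNumber : PS (fun x : List CodeSym => (natVal x, dropBits x)) := by
  have h := PS.iterate (g := fun (_ : List CodeSym) s => readStep s)
    (f := fun x => ((0, 1, x) : ℕ × ℕ × List CodeSym)) (n := fun x => codeString x)
    (b := fun x => ((codeString x + 1, codeString x + 1, x) : ℕ × ℕ × List CodeSym))
    (by unfold readStep; fun_prop) (by fun_prop) PS.codeNumber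
    (by have := PS.codeNumber; fun_prop) (by
      intro x j _
      -- The place value doubles while the code of the remaining string shrinks by at least as much;
      -- the product bounds the place value by the input, and the value read is below the place
      -- value.
      have inv : ∀ j, (readStep^[j] (0, 1, x)).1 < (readStep^[j] (0, 1, x)).2.1 ∧
          (readStep^[j] (0, 1, x)).2.1 * (codeString (readStep^[j] (0, 1, x)).2.2 + 1) ≤
            codeString x + 1 ∧
          codeString (readStep^[j] (0, 1, x)).2.2 ≤ codeString x := by
        intro j
        induction j with
        | zero => simp
        | succ j ih =>
          rw [iterate_succ_apply']
          generalize readStep^[j] (0, 1, x) = s at ih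
          obtain ⟨a, p, y⟩ := s
          obtain ⟨h1, h2, h3⟩ := ih
          simp only at h1 h2 h3
          unfold readStep
          by_cases hb : isBit y = true
          · obtain ⟨b, z, rfl⟩ := isBit_iff hb
            have hc := codeString_cons (.bit b) z
            simp only [hb, cond_true, hd_bit, List.tail_cons] at hc ⊢
            refine ⟨?_, ?_, by omega⟩
            · cases b <;> simp <;> omega
            · refine le_trans ?_ h2
              rw [hc.1]; nlinarith
          · simp only [eq_false_of_ne_true hb, cond_false]
            exact ⟨h1, h2, h3⟩
      obtain ⟨h1, h2, h3⟩ := inv j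
      set s := readStep^[j] (0, 1, x)
      have h4 : s.2.1 ≤ codeString x + 1 := by nlinarith
      exact enc_pair_mono (a := s.1) (b := s.2) (by simp only [enc_nat]; omega)
        (enc_pair_mono (a := s.2.1) (b := s.2.2) h4 h3))
  refine PS.of_eq (f := fun x => ((readStep^[codeString x] (0, 1, x)).1,
    (readStep^[codeString x] (0, 1, x)).2.2)) (by fun_prop) fun x => ?_
  obtain ⟨h1, h2⟩ := readStep_iterate x (codeString x) (length_le_codeString x) 0 1
  rw [h1, h2]; simp

@[fun_prop] theorem PS.natVal_comp {f : α → List CodeSym} (hf : PS f) :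
    PS (fun a => natVal (f a)) := PS.fst.comp (PS.readNumber.comp hf)

@[fun_prop] theorem PS.natRest_comp {f : α → List CodeSym} (hf : PS f) :
    PS (fun a => natRest (f a)) := PS.list_tail (PS.snd.comp (PS.readNumber.comp hf))

theorem dropBits_suffix (x : List CodeSym) : dropBits x <:+ x := by
  induction x with
  | nil => exact List.suffix_rfl
  | cons c x ih =>
    cases c with
    | bit b => exact ih.trans (List.suffix_cons _ _)
    | endNum => exact List.suffix_rfl
    | endList => exact List.suffix_rfl

theorem natRest_suffix (x : List CodeSym) : natRest x <:+ x :=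
  (List.tail_suffix _).trans (dropBits_suffix x)

/-- `encodeNat` writes the lowest bit first and emits only bits, so reading stops exactly at
`endNum`. -/
theorem encodeNat_cases (n : ℕ) : ∀ y, natVal ((Computability.encodeNat n).map .bit ++
    CodeSym.endNum :: y) = n ∧
    dropBits ((Computability.encodeNat n).map .bit ++ CodeSym.endNum :: y) = .endNum :: y := by
  intro y
  have hpos : ∀ p : PosNum, natVal ((Computability.encodePosNum p).map .bit ++
      CodeSym.endNum :: y) = p ∧
      dropBits ((Computability.encodePosNum p).map .bit ++ CodeSym.endNum :: y) = .endNum :: y := by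
    intro p
    induction p with
    | one => simp [Computability.encodePosNum, natVal, dropBits]
    | bit0 p ih =>
      simp only [Computability.encodePosNum, List.map_cons, List.cons_append, natVal, dropBits,
        ih, PosNum.cast_bit0, and_true, Bool.toNat_false]
      ring
    | bit1 p ih =>
      simp only [Computability.encodePosNum, List.map_cons, List.cons_append, natVal, dropBits,
        ih, PosNum.cast_bit1, and_true, Bool.toNat_true]
      ring
  unfold Computability.encodeNat
  have hn : ((n : Num) : ℕ) = n := Num.to_of_nat n
  rcases h : (n : Num) with _ | p
  · rw [h] at hn
    have : n = 0 := by rw [← hn]; rfl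
    subst this
    simp [Computability.encodeNum, natVal, dropBits]
  · rw [h] at hn
    have := hpos p
    rw [show ((p : ℕ)) = n from hn] at this
    exact this

theorem natVal_codeNat (n : ℕ) (y : List CodeSym) : natVal (codeNat n ++ y) = n := by
  have := (encodeNat_cases n y).1
  rwa [codeNat, List.append_assoc]

theorem natRest_codeNat (n : ℕ) (y : List CodeSym) : natRest (codeNat n ++ y) = y := by
  have := (encodeNat_cases n y).2
  rw [codeNat, List.append_assoc, natRest]
  simp only [List.cons_append, List.nil_append]
  rw [this]; rfl

theorem goesOn_codeNat (n : ℕ) (y : List CodeSym) : goesOn (codeNat n ++ y) = true := by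
  rw [codeNat]
  cases Computability.encodeNat n with
  | nil => exact goesOn_endNum _
  | cons b l => exact goesOn_bit _ _

/-- The string after the first symbol that ends a list. -/
def dropList : List CodeSym → List CodeSym
  | [] => []
  | .endList :: x => x
  | .bit _ :: x => dropList x
  | .endNum :: x => dropList x

theorem dropList_append {x : List CodeSym} (hx : CodeSym.endList ∉ x) (y : List CodeSym) :
    dropList (x ++ .endList :: y) = y := by
  induction x with
  | nil => rfl
  | cons c x ih =>
    simp only [List.mem_cons, not_or] at hx
    cases c with
    | endList => exact absurd rfl hx.1
    | bit b => exact ih hx.2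
    | endNum => exact ih hx.2

-- The iteration halts in front of the closing symbol, so surplus rounds are harmless; a last tail
-- removes that symbol.
@[fun_prop] theorem PS.dropList_comp {f : α → List CodeSym} (hf : PS f) :
    PS (fun a => dropList (f a)) := by
  refine PS.comp (g := dropList) ?_ hf
  set g : List CodeSym → List CodeSym := fun x => cond (goesOn x) x.tail x
  have key : ∀ (x : List CodeSym) (j : ℕ), x.length ≤ j →
      (g^[j] x).tail = dropList x := by
    intro x
    induction x with
    | nil => intro j _; rw [iterate_fixed (by simp [g, goesOn_nil])]; rfl
    | cons c x ih =>
      intro j hj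
      have hj' : c = .endList ∨ g^[j] (c :: x) = g^[j - 1] x ∧ c ≠ .endList := by
        obtain ⟨j, rfl⟩ : ∃ i, j = i + 1 := ⟨j - 1, by simp at hj; omega⟩
        rw [iterate_succ_apply]
        cases c with
        | endList => exact .inl rfl
        | bit b => right; simp [g, goesOn_bit]
        | endNum => right; simp [g, goesOn_endNum]
      have hl : x.length ≤ j - 1 := by simp at hj; omega
      rcases hj' with rfl | ⟨h, hne⟩
      · rw [iterate_fixed (by simp [g, goesOn_endList])]; rfl
      · rw [h, ih _ hl]
        cases c with
        | endList => exact absurd rfl hne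
        | bit b => rfl
        | endNum => rfl
  refine (PS.list_tail (PS.iterate (g := fun (_ : List CodeSym) x => g x)
    (f := fun x => x) (n := fun x => codeString x) (b := fun x => x) (by fun_prop) (by fun_prop)
    PS.codeNumber (by fun_prop) ?_)).of_eq fun x => key x _ (length_le_codeString x)
  intro x j _
  induction j with
  | zero => exact le_rfl
  | succ j ih =>
    rw [iterate_succ_apply']
    refine le_trans ?_ (ih (by omega))
    generalize g^[j] x = y
    simp only [g]
    cases goesOn y
    · exact le_rfl
    · exact codeString_tail_le y

/-- The length of a string. -/
theorem PS.string_length : PS (fun x : List CodeSym => x.length) := by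
  set g : List CodeSym × ℕ → List CodeSym × ℕ := fun s => cond (Nat.beq (hd s.1) 0) s
    (s.1.tail, s.2 + 1)
  have key : ∀ (x : List CodeSym) (j c : ℕ),
      (g^[j] (x, c)).2 ≤ c + x.length ∧ codeString (g^[j] (x, c)).1 ≤ codeString x ∧
      (x.length ≤ j → (g^[j] (x, c)).2 = c + x.length) := by
    intro x
    induction x with
    | nil =>
      intro j c
      rw [iterate_fixed (by simp [g, hd_nil])]
      exact ⟨by simp, le_rfl, by simp⟩
    | cons a x ih =>
      intro j c
      cases j with
      | zero => exact ⟨by simp, le_rfl, by simp⟩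
      | succ j =>
        have h4 := codeString_cons a x
        have h0 : Nat.beq (hd (a :: x)) 0 = false := by
          rw [← Bool.not_eq_true, Nat.beq_eq]; omega
        have : g (a :: x, c) = (x, c + 1) := by simp [g, h0]
        rw [iterate_succ_apply, this]
        obtain ⟨h1, h2, h3⟩ := ih j (c + 1)
        simp only [List.length_cons]
        exact ⟨by omega, by omega, fun h => by rw [h3 (by omega)]; omega⟩
  refine (PS.snd.comp (PS.iterate (g := fun (_ : List CodeSym) s => g s)
    (f := fun x => (x, 0)) (n := fun x => codeString x) (b := fun x => (x, codeString x))
    (by fun_prop) (by fun_prop) PS.codeNumber (by have := PS.codeNumber; fun_prop) ?_)).of_eq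
    fun x => by rw [(key x _ 0).2.2 (length_le_codeString x), zero_add]
  intro x j _
  obtain ⟨h1, h2, _⟩ := key x j 0
  have := length_le_codeString x
  exact enc_pair_mono (a := (g^[j] (x, 0)).1) (b := (g^[j] (x, 0)).2) h2
    (by simp only [enc_nat]; omega)

/-- One step of the search for an item with a property in a list of items. -/
def anyStep (item : List CodeSym → Bool) (next : List CodeSym → List CodeSym)
    (s : List CodeSym × Bool) : List CodeSym × Bool :=
  cond (goesOn s.1) (next s.1, s.2 || item s.1) s

/-- Whether some item in the list at the start of a string has a property. -/
def anyItem (item : List CodeSym → Bool) (next : List CodeSym → List CodeSym)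
    (x : List CodeSym) : Bool :=
  ((anyStep item next)^[codeString x] (x, false)).2

/-- By `hnext` the string being scanned only shrinks, so all iterates stay below the input. -/
theorem PS.anyItem_comp {item : α → List CodeSym → Bool} {next : List CodeSym → List CodeSym}
    {f : α → List CodeSym} (hi : PS fun p : α × List CodeSym => item p.1 p.2) (hn : PS next)
    (hnext : ∀ x, next x <:+ x) (hf : PS f) :
    PS (fun a => anyItem (item a) next (f a)) := by
  refine PS.snd.comp (PS.iterate (g := fun a s => anyStep (item a) next s)
    (f := fun a => (f a, false)) (n := fun a => codeString (f a)) (b := fun a => (f a, 1)) ?_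
    (by fun_prop) (PS.codeNumber.comp hf) (by fun_prop) ?_)
  · have : PS (fun p : α × (List CodeSym × Bool) => item p.1 p.2.1) :=
      hi.comp (f := fun p : α × (List CodeSym × Bool) => (p.1, p.2.1)) (by fun_prop)
    unfold anyStep
    fun_prop
  · intro a j _
    have : codeString ((anyStep (item a) next)^[j] (f a, false)).1 ≤ codeString (f a) := by
      induction j with
      | zero => exact le_rfl
      | succ j ih =>
        rw [iterate_succ_apply']
        refine le_trans ?_ (ih (by omega))
        generalize (anyStep (item a) next)^[j] (f a, false) = y
        unfold anyStep
        cases goesOn y.1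
        · exact le_rfl
        · exact codeString_suffix (hnext _)
    exact enc_pair_mono (a := ((anyStep (item a) next)^[j] (f a, false)).1)
      (b := ((anyStep (item a) next)^[j] (f a, false)).2) (d := (1 : ℕ)) this (enc_bool_le _)

theorem anyItem_flatMap {ι : Type*} {item : List CodeSym → Bool}
    {next : List CodeSym → List CodeSym} {c : ι → List CodeSym} {P : ι → Bool}
    (hg : ∀ i y, goesOn (c i ++ y) = true) (hn : ∀ i y, next (c i ++ y) = y)
    (hi : ∀ i y, item (c i ++ y) = P i) (l : List ι) (y : List CodeSym) :
    anyItem item next (l.flatMap c ++ .endList :: y) = l.any P := by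
  have key : ∀ (l : List ι) (j : ℕ) (b : Bool), l.length ≤ j →
      ((anyStep item next)^[j] (l.flatMap c ++ .endList :: y, b)).2 = (b || l.any P) := by
    intro l
    induction l with
    | nil =>
      intro j b _
      rw [iterate_fixed (by simp [anyStep, goesOn_endList])]
      simp
    | cons i l ih =>
      intro j b hj
      obtain ⟨j, rfl⟩ : ∃ k, j = k + 1 := ⟨j - 1, by simp at hj; omega⟩
      rw [iterate_succ_apply]
      have : anyStep item next ((i :: l).flatMap c ++ .endList :: y, b) =
          (l.flatMap c ++ .endList :: y, b || P i) := by
        simp only [anyStep, List.flatMap_cons, List.append_assoc, hg, hn, hi, cond_true]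
      rw [this, ih j _ (by simpa using hj)]
      simp [Bool.or_assoc]
  rw [anyItem, key l _ _ ?_, Bool.false_or]
  refine le_trans ?_ (length_le_codeString _)
  -- An empty code would contradict `hg`; hence there are at most as many items as symbols, and the
  -- number of rounds is sufficient.
  have hpos : ∀ i, 1 ≤ (c i).length := by
    intro i
    rcases h : c i with _ | ⟨a, z⟩
    · have := hg i []
      rw [h] at this; simp [goesOn_nil] at this
    · simp
  rw [List.length_append]
  refine le_trans ?_ (Nat.le_add_right _ _)
  induction l with
  | nil => simp
  | cons i l ih => have := hpos i; simp only [List.flatMap_cons, List.length_append, List.length_cons]; omega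

/-- Whether the rational number at the start of a string is negative. -/
def ratNeg (x : List CodeSym) : Bool := Nat.beq (hd x) 5

/-- The numerator of the positive part of the rational number at the start of a string. -/
def ratPos (x : List CodeSym) : ℕ := cond (ratNeg x) 0 (natVal x.tail)

/-- The numerator of the negative part of the rational number at the start of a string. -/
def ratNegPart (x : List CodeSym) : ℕ := cond (ratNeg x) (natVal x.tail) 0

/-- The denominator of the rational number at the start of a string. -/
def ratDen (x : List CodeSym) : ℕ := natVal (natRest x.tail)

/-- The string after the rational number at its start. -/
def ratRest (x : List CodeSym) : List CodeSym := natRest (natRest x.tail)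

@[fun_prop] theorem PS.ratPos_comp {f : α → List CodeSym} (hf : PS f) :
    PS (fun a => ratPos (f a)) := by unfold ratPos ratNeg; fun_prop

@[fun_prop] theorem PS.ratNegPart_comp {f : α → List CodeSym} (hf : PS f) :
    PS (fun a => ratNegPart (f a)) := by unfold ratNegPart ratNeg; fun_prop

@[fun_prop] theorem PS.ratDen_comp {f : α → List CodeSym} (hf : PS f) :
    PS (fun a => ratDen (f a)) := by unfold ratDen; fun_prop

@[fun_prop] theorem PS.ratRest_comp {f : α → List CodeSym} (hf : PS f) :
    PS (fun a => ratRest (f a)) := by unfold ratRest; fun_prop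

theorem ratRest_suffix (x : List CodeSym) : ratRest x <:+ x :=
  (natRest_suffix _).trans ((natRest_suffix _).trans (List.tail_suffix _))

theorem ratPos_codeRat (r : ℚ) (y : List CodeSym) :
    ratPos (codeRat r ++ y) = if r < 0 then 0 else r.num.natAbs := by
  simp only [ratPos, ratNeg, codeRat, List.cons_append, hd_bit, List.tail_cons, List.append_assoc,
    natVal_codeNat]
  have h45 : Nat.beq 4 5 = false := rfl
  by_cases h : r < 0 <;> simp [h, h45]

theorem ratNegPart_codeRat (r : ℚ) (y : List CodeSym) :
    ratNegPart (codeRat r ++ y) = if r < 0 then r.num.natAbs else 0 := by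
  simp only [ratNegPart, ratNeg, codeRat, List.cons_append, hd_bit, List.tail_cons,
    List.append_assoc, natVal_codeNat]
  have h45 : Nat.beq 4 5 = false := rfl
  by_cases h : r < 0 <;> simp [h, h45]

theorem ratDen_codeRat (r : ℚ) (y : List CodeSym) : ratDen (codeRat r ++ y) = r.den := by
  simp only [ratDen, codeRat, List.cons_append, List.tail_cons, List.append_assoc,
    natRest_codeNat, natVal_codeNat]

theorem ratRest_codeRat (r : ℚ) (y : List CodeSym) : ratRest (codeRat r ++ y) = y := by
  simp only [ratRest, codeRat, List.cons_append, List.tail_cons, List.append_assoc,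
    natRest_codeNat]

end Reading

/-! ## The decision procedure -/

section Nodes

variable {α : Type} [Code α]

/-- The number of the vertex with state `s` and gap `(a - b) / d`. -/
def nodeCode (s a b d : ℕ) : ℕ := cpair s (cpair a (cpair b d))

/-- The state of a vertex. -/
def nState (n : ℕ) : ℕ := (cunpair n).1

/-- The numerator of the positive part of the gap of a vertex. -/
def nPos (n : ℕ) : ℕ := (cunpair (cunpair n).2).1

/-- The numerator of the negative part of the gap of a vertex. -/
def nNeg (n : ℕ) : ℕ := (cunpair (cunpair (cunpair n).2).2).1

/-- The denominator of the gap of a vertex. -/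
def nDen (n : ℕ) : ℕ := (cunpair (cunpair (cunpair n).2).2).2

@[fun_prop] theorem PS.cunpair_comp {f : α → ℕ} (hf : PS f) : PS (fun a => cunpair (f a)) :=
  PS.comp (PS.of_enc_eq fun n => cpair_cunpair n) hf

@[fun_prop] theorem PS.cpair_comp {f g : α → ℕ} (hf : PS f) (hg : PS g) :
    PS (fun a => cpair (f a) (g a)) :=
  PS.comp (g := fun p : ℕ × ℕ => cpair p.1 p.2) (PS.of_enc_eq fun _ => rfl) (PS.prodMk hf hg)

@[fun_prop] theorem PS.nState_comp {f : α → ℕ} (hf : PS f) : PS (fun a => nState (f a)) := by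
  unfold nState; fun_prop

@[fun_prop] theorem PS.nPos_comp {f : α → ℕ} (hf : PS f) : PS (fun a => nPos (f a)) := by
  unfold nPos; fun_prop

@[fun_prop] theorem PS.nNeg_comp {f : α → ℕ} (hf : PS f) : PS (fun a => nNeg (f a)) := by
  unfold nNeg; fun_prop

@[fun_prop] theorem PS.nDen_comp {f : α → ℕ} (hf : PS f) : PS (fun a => nDen (f a)) := by
  unfold nDen; fun_prop

section
variable (s a b d : ℕ)
@[simp] theorem nState_nodeCode : nState (nodeCode s a b d) = s := by
  simp [nState, nodeCode, cunpair_cpair]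
@[simp] theorem nPos_nodeCode : nPos (nodeCode s a b d) = a := by
  simp [nPos, nodeCode, cunpair_cpair]
@[simp] theorem nNeg_nodeCode : nNeg (nodeCode s a b d) = b := by
  simp [nNeg, nodeCode, cunpair_cpair]
@[simp] theorem nDen_nodeCode : nDen (nodeCode s a b d) = d := by
  simp [nDen, nodeCode, cunpair_cpair]
end

/-- Three nested pairings give the lengths `4 L + 2`, `10 L + 6` and `22 L + 14`. -/
theorem nodeCode_lt {s a b d L : ℕ} (hs : s < 2 ^ L) (ha : a < 2 ^ L) (hb : b < 2 ^ L)
    (hd : d < 2 ^ L) : nodeCode s a b d < 2 ^ (22 * L + 14) := by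
  rw [← Nat.size_le] at *
  have h1 := size_cpair_le b d
  have h2 := size_cpair_le a (cpair b d)
  have h3 := size_cpair_le s (cpair a (cpair b d))
  unfold nodeCode
  omega

/-- The gap of a vertex. -/
def nGap (n : ℕ) : ℚ := ((nPos n : ℚ) - nNeg n) / nDen n

end Nodes

/-- The initial state in the code of an instance. -/
def cInit (x : List CodeSym) : ℕ := natVal (natRest (natRest x))

/-- The code of an instance from the accepting states on. -/
def cAccept (x : List CodeSym) : List CodeSym := natRest (natRest (natRest x))

/-- The code of an instance from the transitions on. -/
def cTrans (x : List CodeSym) : List CodeSym := dropList (cAccept x)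

/-- The code of an instance from the discount factor on. -/
def cLam (x : List CodeSym) : List CodeSym := dropList (cTrans x)

/-- The code of the target of an instance. -/
def cTarget (x : List CodeSym) : List CodeSym := ratRest (cLam x)

/-- The weight in the code of a transition. -/
def tWeight (y : List CodeSym) : List CodeSym := natRest (natRest (natRest y))

/-- The string after a transition. -/
def tRest (y : List CodeSym) : List CodeSym := ratRest (tWeight y)

/-- Whether the gap equation `p / q * v + g = u` holds, where the rationals `u`, `v` and `g` are
written as differences of fractions. -/
def gapEq (p q gp gn ge a b d a' b' d' : ℕ) : Bool :=
  -- Multiply by `q * d' * ge * d` and move negative terms to the other side, so that only natural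
  -- numbers occur.
  Nat.beq (p * a' * ge * d + gp * q * d' * d + b * q * d' * ge)
    (a * q * d' * ge + gn * q * d' * d + p * b' * ge * d)

/-- Whether the transition `y` of the instance `x` leads from the vertex `u` to the vertex `v`. -/
def tLeads (x : List CodeSym) (u v : ℕ) (y : List CodeSym) : Bool :=
  Nat.beq (natVal y) (nState u) && Nat.beq (natVal (natRest (natRest y))) (nState v) &&
    gapEq (ratPos (cLam x)) (ratDen (cLam x)) (ratPos (tWeight y)) (ratNegPart (tWeight y))
      (ratDen (tWeight y)) (nPos u) (nNeg u) (nDen u) (nPos v) (nNeg v) (nDen v)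

/-- The edges of the graph of an instance. -/
def gEdge (x : List CodeSym) (u v : ℕ) : Bool :=
  -- Self-loops are what Savitch's recursion needs; vertices with denominator `0` get no other
  -- edges.
  Nat.beq u v || (Nat.ble 1 (nDen u) && Nat.ble 1 (nDen v) &&
    anyItem (tLeads x u v) tRest (cTrans x))

/-- Whether a vertex has an accepting state and gap zero. -/
def gAccept (x : List CodeSym) (v : ℕ) : Bool :=
  Nat.ble 1 (nDen v) && Nat.beq (nPos v) (nNeg v) &&
    anyItem (fun y => Nat.beq (natVal y) (nState v)) natRest (cAccept x)

/-- The vertex with the initial state and the target as its gap. -/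
def gStart (x : List CodeSym) : ℕ :=
  nodeCode (cInit x) (ratPos (cTarget x)) (ratNegPart (cTarget x)) (ratDen (cTarget x))

/-- The logarithm of the number of vertices. -/
def gWidth (x : List CodeSym) : ℕ := 100 * (x.length + 1)

/-- The decision procedure for the exact-value problem. -/
def solve (x : List CodeSym) : Bool :=
  bex (2 ^ gWidth x) fun v => gAccept x v && savitch (gEdge x) (gWidth x) (gStart x) v

/-- The final vertex is guessed by exhaustive search over an exponential range; every test along the
way needs only numbers of polynomial length. -/
theorem PS.solve : PS solve := by
  have hlen : PS gWidth := by
    have := PS.string_length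
    unfold gWidth; fun_prop
  have hQ : ∀ x, gWidth x ≤ (100 * (Polynomial.X + 1) : Polynomial ℕ).eval (sz x) := by
    intro x
    have : sz x = 3 * x.length := size_codeString x
    simp only [Polynomial.eval_mul, Polynomial.eval_add, Polynomial.eval_ofNat, Polynomial.eval_X,
      Polynomial.eval_one, gWidth]
    omega
  have hacc : PS fun p : List CodeSym × ℕ => gAccept p.1 p.2 := by
    have := PS.anyItem_comp
      (item := fun (p : List CodeSym × ℕ) y => Nat.beq (natVal y) (nState p.2))
      (next := natRest) (f := fun p => cAccept p.1) (by fun_prop) (by fun_prop) natRest_suffix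
      (by unfold cAccept; fun_prop)
    unfold gAccept
    fun_prop
  have hedge : PS fun p : List CodeSym × ℕ × ℕ => gEdge p.1 p.2.1 p.2.2 := by
    have := PS.anyItem_comp
      (item := fun (p : List CodeSym × ℕ × ℕ) y => tLeads p.1 p.2.1 p.2.2 y)
      (next := tRest) (f := fun p => cTrans p.1)
      (by unfold tLeads gapEq cLam cTrans cAccept tWeight; fun_prop)
      (by unfold tRest tWeight; fun_prop)
      (fun x => (ratRest_suffix _).trans ((natRest_suffix _).trans ((natRest_suffix _).trans
        (natRest_suffix _)))) (by unfold cTrans cAccept; fun_prop)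
    unfold gEdge
    fun_prop
  have hsav : PS fun p : List CodeSym × ℕ =>
      savitch (gEdge p.1) (gWidth p.1) (gStart p.1) p.2 := by
    refine PS.savitch_comp (e := fun p : List CodeSym × ℕ => gEdge p.1)
      (hedge.comp (f := fun p : (List CodeSym × ℕ) × ℕ × ℕ => (p.1.1, p.2.1, p.2.2)) (by fun_prop))
      (hlen.comp PS.fst) (by unfold gStart nodeCode cInit cTarget cLam cTrans cAccept; fun_prop)
      PS.snd (100 * (Polynomial.X + 1)) fun p => (hQ p.1).trans (poly_mono _ (sz_fst_le p.1 p.2))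
  exact PS.bounded_exists (PS.two_pow hlen _ hQ)
    (p := fun x v => gAccept x v && savitch (gEdge x) (gWidth x) (gStart x) v)
    (PS.bool_and hacc hsav)

/-! ## The graph of an instance -/

theorem endList_notMem_codeNat (n : ℕ) : CodeSym.endList ∉ codeNat n := by
  simp [codeNat]

theorem endList_notMem_codeRat (r : ℚ) : CodeSym.endList ∉ codeRat r := by
  simp [codeRat, endList_notMem_codeNat]

theorem flatMap_dite {ι : Type*} {p : ι → Prop} [DecidablePred p] {β : Type*}
    (f : {i // p i} → List β) (l : List ι) :
    (l.flatMap fun i => if h : p i then f ⟨i, h⟩ else []) =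
      (l.filterMap fun i => if h : p i then some ⟨i, h⟩ else none).flatMap f := by
  induction l with
  | nil => rfl
  | cons i l ih =>
    rw [List.flatMap_cons, ih]
    by_cases h : p i <;> simp [h]

section Instance

variable (I : ExactValueInstance)

/-- The list of the accepting states in the code of an instance. -/
def acceptList : List (Fin I.states) :=
  (List.finRange I.states).filter fun q => q ∈ I.aut.accept

/-- The list of the transitions in the code of an instance. -/
def transList : List {e : Fin I.states × Fin I.letters × Fin I.states // e ∈ I.aut.δ} :=
  (List.finRange I.states ×ˢ (List.finRange I.letters ×ˢ List.finRange I.states)).filterMap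
    fun e => if h : e ∈ I.aut.δ then some ⟨e, h⟩ else none

theorem mem_acceptList (q : Fin I.states) : q ∈ acceptList I ↔ q ∈ I.aut.accept := by
  simp [acceptList]

theorem mem_transList (e : {e : Fin I.states × Fin I.letters × Fin I.states // e ∈ I.aut.δ}) :
    e ∈ transList I := by
  rw [transList, List.mem_filterMap]
  refine ⟨e.1, ?_, by simp [e.2]⟩
  exact List.mem_product.2 ⟨List.mem_finRange _, List.mem_product.2
    ⟨List.mem_finRange _, List.mem_finRange _⟩⟩

theorem codeInstance_eq : codeInstance I =
    codeNat I.letters ++ (codeNat I.states ++ (codeNat I.aut.init.val ++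
      ((acceptList I).flatMap (fun q => codeNat q.val) ++ .endList ::
        ((transList I).flatMap (codeTransition I.aut) ++ .endList ::
          (codeRat I.aut.lam ++ (codeRat I.target ++ [])))))) := by
  rw [transList, ← flatMap_dite]
  simp only [codeInstance, acceptList, List.append_assoc, List.cons_append, List.nil_append,
    List.append_nil]

theorem cInit_codeInstance : cInit (codeInstance I) = I.aut.init.val := by
  rw [codeInstance_eq, cInit, natRest_codeNat, natRest_codeNat, natVal_codeNat]

theorem cAccept_codeInstance : cAccept (codeInstance I) =
    (acceptList I).flatMap (fun q => codeNat q.val) ++ .endList ::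
        ((transList I).flatMap (codeTransition I.aut) ++ .endList ::
          (codeRat I.aut.lam ++ (codeRat I.target ++ []))) := by
  rw [codeInstance_eq, cAccept, natRest_codeNat, natRest_codeNat, natRest_codeNat]

theorem cTrans_codeInstance : cTrans (codeInstance I) =
    (transList I).flatMap (codeTransition I.aut) ++ .endList ::
          (codeRat I.aut.lam ++ (codeRat I.target ++ [])) := by
  rw [cTrans, cAccept_codeInstance, dropList_append]
  simp [endList_notMem_codeNat]

theorem cLam_codeInstance : cLam (codeInstance I) =
    codeRat I.aut.lam ++ (codeRat I.target ++ []) := by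
  rw [cLam, cTrans_codeInstance, dropList_append]
  simp [codeTransition, endList_notMem_codeNat, endList_notMem_codeRat]

theorem cTarget_codeInstance : cTarget (codeInstance I) = codeRat I.target ++ [] := by
  rw [cTarget, cLam_codeInstance, ratRest_codeRat]

theorem gAccept_codeInstance (v : ℕ) : gAccept (codeInstance I) v = true ↔
    0 < nDen v ∧ nPos v = nNeg v ∧ ∃ q ∈ I.aut.accept, nState v = q.val := by
  rw [gAccept, cAccept_codeInstance, anyItem_flatMap (P := fun q => Nat.beq q.val (nState v))
    (fun q y => goesOn_codeNat _ _) (fun q y => natRest_codeNat _ _)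
    (fun q y => by rw [natVal_codeNat])]
  simp only [Bool.and_eq_true, Nat.ble_eq, Nat.beq_eq, List.any_eq_true, mem_acceptList, and_assoc]
  refine and_congr_right fun _ => and_congr_right fun _ => exists_congr fun q =>
    and_congr_right fun _ => eq_comm

/-- The numerators of the positive and the negative part of a rational number. -/
theorem rat_parts (r : ℚ) : (((if r < 0 then 0 else r.num.natAbs : ℕ) : ℚ) -
    (if r < 0 then r.num.natAbs else 0 : ℕ)) / r.den = r := by
  have h : (r.num : ℚ) / r.den = r := Rat.num_div_den r
  by_cases h0 : r < 0
  · have : (r.num.natAbs : ℚ) = -r.num := by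
      have h1 : r.num < 0 := Rat.num_neg.2 h0
      rw [Nat.cast_natAbs, abs_of_neg h1]; push_cast; rfl
    simpa only [h0, if_true, this, Nat.cast_zero, zero_sub, neg_neg] using h
  · have : (r.num.natAbs : ℚ) = r.num := by
      have h1 : 0 ≤ r.num := Rat.num_nonneg.2 (not_lt.1 h0)
      rw [Nat.cast_natAbs, abs_of_nonneg h1]
    simpa only [h0, if_false, this, Nat.cast_zero, sub_zero] using h

theorem gapEq_iff {p q gp gn ge a b d a' b' d' : ℕ} (hq : 0 < q) (hge : 0 < ge) (hd : 0 < d)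
    (hd' : 0 < d') : gapEq p q gp gn ge a b d a' b' d' = true ↔
      (p : ℚ) / q * (((a' : ℚ) - b') / d') + ((gp : ℚ) - gn) / ge = ((a : ℚ) - b) / d := by
  rw [gapEq, Nat.beq_eq, ← Nat.cast_inj (R := ℚ)]
  have h1 : (q : ℚ) ≠ 0 := by positivity
  have h2 : (ge : ℚ) ≠ 0 := by positivity
  have h3 : (d : ℚ) ≠ 0 := by positivity
  have h4 : (d' : ℚ) ≠ 0 := by positivity
  push_cast
  field_simp
  constructor <;> intro h <;> linarith

/-- Edges other than self-loops depend only on the state and the gap, so vertices whose fractions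
are not in lowest terms do no harm. -/
theorem gEdge_codeInstance (u v : ℕ) : gEdge (codeInstance I) u v = true ↔
    u = v ∨ (0 < nDen u ∧ 0 < nDen v ∧
      ∃ e : {e : Fin I.states × Fin I.letters × Fin I.states // e ∈ I.aut.δ},
        nState u = e.1.1.val ∧ nState v = e.1.2.2.val ∧
          I.aut.lam * nGap v + I.aut.γ e = nGap u) := by
  have hlam : ¬ I.aut.lam < 0 := not_lt.2 I.aut.lam_pos.le
  rw [gEdge, cTrans_codeInstance, anyItem_flatMap (P := fun e =>
    Nat.beq e.1.1.val (nState u) && Nat.beq e.1.2.2.val (nState v) &&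
    gapEq I.aut.lam.num.natAbs I.aut.lam.den
      (if I.aut.γ e < 0 then 0 else (I.aut.γ e).num.natAbs)
      (if I.aut.γ e < 0 then (I.aut.γ e).num.natAbs else 0)
      (I.aut.γ e).den (nPos u) (nNeg u) (nDen u) (nPos v) (nNeg v) (nDen v))
    (fun e y => by rw [codeTransition]; simp only [List.append_assoc]; exact goesOn_codeNat _ _)
    (fun e y => by
      simp only [codeTransition, List.append_assoc, tRest, tWeight, natRest_codeNat,
        ratRest_codeRat])
    (fun e y => by
      simp only [codeTransition, List.append_assoc, tLeads, tWeight, natRest_codeNat,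
        natVal_codeNat, cLam_codeInstance, ratPos_codeRat, ratDen_codeRat, ratNegPart_codeRat,
        hlam, if_false])]
  simp only [Bool.or_eq_true, Bool.and_eq_true, Nat.ble_eq, Nat.beq_eq, List.any_eq_true, and_assoc]
  refine or_congr_right (and_congr_right fun hu => and_congr_right fun hv => exists_congr fun e => ?_)
  rw [gapEq_iff I.aut.lam.den_pos (I.aut.γ e).den_pos hu hv, rat_parts]
  have h1 : (I.aut.lam.num.natAbs : ℚ) / I.aut.lam.den = I.aut.lam := by
    have := rat_parts I.aut.lam
    simpa [hlam] using this
  rw [h1]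
  refine ⟨fun h => ⟨h.2.1.symm, h.2.2.1.symm, h.2.2.2⟩,
    fun h => ⟨mem_transList I e, h.1.symm, h.2.1.symm, h.2.2⟩⟩

/-- The vertex of a state and a gap. -/
def canon (s : ℕ) (g : ℚ) : ℕ :=
  nodeCode s (if g < 0 then 0 else g.num.natAbs) (if g < 0 then g.num.natAbs else 0) g.den

theorem nGap_canon (s : ℕ) (g : ℚ) : nGap (canon s g) = g := by
  simp only [nGap, canon, nPos_nodeCode, nNeg_nodeCode, nDen_nodeCode]
  exact rat_parts g

theorem gStart_codeInstance : gStart (codeInstance I) = canon I.aut.init.val I.target := by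
  rw [gStart, cInit_codeInstance, cTarget_codeInstance, ratPos_codeRat, ratNegPart_codeRat,
    ratDen_codeRat, canon]

theorem canon_lt {s : ℕ} {g : ℚ} {L : ℕ} (hs : s < 2 ^ L) (hn : g.num.natAbs < 2 ^ L)
    (hd : g.den < 2 ^ L) : canon s g < 2 ^ (22 * L + 14) := by
  have : 0 < 2 ^ L := by positivity
  apply nodeCode_lt hs _ _ hd <;> split_ifs <;> assumption

theorem natVal_lt (x : List CodeSym) : natVal x < 2 ^ x.length := by
  induction x with
  | nil => simp [natVal]
  | cons c x ih =>
    rw [List.length_cons, pow_succ]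
    cases c with
    | bit b => cases b <;> simp [natVal] <;> omega
    | endNum => simp [natVal]
    | endList => simp [natVal]

theorem lt_two_pow_codeNat (n : ℕ) : n < 2 ^ (codeNat n).length := by
  have := natVal_lt (codeNat n ++ [])
  rwa [natVal_codeNat, List.append_nil] at this

end Instance

/-! ## Runs as paths of gaps -/

namespace DSA

variable {α Q : Type*}

/-- The automaton with another initial state. -/
def startAt (A : DSA α Q) (s : Q) : DSA α Q := { A with init := s }

/-- A transition between two states with gaps: a word of value `x.2` from `x.1` whose first
transition is this one continues with a word of value `y.2` from `y.1`. -/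
def GapStep (A : DSA α Q) (x y : Q × ℚ) : Prop :=
  ∃ a, ∃ h : (x.1, a, y.1) ∈ A.δ, A.lam * y.2 + A.γ ⟨_, h⟩ = x.2

variable {A : DSA α Q} {s s' : Q} {a : α} {w : List α}

/-- A run preceded by a transition. -/
def Run.cons (h : (s, a, s') ∈ A.δ) (r : (A.startAt s').Run w) : (A.startAt s).Run (a :: w) where
  state := Fin.cons (α := fun _ => Q) s r.state
  start := rfl
  step := by
    intro i
    refine Fin.cases ?_ (fun i => ?_) i
    · have := r.start
      change (s, a, r.state 0) ∈ A.δ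
      rw [this]; exact h
    · exact r.step i

/-- A run without its first transition. -/
def Run.tail (r : (A.startAt s).Run (a :: w)) : (A.startAt (r.state 1)).Run w where
  state i := r.state i.succ
  start := rfl
  step i := r.step i.succ

theorem Run.first (r : (A.startAt s).Run (a :: w)) : (s, a, r.state 1) ∈ A.δ := by
  have h := r.step 0
  have h0 : r.state (Fin.castSucc 0) = s := r.start
  rw [h0] at h
  exact h

theorem gamma_congr {e e' : Q × α × Q} (h : e = e') (he : e ∈ A.δ) (he' : e' ∈ A.δ) :
    A.γ ⟨e, he⟩ = A.γ ⟨e', he'⟩ := by subst h; rfl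

theorem Run.value_eq_tail (r : (A.startAt s).Run (a :: w)) :
    r.value = A.lam * r.tail.value + A.γ ⟨_, r.first⟩ := by
  unfold Run.value
  refine (Fin.sum_univ_succ (n := w.length) _).trans ?_
  rw [add_comm, Finset.mul_sum]
  congr 1
  · refine Finset.sum_congr rfl fun i _ => ?_
    rw [← mul_assoc, Fin.val_succ, pow_succ']
    rfl
  · rw [Fin.val_zero, pow_zero, one_mul]
    have h0 : r.state (Fin.castSucc 0) = s := r.start
    exact gamma_congr (A := A) (congrArg (fun q => (q, a, r.state 1)) h0) _ _

theorem Run.value_cons (h : (s, a, s') ∈ A.δ) (r : (A.startAt s').Run w) :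
    (Run.cons h r).value = A.lam * r.value + A.γ ⟨_, h⟩ := by
  unfold Run.value
  refine (Fin.sum_univ_succ (n := w.length) _).trans ?_
  rw [add_comm, Finset.mul_sum]
  congr 1
  · refine Finset.sum_congr rfl fun i _ => ?_
    rw [← mul_assoc, Fin.val_succ, pow_succ']
    rfl
  · rw [Fin.val_zero, pow_zero, one_mul]
    have h0 : r.state 0 = s' := r.start
    exact gamma_congr (A := A) (congrArg (fun q => (s, a, q)) h0) _ _

/-- The gaps along the path are the values of the successive tails of the run. -/
theorem exists_path_of_run : ∀ (w : List α) (s : Q) (r : (A.startAt s).Run w), r.IsAccepting →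
    ∃ f ∈ A.accept, ReflTransGen A.GapStep (s, r.value) (f, 0)
  | [], s, r, h => by
    have h0 : r.state (Fin.last _) = s := r.start
    refine ⟨s, h0 ▸ h, ?_⟩
    have : r.value = 0 := Fin.sum_univ_zero _
    rw [this]
  | a :: w, s, r, h => by
    obtain ⟨f, hf, hp⟩ := exists_path_of_run w _ r.tail h
    exact ⟨f, hf, .head ⟨a, r.first, r.value_eq_tail.symm⟩ hp⟩

theorem exists_run_of_path {x y : Q × ℚ} (h : ReflTransGen A.GapStep x y) (hy : y.1 ∈ A.accept)
    (hy0 : y.2 = 0) : ∃ (w : List α) (r : (A.startAt x.1).Run w), r.IsAccepting ∧ r.value = x.2 := by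
  induction h using ReflTransGen.head_induction_on with
  | refl =>
    refine ⟨[], ⟨fun _ => y.1, rfl, fun i => i.elim0⟩, hy, ?_⟩
    rw [hy0]; exact Fin.sum_univ_zero _
  | @head x z hxz _ ih =>
    obtain ⟨w, r, hr, hv⟩ := ih
    obtain ⟨a, ha, hg⟩ := hxz
    exact ⟨a :: w, Run.cons ha r, hr, by rw [Run.value_cons, hv, hg]⟩

theorem exists_run_iff (t : ℚ) :
    (∃ (w : List α) (r : A.Run w), r.IsAccepting ∧ r.value = t) ↔
      ∃ f ∈ A.accept, ReflTransGen A.GapStep (A.init, t) (f, 0) := by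
  constructor
  · rintro ⟨w, r, hr, rfl⟩
    exact exists_path_of_run w A.init r hr
  · rintro ⟨f, hf, h⟩
    exact exists_run_of_path h hf rfl

/-- The infimum ranges over a single value, or over nothing; in the latter case it is `⊤`, which is
not rational. -/
theorem IsFunctional.value_eq_iff (hA : A.IsFunctional) (w : List α) (t : ℚ) :
    A.value w = ((t : ℝ) : EReal) ↔ ∃ r : A.Run w, r.IsAccepting ∧ r.value = t := by
  have key : ∀ r : A.Run w, r.IsAccepting → A.value w = ((r.value : ℝ) : EReal) := fun r hr =>
    le_antisymm (iInf₂_le r hr) (le_iInf₂ fun r' hr' => by rw [hA w r r' hr hr'])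
  constructor
  · intro h
    by_cases hr : ∃ r : A.Run w, r.IsAccepting
    · obtain ⟨r, hr⟩ := hr
      refine ⟨r, hr, ?_⟩
      rw [key r hr] at h
      exact_mod_cast h
    · have : A.value w = ⊤ := iInf₂_eq_top.2 fun r h' => (hr ⟨r, h'⟩).elim
      rw [this] at h
      exact absurd h.symm (EReal.coe_ne_top _)
  · rintro ⟨r, hr, rfl⟩
    exact key r hr

theorem IsUnambiguous.isFunctional (hA : A.IsUnambiguous) : A.IsFunctional :=
  fun w r r' h h' => by rw [hA w r r' h h']

theorem IsDeterministic.isUnambiguous (hA : A.IsDeterministic) : A.IsUnambiguous := by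
  intro w r r' _ _
  have h : ∀ i, r.state i = r'.state i := by
    intro i
    induction i using Fin.induction with
    | zero => rw [r.start, r'.start]
    | succ i ih => exact hA _ _ _ _ (r.step i) (ih ▸ r'.step i)
  cases r; cases r'
  congr
  exact funext h

end DSA

/-! ## Correctness of the decision procedure -/

/-! ### Size of rational numbers from the length of their codes. -/

section Bounds

theorem length_codeNat_le_codeRat (r : ℚ) :
    (codeNat r.num.natAbs).length ≤ (codeRat r).length ∧
      (codeNat r.den).length ≤ (codeRat r).length := by
  simp only [codeRat, List.length_cons, List.length_append]
  omega

theorem natAbs_num_lt (r : ℚ) : r.num.natAbs < 2 ^ (codeRat r).length :=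
  (lt_two_pow_codeNat _).trans_le
    (Nat.pow_le_pow_right two_pos (length_codeNat_le_codeRat r).1)

theorem den_lt (r : ℚ) : r.den < 2 ^ (codeRat r).length :=
  (lt_two_pow_codeNat _).trans_le
    (Nat.pow_le_pow_right two_pos (length_codeNat_le_codeRat r).2)

/-- Each denominator is written out in the input, so the exponents add up to at most the total
length: the common denominator is short although it is a product. -/
theorem prod_den_le {ι : Type*} (f : ι → ℚ) (c : ι → List CodeSym)
    (h : ∀ i, (codeRat (f i)).length ≤ (c i).length) (l : List ι) :
    (l.map fun i => (f i).den).prod ≤ 2 ^ (l.flatMap c).length := by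
  induction l with
  | nil => simp
  | cons i l ih =>
    rw [List.map_cons, List.prod_cons, List.flatMap_cons, List.length_append, pow_add]
    exact Nat.mul_le_mul ((den_lt _).le.trans (Nat.pow_le_pow_right two_pos (h i))) ih

theorem abs_le_natAbs_num (r : ℚ) : |r| ≤ r.num.natAbs := by
  rw [Nat.cast_natAbs, Int.cast_abs]
  nth_rw 1 [← Rat.num_div_den r]
  rw [abs_div, Nat.abs_cast]
  exact div_le_self (abs_nonneg _) (by exact_mod_cast r.den_pos)

/-- A rational number that becomes an integer when multiplied with either of two coprime numbers
is an integer. -/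
theorem exists_int_of_coprime {p q : ℤ} (h : IsCoprime p q) {m : ℚ} {z z' : ℤ}
    (hz : (p : ℚ) * m = z) (hz' : (q : ℚ) * m = z') : ∃ k : ℤ, m = k := by
  obtain ⟨u, v, huv⟩ := h
  refine ⟨u * z + v * z', ?_⟩
  have : (u : ℚ) * p + v * q = 1 := by exact_mod_cast huv
  push_cast
  linear_combination (-m) * this + (u : ℚ) * hz + v * hz'

end Bounds

/-! ### Gaps on successful paths. -/

section Correctness

variable (I : ExactValueInstance)

/-- The product of the denominators of the target and the weights. -/
def commonDen : ℕ := I.target.den * ((transList I).map fun e => (I.aut.γ e).den).prod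

theorem length_codeTransition (e : {e : Fin I.states × Fin I.letters × Fin I.states // e ∈ I.aut.δ}) :
    (codeRat (I.aut.γ e)).length ≤ (codeTransition I.aut e).length := by
  simp only [codeTransition, List.length_append]
  omega

theorem commonDen_le : commonDen I ≤ 2 ^ (codeInstance I).length := by
  refine (Nat.mul_le_mul (den_lt _).le
    (prod_den_le I.aut.γ _ (length_codeTransition I) _)).trans ?_
  rw [← pow_add]
  refine Nat.pow_le_pow_right two_pos ?_
  rw [codeInstance_eq]
  simp only [List.length_append, List.length_cons]
  omega

theorem commonDen_pos : 0 < commonDen I := by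
  refine Nat.mul_pos I.target.den_pos (List.prod_pos ?_)
  simp only [List.mem_map]
  rintro _ ⟨e, _, rfl⟩
  exact (I.aut.γ e).den_pos

theorem exists_int_mul_of_den_dvd {r : ℚ} {D : ℕ} (h : r.den ∣ D) : ∃ z : ℤ, (D : ℚ) * r = z := by
  obtain ⟨c, rfl⟩ := h
  refine ⟨c * r.num, ?_⟩
  push_cast
  linear_combination (c : ℚ) * Rat.den_mul_eq_num r

theorem commonDen_mul_target : ∃ z : ℤ, (commonDen I : ℚ) * I.target = z :=
  exists_int_mul_of_den_dvd (Dvd.intro _ rfl)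

theorem commonDen_mul_weight (e) : ∃ z : ℤ, (commonDen I : ℚ) * I.aut.γ e = z :=
  exists_int_mul_of_den_dvd (Dvd.dvd.mul_left
    (List.dvd_prod (List.mem_map.2 ⟨e, mem_transList I e, rfl⟩)) _)

theorem abs_weight_le (e) : |I.aut.γ e| ≤ (2 : ℚ) ^ (codeInstance I).length := by
  refine (abs_le_natAbs_num _).trans ?_
  have h : (codeTransition I.aut e).length ≤ ((transList I).flatMap (codeTransition I.aut)).length :=
    by
    rw [List.flatMap_def]
    exact (List.sublist_flatten_of_mem (List.mem_map_of_mem (mem_transList I e))).length_le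
  have h' := length_codeTransition I e
  have : (I.aut.γ e).num.natAbs ≤ 2 ^ (codeInstance I).length := by
    refine (natAbs_num_lt _).le.trans (Nat.pow_le_pow_right two_pos ?_)
    rw [codeInstance_eq]
    simp only [List.length_append, List.length_cons]
    omega
  exact_mod_cast this

theorem lam_den_le : I.aut.lam.den ≤ 2 ^ (codeInstance I).length := by
  refine (den_lt _).le.trans (Nat.pow_le_pow_right two_pos ?_)
  rw [codeInstance_eq]
  simp only [List.length_append, List.length_cons]
  omega

theorem state_lt (s : Fin I.states) : s.val < 2 ^ (codeInstance I).length := by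
  refine s.2.trans ((lt_two_pow_codeNat _).trans_le (Nat.pow_le_pow_right two_pos ?_))
  rw [codeInstance_eq]
  simp only [List.length_append, List.length_cons]
  omega

/-- The start vertex needs its own bound, since for soundness it is not known beforehand that the
target reaches gap zero. -/
theorem canon_init_lt : canon I.aut.init.val I.target < 2 ^ gWidth (codeInstance I) := by
  have hle : (codeRat I.target).length ≤ (codeInstance I).length := by
    rw [codeInstance_eq]
    simp only [List.length_append, List.length_cons]
    omega
  have hmono := Nat.pow_le_pow_right two_pos hle
  refine (canon_lt (state_lt I _) ((natAbs_num_lt _).trans_le hmono)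
    ((den_lt _).trans_le hmono)).trans_le (Nat.pow_le_pow_right two_pos ?_)
  rw [gWidth]
  omega

/-- What holds of a gap that is reached from the target. -/
def Reached (g : ℚ) : Prop :=
  ∃ (i : ℕ) (z : ℤ), (I.aut.lam.num : ℚ) ^ i * (commonDen I * g) = z

/-- What holds of a gap that reaches zero. -/
def Reaching (g : ℚ) : Prop :=
  (∃ (j : ℕ) (z : ℤ), (I.aut.lam.den : ℚ) ^ j * (commonDen I * g) = z) ∧
    |g| ≤ 2 ^ (codeInstance I).length * I.aut.lam.den

variable {I}

theorem reached_target : Reached I I.target := by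
  obtain ⟨z, hz⟩ := commonDen_mul_target I
  exact ⟨0, z, by rw [pow_zero, one_mul, hz]⟩

theorem reaching_zero : Reaching I 0 :=
  ⟨⟨0, 0, by simp⟩, by rw [abs_zero]; positivity⟩

variable {x y : Fin I.states × ℚ}

/-- From `λ g' + γ = g` follows `p g' = q (g - γ)`: one more power of `p` clears the new
denominator. -/
theorem Reached.step (h : I.aut.GapStep x y) (hx : Reached I x.2) : Reached I y.2 := by
  obtain ⟨a, ha, hg⟩ := h
  obtain ⟨i, z, hz⟩ := hx
  obtain ⟨k, hk⟩ := commonDen_mul_weight I ⟨_, ha⟩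
  have hl := Rat.den_mul_eq_num I.aut.lam
  refine ⟨i + 1, I.aut.lam.den * (z - I.aut.lam.num ^ i * k), ?_⟩
  push_cast
  rw [← hz, ← hk, ← hg, pow_succ]
  linear_combination (-(I.aut.lam.num : ℚ) ^ i * commonDen I * y.2) * hl

/-- From `q g = p g' + q γ`, one more power of `q` suffices. The bound reproduces itself: `λ (M q) +
M = M (p + 1) ≤ M q`. -/
theorem Reaching.step (h : I.aut.GapStep x y) (hy : Reaching I y.2) : Reaching I x.2 := by
  obtain ⟨a, ha, hg⟩ := h
  obtain ⟨⟨j, z, hz⟩, hb⟩ := hy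
  obtain ⟨k, hk⟩ := commonDen_mul_weight I ⟨_, ha⟩
  have hl := Rat.den_mul_eq_num I.aut.lam
  refine ⟨⟨j + 1, I.aut.lam.num * z + I.aut.lam.den ^ (j + 1) * k, ?_⟩, ?_⟩
  · push_cast
    rw [← hz, ← hk, ← hg, pow_succ]
    linear_combination ((I.aut.lam.den : ℚ) ^ j * commonDen I * y.2) * hl
  · rw [← hg]
    have h1 := abs_weight_le I ⟨_, ha⟩
    -- `λ < 1` gives `p < q`, and these are integers.
    have h2 : (I.aut.lam.num : ℚ) + 1 ≤ I.aut.lam.den := by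
      have h3 : (I.aut.lam.num : ℚ) < I.aut.lam.den := by
        rw [← hl]
        have : (0 : ℚ) < I.aut.lam.den := by exact_mod_cast I.aut.lam.den_pos
        nlinarith [I.aut.lam_lt_one]
      exact_mod_cast h3
    have h4 : (0 : ℚ) ≤ 2 ^ (codeInstance I).length := by positivity
    calc |I.aut.lam * y.2 + I.aut.γ ⟨_, ha⟩|
        ≤ I.aut.lam * |y.2| + |I.aut.γ ⟨_, ha⟩| := by
          refine (abs_add_le _ _).trans ?_
          rw [abs_mul, abs_of_pos I.aut.lam_pos]
      _ ≤ I.aut.lam * (2 ^ (codeInstance I).length * I.aut.lam.den) +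
          2 ^ (codeInstance I).length :=
          add_le_add (mul_le_mul_of_nonneg_left hb I.aut.lam_pos.le) h1
      _ = 2 ^ (codeInstance I).length * (I.aut.lam.num + 1) := by rw [← hl]; ring
      _ ≤ _ := mul_le_mul_of_nonneg_left h2 h4

/-- Powers of `p` and `q` are coprime and both make `D g` an integer, so `D g` is one itself and the
denominator of `g` divides `D`. With the bound on `|g|` this also bounds the numerator. -/
theorem canon_lt_of_reached_reaching (s : Fin I.states) {g : ℚ} (h : Reached I g)
    (h' : Reaching I g) : canon s.val g < 2 ^ gWidth (codeInstance I) := by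
  obtain ⟨i, z, hz⟩ := h
  obtain ⟨⟨j, z', hz'⟩, hb⟩ := h'
  have hcop : IsCoprime (I.aut.lam.num ^ i) ((I.aut.lam.den : ℤ) ^ j) := by
    refine IsCoprime.pow ?_
    rw [Int.isCoprime_iff_gcd_eq_one]
    exact I.aut.lam.reduced
  obtain ⟨k, hk⟩ := exists_int_of_coprime (m := commonDen I * g) hcop
    (by push_cast; exact hz) (by push_cast; exact hz')
  have hD : (commonDen I : ℚ) ≠ 0 := by exact_mod_cast (commonDen_pos I).ne'
  have hg : g = k / (commonDen I : ℤ) := by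
    rw [← hk, Int.cast_natCast, mul_div_cancel_left₀ _ hD]
  have hden : g.den ≤ 2 ^ (codeInstance I).length := by
    refine (Nat.le_of_dvd (commonDen_pos I) ?_).trans (commonDen_le I)
    have := Rat.den_dvd k (commonDen I : ℤ)
    rw [Rat.divInt_eq_div, ← hg] at this
    exact_mod_cast this
  have hlam := lam_den_le I
  set l := (codeInstance I).length with hl
  have hnum : g.num.natAbs ≤ 2 ^ l * 2 ^ l * 2 ^ l := by
    have h1 : (g.num.natAbs : ℚ) = g.den * |g| := by
      rw [Nat.cast_natAbs, Int.cast_abs, ← Rat.den_mul_eq_num g, abs_mul, Nat.abs_cast]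
    have h2 : (g.num.natAbs : ℚ) ≤ 2 ^ l * (2 ^ l * 2 ^ l) := by
      rw [h1]
      refine mul_le_mul (by exact_mod_cast hden) (hb.trans ?_) (abs_nonneg _) (by positivity)
      exact mul_le_mul_of_nonneg_left (by exact_mod_cast hlam) (by positivity)
    rw [mul_assoc]
    exact_mod_cast h2
  rw [← pow_add, ← pow_add] at hnum
  have hs := state_lt I s
  have hmono : ∀ m, m ≤ 3 * l → 2 ^ m < 2 ^ (3 * l + 1) := fun m hm =>
    Nat.pow_lt_pow_right one_lt_two (by omega)
  refine (canon_lt (L := 3 * l + 1) (hs.trans (hmono _ (by omega)))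
    (hnum.trans_lt (hmono _ (by omega))) (hden.trans_lt (hmono _ (by omega)))).trans_le ?_
  -- With `L = 3 l + 1` this is `22 * (3 * l + 1) + 14 ≤ 100 * (l + 1)`.
  refine Nat.pow_le_pow_right two_pos ?_
  rw [gWidth]
  omega

theorem gEdge_canon (h : I.aut.GapStep x y) :
    gEdge (codeInstance I) (canon x.1.val x.2) (canon y.1.val y.2) = true := by
  obtain ⟨a, ha, hg⟩ := h
  rw [gEdge_codeInstance]
  refine Or.inr ⟨?_, ?_, ⟨_, ha⟩, ?_, ?_, ?_⟩
  · rw [canon, nDen_nodeCode]; exact x.2.den_pos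
  · rw [canon, nDen_nodeCode]; exact y.2.den_pos
  · rw [canon, nState_nodeCode]
  · rw [canon, nState_nodeCode]
  · rw [nGap_canon, nGap_canon, hg]

/-- `Reached` is carried forward as a hypothesis of the induction and `Reaching` comes back with its
conclusion, so both hold at every vertex of the path. -/
theorem path_canon (h : ReflTransGen I.aut.GapStep x y) (hy : y.2 = 0) (hx : Reached I x.2) :
    Reaching I x.2 ∧ ReflTransGen (EdgeBelow (gEdge (codeInstance I))
      (2 ^ gWidth (codeInstance I))) (canon x.1.val x.2) (canon y.1.val y.2) := by
  induction h using ReflTransGen.head_induction_on with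
  | refl => exact ⟨hy ▸ reaching_zero, .refl⟩
  | @head x z hxz _ ih =>
    have hz := hx.step hxz
    obtain ⟨h1, h2⟩ := ih hz
    have h3 := h1.step hxz
    exact ⟨h3, .head ⟨canon_lt_of_reached_reaching _ hx h3, canon_lt_of_reached_reaching _ hz h1,
      gEdge_canon hxz⟩ h2⟩

/-- Soundness needs no size bounds: self-loops are dropped and any other edge is a transition
between the decoded states and gaps. -/
theorem path_of_edges {W n : ℕ}
    (h : ReflTransGen (EdgeBelow (gEdge (codeInstance I)) W) (canon x.1.val x.2) n) :
    ∃ s : Fin I.states, nState n = s.val ∧ ReflTransGen I.aut.GapStep x (s, nGap n) := by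
  induction h with
  | refl =>
    refine ⟨x.1, by rw [canon, nState_nodeCode], ?_⟩
    rw [nGap_canon]
  | @tail u v _ huv ih =>
    obtain ⟨s, hs, hp⟩ := ih
    rcases (gEdge_codeInstance I u v).1 huv.2.2 with rfl | ⟨_, _, e, h1, h2, h3⟩
    · exact ⟨s, hs, hp⟩
    · refine ⟨e.1.2.2, h2, hp.tail ⟨e.1.2.1, ?_, ?_⟩⟩
      · have : s = e.1.1 := Fin.ext (hs.symm.trans h1)
        rw [this]; exact e.2
      · have : s = e.1.1 := Fin.ext (hs.symm.trans h1)
        subst this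
        exact h3

theorem solve_codeInstance_iff_path : solve (codeInstance I) = true ↔
    ∃ f ∈ I.aut.accept, ReflTransGen I.aut.GapStep (I.aut.init, I.target) (f, 0) := by
  have hrefl : ∀ u, gEdge (codeInstance I) u u = true := fun u =>
    (gEdge_codeInstance I u u).2 (Or.inl rfl)
  rw [solve, bex_eq_true]
  simp only [Bool.and_eq_true, gStart_codeInstance]
  constructor
  · rintro ⟨v, hv, hacc, hsav⟩
    obtain ⟨hd, h0, q, hq, hqv⟩ := (gAccept_codeInstance I v).1 hacc
    obtain ⟨s, hs, hp⟩ := path_of_edges (x := (I.aut.init, I.target))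
      ((savitch_eq_true hrefl (canon_init_lt I) hv).1 hsav)
    have hqs : q = s := Fin.ext (hqv.symm.trans hs)
    have hg : nGap v = 0 := by rw [nGap, h0, sub_self, zero_div]
    rw [hg] at hp
    exact ⟨s, hqs ▸ hq, hp⟩
  · rintro ⟨f, hf, hp⟩
    obtain ⟨h1, h2⟩ := path_canon hp rfl reached_target
    have hi := canon_lt_of_reached_reaching I.aut.init reached_target h1
    have h0 : Reached I 0 := ⟨0, 0, by simp⟩
    have hv := canon_lt_of_reached_reaching f h0 reaching_zero
    refine ⟨_, hv, ?_, (savitch_eq_true hrefl hi hv).2 h2⟩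
    rw [gAccept_codeInstance]
    refine ⟨?_, ?_, f, hf, ?_⟩ <;> simp [canon]

/-- The procedure decides the existence of an accepting run with the target value for every
automaton; functionality only turns values of runs into values of words. -/
theorem solve_codeInstance (hI : I.aut.IsFunctional) :
    solve (codeInstance I) = true ↔ I.HasSolution := by
  rw [solve_codeInstance_iff_path, ← DSA.exists_run_iff]
  exact exists_congr fun w => (hI.value_eq_iff w I.target).symm

end Correctness

/-- One language, that of `solve`, serves all three classes, since deterministic automata are
unambiguous and unambiguous ones functional. -/
theorem mainTheorem3 :
    DecidableInPSPACEOn codeInstance (fun I => I.aut.IsFunctional)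
      ExactValueInstance.HasSolution ∧
    DecidableInPSPACEOn codeInstance (fun I => I.aut.IsUnambiguous)
      ExactValueInstance.HasSolution ∧
    DecidableInPSPACEOn codeInstance (fun I => I.aut.IsDeterministic)
      ExactValueInstance.HasSolution :=
  ⟨⟨_, PS.solve.inPSPACE, fun _ h => solve_codeInstance h⟩,
    ⟨_, PS.solve.inPSPACE, fun _ h => solve_codeInstance h.isFunctional⟩,
    ⟨_, PS.solve.inPSPACE, fun _ h => solve_codeInstance h.isUnambiguous.isFunctional⟩⟩
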